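/- \textbf{Setting.} Let $\mathsf{k}$, $\mathfrak{h}$, $\mathfrak{h}'$ be complex Hilbert spaces (inner products linear in the second argument), and let $D, D'$ be dense subspaces of $\mathsf{k}$. Put $\hat{\mathsf{k}} = \mathbb{C}\oplus\mathsf{k}$, $\hat{c} = \binom{1}{c}$ for $c\in\mathsf{k}$, and $\hat{D} = \mathrm{Lin}\{\hat{c} : c\in D\}$. Let $\mathcal{F}$ be the symmetric Fock space over $L^2(\mathbb{R}_+;\mathsf{k})$ with exponential vectors $\varepsilon(g) = ((n!)^{-1/2} g^{\otimes n})_{n\ge 0}$; let $\mathbb{S}_D$ be the linear span of the step functions $d_{[0,t[}$ ($d\in D$, $t\ge 0$), $\mathbb{S}=\mathbb{S}_{\mathsf{k}}$, $\mathcal{E}_D = \mathrm{Lin}\{\varepsilon(g) : g\in\mathbb{S}_D\}$, $\mathcal{D} = \mathfrak{h}\,\underline{\otimes}\,\mathcal{E}_D$ and $\mathcal{D}' = \mathfrak{h}'\,\underline{\otimes}\,\mathcal{E}_{D'}$ (algebraic tensor products). For dense subspaces $E\subset H$, $E'\subset H'$ of Hilbert spaces, $\mathcal{O}(E;H')$ is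 the space of operators from $H$ to $H'$ with domain $E$, $\mathcal{O}^{\ddagger}(E,E') = \{T\in\mathcal{O}(E;H') : \mathrm{Dom}\,T^*\supset E'\}$, and $T^{\dagger} = T^*|_{E'}$. A process is a family $(X_t)_{t\ge0}$ in $\mathcal{O}(\mathcal{D};\mathfrak{h}'\otimes\mathcal{F})$ that is weakly measurable and adapted, that is, $\langle u'\varepsilon(g'), X_t u\varepsilon(g)\rangle = \langle u'\varepsilon(g'_{[0,t[}), X_t u\varepsilon(g_{[0,t[})\rangle\,\langle \varepsilon(g'_{[t,\infty[}),\varepsilon(g_{[t,\infty[})\rangle$ for $u\in\mathfrak h$, $g\in\mathbb{S}_D$, $u'\in\mathfrak h'$, $g'\in\mathbb{S}$; similarly for processes with domain $\mathfrak{h}\,\underline{\otimes}\,\hat{D}\,\underline{\otimes}\,\mathcal{E}_D$ and values in $\mathfrak{h}'\otimes\hat{\mathsf{k}}\otimes\mathcal{F}$. For $\varepsilon'\in\mathcal F$ and $\varepsilon\in\mathcal{E}_D$ the slice $\omega_{\varepsilon',\varepsilon}\bullet T$ is the map $\mathfrak{h}\to\mathfrak{h}'$ with $\langle u',(\omega_{\varepsilon',\varepsilon}\bullet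 T)u\rangle = \langle u'\varepsilon',Tu\varepsilon\rangle$. Let $\mathsf{V}$ be a finite-dimensional operator space in $B(\mathfrak{h};\mathfrak{h}')$. A (weak) quantum stochastic cocycle on $\mathsf{V}$ is a family $k = (k_t)_{t\ge0}$ of linear maps $\mathsf{V}\to\mathcal{O}(\mathcal{D};\mathfrak{h}'\otimes\mathcal{F})$ such that each $(k_t(x))_{t\ge 0}$ is a process, $\omega_{\varepsilon',\varepsilon}\bullet k_t(\mathsf{V})\subset\mathsf{V}$ for all $\varepsilon'\in\mathcal{E}_{D'}$, $\varepsilon\in\mathcal{E}_D$, and the maps $k^{g',g}_t := e^{-\langle g'_{[0,t[},g_{[0,t[}\rangle}\,\omega_{\varepsilon(g'_{[0,t[}),\varepsilon(g_{[0,t[})}\bullet k_t$ on $\mathsf{V}$ satisfy $k^{g',g}_0 = \mathrm{id}_{\mathsf{V}}$ and $k^{g',g}_{r+t} = k^{g',g}_r\circ k^{S_r^*g',S_r^*g}_t$ for all $g'\in\mathbb{S}_{D'}$, $g\in\mathbb{S}_D$, $r,t\ge0$, where $(S_r^*g)(s) = g(s+r)$. \textbf{Theorem.} Let $k$ be a quantum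 stochastic cocycle on the finite-dimensional operator space $\mathsf{V}$. Suppose that $k_t(x)\in\mathcal{O}^{\ddagger}(\mathcal{D},\mathcal{D}')$ for all $t\ge 0$, $x\in \mathsf{V}$ and that both $k$ and its conjugate process $k^{\dagger}_t(x^{*}) = k_t(x)^{\dagger}$ have bounded columns that are H\"older $\tfrac12$-continuous at $0$: for all $x\in\mathsf{V}$, $\varepsilon\in\mathcal{E}_D$, the operators $k_{t,|\varepsilon\rangle}(x): u\mapsto k_t(x)u\varepsilon$ from $\mathfrak{h}$ to $\mathfrak{h}'\otimes\mathcal{F}$ are bounded for every $t\ge 0$ and $\|k_{s,|\varepsilon\rangle}(x)-k_{0,|\varepsilon\rangle}(x)\| = O(s^{1/2})$ as $s\to0^+$, and likewise for $k^\dagger$ with $\varepsilon\in\mathcal{E}_{D'}$. Then there is a linear map $\phi : \mathsf{V}\to\mathsf{V}\,\underline{\otimes}\,\mathcal{O}^{\ddagger}(\hat{D},\widehat{D'})$ such that $k = k^{\phi}$. That is, writing $\phi^{\zeta'}_{\zeta} = (\mathrm{id}\otimes\omega_{\zeta',\zeta})\circ\phi$ with $\omega_{\zeta',\zeta}(T)=\langle\zeta',T\zeta\rangle$: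 (i) $k$ is a strong solution of $dk_t = k_t\bullet d\Lambda_{\phi}(t)$, $k_0(x) = x\otimes I$: there is a linear process $K$ on $\mathsf{V}$, with values in $\mathcal{O}(\mathfrak{h}\,\underline{\otimes}\,\hat{D}\,\underline{\otimes}\,\mathcal{E}_D;\mathfrak{h}'\otimes\hat{\mathsf{k}}\otimes\mathcal{F})$, for which every $s\mapsto K_s(x)u\zeta\varepsilon$ is strongly measurable and locally square-integrable, such that $\omega_{\zeta',\zeta}\bullet K_t = k_t\circ\phi^{\zeta'}_{\zeta}$ for $\zeta'\in\widehat{D'}$, $\zeta\in\hat{D}$, and $k_t(x) = x\otimes I+\int_0^t K_s(x)\,d\Lambda_s$ as a quantum stochastic integral, the latter being determined by $\langle u'\varepsilon(g'),\int_0^tF_s\,d\Lambda_s\,u\varepsilon(g)\rangle = \int_0^t\langle u'\widehat{g'}(s)\varepsilon(g'),F_su\hat{g}(s)\varepsilon(g)\rangle\,ds$ for $u'\in\mathfrak h'$, $g'\in\mathbb{S}$, $u\in\mathfrak h$, $g\in\mathbb{S}_D$; (ii) $\omega_{\varepsilon',\varepsilon}\bullet k_t(\mathsf{V})\subset\mathsf{V}$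 for all $\varepsilon'\in\mathcal{E}_{\mathsf{k}}$, $\varepsilon\in\mathcal{E}_D$, $t\ge 0$; (iii) $k$ is the only linear process on $\mathsf{V}$ that is a weak solution of this equation, that is, for which $t\mapsto\langle\xi',k_t(x)\xi\rangle$ is continuous for all $\xi'\in\mathcal{D}'$, $\xi\in\mathcal{D}$, $x\in \mathsf{V}$, and $\langle u'\varepsilon(g'),k_t(x)u\varepsilon(g)\rangle-\langle u',xu\rangle\langle\varepsilon(g'),\varepsilon(g)\rangle = \int_0^t\langle u'\varepsilon(g'),k_s(\phi^{\widehat{g'}(s)}_{\hat{g}(s)}(x))u\varepsilon(g)\rangle\,ds$ for $u'\in\mathfrak h'$, $g'\in\mathbb{S}_{D'}$, $u\in\mathfrak h$, $g\in\mathbb{S}_D$, $t\ge 0$. -/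

import Mathlib

open MeasureTheory TensorProduct
open scoped NNReal InnerProductSpace ENNReal

namespace QS

noncomputable section

universe u v w

/-! ### Hilbert space tensor products, bras and kets -/

section HilbertTensor

variable (H : Type u) [NormedAddCommGroup H] [InnerProductSpace ℂ H]
variable (K : Type v) [NormedAddCommGroup K] [InnerProductSpace ℂ K]

/-- The Hilbert space tensor product: the completion of the algebraic tensor product for
`⟪u ⊗ ζ, u' ⊗ ζ'⟫ = ⟪u, u'⟫ ⟪ζ, ζ'⟫`. -/
def HTensor : Type (max u v) := UniformSpace.Completion (H ⊗[ℂ] K)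

instance : NormedAddCommGroup (HTensor H K) :=
  inferInstanceAs (NormedAddCommGroup (UniformSpace.Completion (H ⊗[ℂ] K)))

instance : InnerProductSpace ℂ (HTensor H K) :=
  inferInstanceAs (InnerProductSpace ℂ (UniformSpace.Completion (H ⊗[ℂ] K)))

instance : CompleteSpace (HTensor H K) :=
  inferInstanceAs (CompleteSpace (UniformSpace.Completion (H ⊗[ℂ] K)))

variable {H K}

/-- The inclusion of the algebraic tensor product in its completion. -/
def toHTensor : H ⊗[ℂ] K →L[ℂ] HTensor H K :=
  (UniformSpace.Completion.toComplL : H ⊗[ℂ] K →L[ℂ] UniformSpace.Completion (H ⊗[ℂ] K))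

/-- The ampliated ket `E_ζ : H → H ⊗ K`, `u ↦ u ⊗ ζ`. -/
def ket (ζ : K) : H →L[ℂ] HTensor H K :=
  toHTensor.comp ((TensorProduct.mkL ℂ H K).flip ζ)

/-- The simple tensor `u ⊗ ζ` in the Hilbert space tensor product. -/
def tmulH (u : H) (ζ : K) : HTensor H K := ket ζ u

/-- The ampliated bra `E^ζ : H ⊗ K → H`, the adjoint of `E_ζ`. -/
def bra [CompleteSpace H] (ζ : K) : HTensor H K →L[ℂ] H := (ket ζ).adjoint

/-- The algebraic tensor product `A ⊙ B` of subspaces, as a subspace of `H ⊗ K`. -/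
def algTensor (A : Submodule ℂ H) (B : Submodule ℂ K) : Submodule ℂ (HTensor H K) :=
  Submodule.span ℂ {x | ∃ a ∈ A, ∃ b ∈ B, x = tmulH a b}

theorem tmulH_mem {A : Submodule ℂ H} {B : Submodule ℂ K} {a : H} {b : K}
    (ha : a ∈ A) (hb : b ∈ B) : tmulH a b ∈ algTensor A B :=
  Submodule.subset_span ⟨a, ha, b, hb, rfl⟩

theorem norm_tmulH (u : H) (ζ : K) : ‖tmulH u ζ‖ = ‖u‖ * ‖ζ‖ := by
  change ‖((u ⊗ₜ[ℂ] ζ : H ⊗[ℂ] K) : UniformSpace.Completion (H ⊗[ℂ] K))‖ = _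
  rw [UniformSpace.Completion.norm_coe]
  exact TensorProduct.norm_tmul u ζ

end HilbertTensor

/-! ### Symmetric Fock space and exponential vectors -/

section Fock

/-- A bundled complex Hilbert space (used only to define tensor powers by recursion). -/
structure HilbSp : Type (u + 1) where
  carrier : Type u
  [ng : NormedAddCommGroup carrier]
  [ip : InnerProductSpace ℂ carrier]
  [cs : CompleteSpace carrier]

attribute [instance] HilbSp.ng HilbSp.ip HilbSp.cs

variable (H : Type u) [NormedAddCommGroup H] [InnerProductSpace ℂ H]

/-- The Hilbert space tensor powers: `H^{⊗ 0}` is the one-dimensional Hilbert space (in the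
universe of `H`), and `H^{⊗ (n+1)} = H ⊗ H^{⊗ n}`. -/
def tensorPowerSp : ℕ → HilbSp.{u}
  | 0 => ⟨EuclideanSpace ℂ PUnit.{u + 1}⟩
  | n + 1 => ⟨HTensor H (tensorPowerSp n).carrier⟩

/-- The `n`-th Hilbert space tensor power of `H`. -/
abbrev TPow (n : ℕ) : Type u := (tensorPowerSp H n).carrier

variable {H}

/-- The power `f^{⊗ n}`. -/
def tpow (f : H) : (n : ℕ) → TPow H n
  | 0 => (WithLp.toLp 2 (fun _ : PUnit.{u + 1} => (1 : ℂ)) : EuclideanSpace ℂ PUnit.{u + 1})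
  | n + 1 => (tmulH f (tpow f n) : HTensor H (tensorPowerSp H n).carrier)

theorem norm_tpow (f : H) (n : ℕ) : ‖tpow f n‖ = ‖f‖ ^ n := by
  induction n with
  | zero =>
    change ‖(WithLp.toLp 2 (fun _ : PUnit.{u + 1} => (1 : ℂ)) :
      EuclideanSpace ℂ PUnit.{u + 1})‖ = _
    simp [EuclideanSpace.norm_eq]
  | succ n ih =>
    change ‖(tmulH f (tpow f n) : HTensor H (tensorPowerSp H n).carrier)‖ = _
    rw [norm_tmulH, ih, pow_succ, mul_comm]

variable (H) in
/-- The full Fock space `⨁ₙ H^{⊗ n}`. -/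
abbrev FullFock : Type u := lp (fun n : ℕ => TPow H n) 2

variable (H) in
/-- The symmetric Fock space over `H`, inside the full Fock space: the `n`-th component lies in
the symmetric tensor power, the closed linear span of the powers `f^{⊗ n}`. -/
def symFock : Submodule ℂ (FullFock H) where
  carrier := {x | ∀ n : ℕ,
    (x : ∀ n, TPow H n) n ∈
      (Submodule.span ℂ (Set.range fun f : H => tpow f n)).topologicalClosure}
  zero_mem' _ := Submodule.zero_mem _
  add_mem' hx hy n := Submodule.add_mem _ (hx n) (hy n)
  smul_mem' c _ hx n := Submodule.smul_mem _ c (hx n)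

theorem expVec_memℓp (f : H) :
    Memℓp (fun n : ℕ => (((Real.sqrt (n.factorial : ℝ))⁻¹ : ℝ) : ℂ) • tpow f n) 2 := by
  have h2 : (0 : ℝ) < (2 : ℝ≥0∞).toReal := by norm_num
  refine memℓp_gen ?_
  have h := Real.summable_pow_div_factorial (‖f‖ ^ 2)
  refine h.congr fun n => ?_
  have hn : (0 : ℝ) ≤ (n.factorial : ℝ) := by positivity
  rw [norm_smul, norm_tpow, Complex.norm_real, norm_inv, Real.norm_of_nonneg (Real.sqrt_nonneg _)]
  simp only [ENNReal.toReal_ofNat, Real.rpow_ofNat]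
  rw [mul_pow, inv_pow, Real.sq_sqrt hn, ← pow_mul, ← pow_mul, mul_comm n 2, div_eq_inv_mul]

/-- The exponential vector `ε(f) = ((n!)^{-1/2} f^{⊗ n})ₙ`. -/
def expVec (f : H) : symFock H :=
  ⟨⟨fun n : ℕ => (((Real.sqrt (n.factorial : ℝ))⁻¹ : ℝ) : ℂ) • tpow f n, expVec_memℓp f⟩,
    fun _ => Submodule.smul_mem _ _
      (Submodule.le_topologicalClosure _ (Submodule.subset_span ⟨f, rfl⟩))⟩

end Fock

/-! ### Step functions and exponential domains -/

section Step

variable (k : Type u) [NormedAddCommGroup k] [InnerProductSpace ℂ k]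

/-- `L²(ℝ₊; k)`. -/
abbrev L2 : Type u := Lp k 2 (volume.restrict (Set.Ici (0 : ℝ)))

/-- The symmetric Fock space over `L²(ℝ₊; k)`. -/
abbrev NoiseFock : Type u := symFock (L2 k)

/-- `k̂ = ℂ ⊕ k` (orthogonal sum). -/
abbrev KHat : Type u := WithLp 2 (ℂ × k)

variable {k}

/-- `ĉ = (1, c)`. -/
def hat (c : k) : KHat k := WithLp.toLp 2 ((1 : ℂ), c)

/-- `D̂ = Lin {ĉ : c ∈ D}`. -/
def hatSub (D : Submodule ℂ k) : Submodule ℂ (KHat k) :=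
  Submodule.span ℂ (hat '' (D : Set k))

/-- The right-continuous `D`-valued step functions: the linear span of the functions
`d_{[0,t[}`, `d ∈ D`, `t ≥ 0` (functions on `ℝ₊` are extended by zero to `ℝ`). -/
def Step (D : Submodule ℂ k) : Submodule ℂ (ℝ → k) :=
  Submodule.span ℂ {f | ∃ d ∈ D, ∃ t : ℝ, 0 ≤ t ∧ f = (Set.Ico 0 t).indicator fun _ => d}

theorem Step.apply_mem {D : Submodule ℂ k} {g : ℝ → k} (hg : g ∈ Step D) (s : ℝ) : g s ∈ D := by
  induction hg using Submodule.span_induction with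
  | mem f hf =>
    obtain ⟨d, hd, t, -, rfl⟩ := hf
    by_cases h : s ∈ Set.Ico 0 t
    · simpa [h] using hd
    · simp [h]
  | zero => simp
  | add f g _ _ hf hg => exact D.add_mem hf hg
  | smul c f _ hf => exact D.smul_mem c hf

theorem Step.memLp {D : Submodule ℂ k} {g : ℝ → k} (hg : g ∈ Step D) :
    MemLp g 2 (volume.restrict (Set.Ici (0 : ℝ))) := by
  induction hg using Submodule.span_induction with
  | mem f hf =>
    obtain ⟨d, hd, t, -, rfl⟩ := hf
    refine memLp_indicator_const 2 measurableSet_Ico d (Or.inr ?_)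
    exact ((Measure.restrict_apply_le _ _).trans_lt (by simp)).ne
  | zero => exact MemLp.zero
  | add f g _ _ hf hg => exact hf.add hg
  | smul c f _ hf => exact hf.const_smul c

open Classical in
/-- The class in `L²(ℝ₊; k)` of a square-integrable function (only used for such functions). -/
def toL2 (f : ℝ → k) : L2 k :=
  if h : MemLp f 2 (volume.restrict (Set.Ici (0 : ℝ))) then h.toLp f else 0

/-- The exponential vector `ε(g)` of a square-integrable function `g` on `ℝ₊`. -/
def ev (g : ℝ → k) : NoiseFock k := expVec (toL2 g)

/-- `Exps D = Lin {ε(g) : g ∈ Step D}`. -/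
def Exps (D : Submodule ℂ k) : Submodule ℂ (NoiseFock k) :=
  Submodule.span ℂ {x | ∃ g ∈ Step D, x = ev g}

/-- `g_{[0,t[}`. -/
def before (t : ℝ≥0) (g : ℝ → k) : ℝ → k := (Set.Ico 0 (t : ℝ)).indicator g

/-- `g_{[t,∞[}`. -/
def after (t : ℝ≥0) (g : ℝ → k) : ℝ → k := (Set.Ici (t : ℝ)).indicator g

/-- The adjoint `S_r^*` of the right shift: `(S_r^* g)(s) = g(s + r)` for `s ≥ 0`. -/
def shift (r : ℝ≥0) (g : ℝ → k) : ℝ → k := (Set.Ici (0 : ℝ)).indicator fun s => g (s + r)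

theorem Step.indicator_mem {D : Submodule ℂ k} {d : k} (hd : d ∈ D) (t : ℝ) :
    ((Set.Ico 0 t).indicator fun _ => d) ∈ Step D := by
  rcases le_total 0 t with h | h
  · exact Submodule.subset_span ⟨d, hd, t, h, rfl⟩
  · simp only [Set.Ico_eq_empty (not_lt.mpr h), Set.indicator_empty]
    exact Submodule.zero_mem _

theorem Step.before_mem {D : Submodule ℂ k} {g : ℝ → k} (hg : g ∈ Step D) (t : ℝ≥0) :
    before t g ∈ Step D := by
  induction hg using Submodule.span_induction with
  | mem f hf =>
    obtain ⟨d, hd, s, -, rfl⟩ := hf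
    have := Step.indicator_mem hd (min t s)
    rwa [before, Set.indicator_indicator, Set.Ico_inter_Ico, max_self]
  | zero =>
    have : before t (0 : ℝ → k) = 0 := Set.indicator_zero _ _
    rw [this]; exact Submodule.zero_mem _
  | add f g _ _ hf hg =>
    have : before t (f + g) = before t f + before t g := Set.indicator_add' _ _ _
    rw [this]; exact Submodule.add_mem _ hf hg
  | smul c f _ hf =>
    have : before t (c • f) = c • before t f := Set.indicator_const_smul _ _ _
    rw [this]; exact Submodule.smul_mem _ c hf

theorem Step.shift_mem {D : Submodule ℂ k} {g : ℝ → k} (hg : g ∈ Step D) (r : ℝ≥0) :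
    shift r g ∈ Step D := by
  induction hg using Submodule.span_induction with
  | mem f hf =>
    obtain ⟨d, hd, s, -, rfl⟩ := hf
    have := Step.indicator_mem hd (s - r)
    convert this using 1
    ext x
    have hr := r.coe_nonneg
    simp only [shift, Set.indicator_apply, Set.mem_Ici, Set.mem_Ico]
    split_ifs <;> first | rfl | (exfalso; grind)
  | zero =>
    have : shift r (0 : ℝ → k) = 0 := Set.indicator_zero _ _
    rw [this]; exact Submodule.zero_mem _
  | add f g _ _ hf hg =>
    have : shift r (f + g) = shift r f + shift r g := Set.indicator_add _ _ _
    rw [this]; exact Submodule.add_mem _ hf hg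
  | smul c f _ hf =>
    have : shift r (c • f) = c • shift r f := Set.indicator_const_smul _ _ _
    rw [this]; exact Submodule.smul_mem _ c hf

theorem ev_mem {D : Submodule ℂ k} {g : ℝ → k} (hg : g ∈ Step D) : ev g ∈ Exps D :=
  Submodule.subset_span ⟨g, hg, rfl⟩

theorem hat_mem {D : Submodule ℂ k} {c : k} (hc : c ∈ D) : hat c ∈ hatSub D :=
  Submodule.subset_span ⟨c, hc, rfl⟩

variable {H : Type v} [NormedAddCommGroup H] [InnerProductSpace ℂ H]

/-- The exponential domain `𝔇 ⊙ Exps D` in `H ⊗ F`. -/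
def expDomain (Dom : Submodule ℂ H) (D : Submodule ℂ k) : Submodule ℂ (HTensor H (NoiseFock k)) :=
  algTensor Dom (Exps D)

/-- The vector `v ε` of an exponential domain. -/
def domVec {Dom : Submodule ℂ H} {D : Submodule ℂ k} (a : Dom) (e : Exps D) : expDomain Dom D :=
  ⟨tmulH (a : H) (e : NoiseFock k), tmulH_mem a.2 e.2⟩

end Step

/-! ### Unbounded operators with a fixed domain -/

section Operators

variable {H : Type u} [NormedAddCommGroup H] [InnerProductSpace ℂ H]
variable {K : Type v} [NormedAddCommGroup K] [InnerProductSpace ℂ K]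

/-- `Op(E; K)`: the operators from `H` to `K` with domain `E`. -/
abbrev Op (E : Submodule ℂ H) (K : Type v) [NormedAddCommGroup K] [InnerProductSpace ℂ K] :
    Type (max u v) := E →ₗ[ℂ] K

/-- The Hilbert space adjoint of an operator with domain `E`. -/
def adj [CompleteSpace H] {E : Submodule ℂ H} (T : Op E K) : K →ₗ.[ℂ] H :=
  LinearPMap.adjoint ⟨E, T⟩

/-- `Op‡(E, E')`: the operators with domain `E` whose adjoint is defined on `E'`. -/
def OpDagger [CompleteSpace H] (E : Submodule ℂ H) (E' : Submodule ℂ K) :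
    Submodule ℂ (Op E K) where
  carrier := {T | E' ≤ (adj T).domain}
  zero_mem' y _ := by
    change Continuous fun x : E => ⟪y, (0 : K)⟫_ℂ
    exact continuous_const
  add_mem' {S T} hS hT y hy := by
    have h1 : Continuous fun x : E => ⟪y, S x⟫_ℂ := hS hy
    have h2 : Continuous fun x : E => ⟪y, T x⟫_ℂ := hT hy
    change Continuous fun x : E => ⟪y, S x + T x⟫_ℂ
    simp only [inner_add_right]
    exact h1.add h2
  smul_mem' c T hT y hy := by
    have h1 : Continuous fun x : E => ⟪y, T x⟫_ℂ := hT hy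
    change Continuous fun x : E => ⟪y, c • T x⟫_ℂ
    simp only [inner_smul_right]
    exact continuous_const.mul h1

/-- The conjugate `T† = T^*|_{E'}` of an operator `T ∈ Op‡(E, E')`. -/
def opConj [CompleteSpace H] {E : Submodule ℂ H} {E' : Submodule ℂ K} (T : Op E K)
    (hT : T ∈ OpDagger E E') : Op E' H :=
  (adj T).toFun ∘ₗ Submodule.inclusion hT

/-- The functional `ω_{ζ',ζ} : T ↦ ⟪ζ', T ζ⟫` on `Op(E; K)`. -/
def omega {E : Submodule ℂ H} (ζ' : K) (ζ : E) : Op E K →ₗ[ℂ] ℂ :=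
  (innerSL ℂ ζ').toLinearMap ∘ₗ LinearMap.applyₗ ζ

end Operators

/-! ### Processes -/

section Processes

variable {k : Type u} [NormedAddCommGroup k] [InnerProductSpace ℂ k]
variable {H : Type v} [NormedAddCommGroup H] [InnerProductSpace ℂ H]
variable {H' : Type w} [NormedAddCommGroup H'] [InnerProductSpace ℂ H']
variable {Dom : Submodule ℂ H} {D : Submodule ℂ k}

/-- Weakly measurable and adapted families `X : ℝ₊ → Op(𝔇 ⊙ Exps D; H' ⊗ F)`. -/
structure IsProcess (X : ℝ≥0 → Op (expDomain Dom D) (HTensor H' (NoiseFock k))) : Prop where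
  measurable : ∀ (ξ' : HTensor H' (NoiseFock k)) (ξ : expDomain Dom D),
    Measurable fun t => ⟪ξ', X t ξ⟫_ℂ
  adapted : ∀ (t : ℝ≥0) (a : Dom) (g : ℝ → k) (hg : g ∈ Step D) (a' : H'),
    ∀ g' ∈ Step (⊤ : Submodule ℂ k),
    ⟪tmulH a' (ev g'), X t (domVec a ⟨ev g, ev_mem hg⟩)⟫_ℂ =
      ⟪tmulH a' (ev (before t g')),
          X t (domVec a ⟨ev (before t g), ev_mem (Step.before_mem hg t)⟩)⟫_ℂ *
        ⟪ev (after t g'), ev (after t g)⟫_ℂ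

/-- The column `T E_ε : H → H' ⊗ F`, `u ↦ T (u ε)`. -/
def column (T : Op (expDomain (⊤ : Submodule ℂ H) D) (HTensor H' (NoiseFock k))) (e : Exps D) :
    H →ₗ[ℂ] HTensor H' (NoiseFock k) :=
  T ∘ₗ (ket (e : NoiseFock k)).toLinearMap.codRestrict (expDomain (⊤ : Submodule ℂ H) D)
    (fun _ => tmulH_mem Submodule.mem_top e.2)

/-- The slice `T ↦ ω_{ε',ε} • T = E^{ε'} T E_ε`. -/
def slice [CompleteSpace H'] (e' : NoiseFock k) (e : Exps D) :
    Op (expDomain (⊤ : Submodule ℂ H) D) (HTensor H' (NoiseFock k)) →ₗ[ℂ] (H →ₗ[ℂ] H') where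
  toFun T := (bra e').toLinearMap ∘ₗ column T e
  map_add' _ _ := by ext u; simp [column]
  map_smul' _ _ := by ext u; simp [column]

/-- `x ↦ k_{t,|ε⟩}(x)` has bounded values and is Hölder continuous at `0` with exponent `1/2`, in
the operator norm, for each `x` (in the index set `ι`) and each `ε ∈ Exps D`. -/
structure HasHolderColumns {ι : Type*}
    (X : ℝ≥0 → ι → Op (expDomain (⊤ : Submodule ℂ H) D) (HTensor H' (NoiseFock k))) : Prop where
  bounded : ∀ (t : ℝ≥0) (x : ι) (e : Exps D), ∃ C : ℝ, ∀ a : H, ‖column (X t x) e a‖ ≤ C * ‖a‖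
  holder : ∀ (x : ι) (e : Exps D), ∃ C : ℝ, ∃ δ : ℝ≥0, 0 < δ ∧ ∀ s : ℝ≥0, s < δ → ∀ a : H,
    ‖column (X s x) e a - column (X 0 x) e a‖ ≤ C * Real.sqrt s * ‖a‖

end Processes

/-! ### Cocycles on a concrete operator space -/

section Cocycles

variable {k : Type u} [NormedAddCommGroup k] [InnerProductSpace ℂ k]
variable {h : Type v} [NormedAddCommGroup h] [InnerProductSpace ℂ h]
variable {h' : Type w} [NormedAddCommGroup h'] [InnerProductSpace ℂ h']

/-- Families `(k_t)` of linear maps from `V` to `Op(h ⊙ Exps D; h' ⊗ F)`. -/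
abbrev OpFamily (V : Submodule ℂ (h →L[ℂ] h')) (D : Submodule ℂ k) :=
  ℝ≥0 → V →ₗ[ℂ] Op (expDomain (⊤ : Submodule ℂ h) D) (HTensor h' (NoiseFock k))

/-- The inclusion of `V` in the space of all linear maps from `h` to `h'`. -/
def inclLin (V : Submodule ℂ (h →L[ℂ] h')) : V →ₗ[ℂ] (h →ₗ[ℂ] h') :=
  ContinuousLinearMap.coeLM ℂ ∘ₗ V.subtype

theorem inclLin_injective (V : Submodule ℂ (h →L[ℂ] h')) : Function.Injective (inclLin V) :=
  fun _ _ hxy => Subtype.ext (ContinuousLinearMap.coe_injective hxy)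

variable [CompleteSpace h'] {V : Submodule ℂ (h →L[ℂ] h')} {D : Submodule ℂ k}

/-- `ω_{ε',ε} • k_t (V) ⊆ V` for all `ε' ∈ Exps D'`, `ε ∈ Exps D`, `t ≥ 0`. -/
def SlicesInto (kk : OpFamily V D) (D' : Submodule ℂ k) : Prop :=
  ∀ (t : ℝ≥0) (x : V) (e' : Exps D') (e : Exps D),
    slice (e' : NoiseFock k) e (kk t x) ∈ LinearMap.range (inclLin V)

/-- The map `ω_{ε',ε} • k_t ∈ L(V)`. -/
def sliceMap {D' : Submodule ℂ k} {kk : OpFamily V D} (hk : SlicesInto kk D') (t : ℝ≥0)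
    (e' : Exps D') (e : Exps D) : V →ₗ[ℂ] V :=
  (LinearEquiv.ofInjective (inclLin V) (inclLin_injective V)).symm.toLinearMap ∘ₗ
    (slice (e' : NoiseFock k) e ∘ₗ kk t).codRestrict _ (fun x => hk t x e' e)

/-- `k^{g',g}_t = exp(-⟪g'_{[0,t[}, g_{[0,t[}⟫) ω_{ε(g'_{[0,t[}),ε(g_{[0,t[})} • k_t ∈ L(V)`. -/
def kgg {D' : Submodule ℂ k} {kk : OpFamily V D} (hk : SlicesInto kk D')
    (g' : Step D') (g : Step D) (t : ℝ≥0) : V →ₗ[ℂ] V :=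
  Complex.exp (-⟪toL2 (before t (g' : ℝ → k)), toL2 (before t (g : ℝ → k))⟫_ℂ) •
    sliceMap hk t ⟨_, ev_mem (Step.before_mem g'.2 t)⟩ ⟨_, ev_mem (Step.before_mem g.2 t)⟩

/-- The class of processes on `V` which are weak quantum stochastic cocycles: `k^{g',g}_0 = id`
and `k^{g',g}_{r+t} = k^{g',g}_r ∘ k^{S_r^* g', S_r^* g}_t`. -/
structure IsCocycle (kk : OpFamily V D) (D' : Submodule ℂ k) : Prop where
  isProcess : ∀ x, IsProcess fun t => kk t x
  slices : SlicesInto kk D'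
  zero : ∀ (g' : Step D') (g : Step D), kgg slices g' g 0 = LinearMap.id
  add : ∀ (g' : Step D') (g : Step D) (r t : ℝ≥0),
    kgg slices g' g (r + t) =
      kgg slices g' g r ∘ₗ
        kgg slices ⟨_, Step.shift_mem g'.2 r⟩ ⟨_, Step.shift_mem g.2 r⟩ t

/-- Cocycles `k` which have a conjugate process `k†_t(x†) = k_t(x)†` on `h' ⊙ Exps D'`, such that
both `k` and `k†` have bounded columns that are Hölder `1/2`-continuous at `0`. -/
structure IsHolderCocycle (kk : OpFamily V D) (D' : Submodule ℂ k) : Prop where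
  cocycle : IsCocycle kk D'
  dagger : ∀ t x, kk t x ∈ OpDagger (expDomain (⊤ : Submodule ℂ h) D)
    (expDomain (⊤ : Submodule ℂ h') D')
  holder : HasHolderColumns fun t x => kk t x
  holder_conj : HasHolderColumns fun t x => opConj (kk t x) (dagger t x)

end Cocycles

/-! ### Quantum stochastic integrals and differential equations -/

section QSDE

variable {k : Type u} [NormedAddCommGroup k] [InnerProductSpace ℂ k]
variable {h : Type v} [NormedAddCommGroup h] [InnerProductSpace ℂ h]
variable {h' : Type w} [NormedAddCommGroup h'] [InnerProductSpace ℂ h']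

/-- The domain `(h ⊙ D̂) ⊙ Exps D` in `(h ⊗ k̂) ⊗ F`. -/
abbrev integrandDomain (h : Type v) [NormedAddCommGroup h] [InnerProductSpace ℂ h]
    (D : Submodule ℂ k) : Submodule ℂ (HTensor (HTensor h (KHat k)) (NoiseFock k)) :=
  expDomain (algTensor (⊤ : Submodule ℂ h) (hatSub D)) D

/-- The vector `u ζ ε` of `(h ⊙ D̂) ⊙ Exps D`. -/
def domVec3 {D : Submodule ℂ k} (a : h) (ζ : hatSub D) (e : Exps D) : integrandDomain h D :=
  domVec ⟨tmulH a (ζ : KHat k), tmulH_mem Submodule.mem_top ζ.2⟩ e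

/-- Quantum stochastic integrability of a process `F`: for all `u`, `ζ`, `ε` the function
`s ↦ F_s (u ζ ε)` is strongly measurable and locally square-integrable. -/
structure IsQSIntegrable {D : Submodule ℂ k}
    (F : ℝ≥0 → Op (integrandDomain h D) (HTensor (HTensor h' (KHat k)) (NoiseFock k))) :
    Prop where
  isProcess : IsProcess F
  memLp : ∀ (T : ℝ≥0) (a : h) (ζ : hatSub D) (e : Exps D),
    MemLp (fun s : ℝ => F s.toNNReal (domVec3 a ζ e)) 2 (volume.restrict (Set.Icc 0 (T : ℝ)))

/-- The time plus Hitsuda–Skorohod integral over `[0,t]` of `z : ℝ₊ → h' ⊗ k̂ ⊗ F`, namely the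
value `y` at `z 1_{[0,t]}` of the adjoint of the extended gradient operator
`u' ε(g') ↦ (s ↦ u' ĝ'(s) ε(g'))`. -/
def IsDivergence (z : ℝ → HTensor (HTensor h' (KHat k)) (NoiseFock k)) (t : ℝ≥0)
    (y : HTensor h' (NoiseFock k)) : Prop :=
  ∀ (a' : h'), ∀ g' ∈ Step (⊤ : Submodule ℂ k),
    ⟪tmulH a' (ev g'), y⟫_ℂ =
      ∫ s in (0 : ℝ)..t, ⟪tmulH (tmulH a' (hat (g' s))) (ev g'), z s⟫_ℂ

/-- `y = (∫₀ᵗ F_s dΛ_s) u ε(g)`: the divergence over `[0,t]` of `s ↦ F_s (u ĝ(s) ε(g))`. -/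
def IsQSIntegralAt {D : Submodule ℂ k}
    (F : ℝ≥0 → Op (integrandDomain h D) (HTensor (HTensor h' (KHat k)) (NoiseFock k)))
    (t : ℝ≥0) (a : h) (g : Step D) (y : HTensor h' (NoiseFock k)) : Prop :=
  IsDivergence (fun s : ℝ => F s.toNNReal
    (domVec3 a ⟨hat ((g : ℝ → k) s), hat_mem (Step.apply_mem g.2 s)⟩ ⟨_, ev_mem g.2⟩)) t y

variable [CompleteSpace k]
variable {V : Submodule ℂ (h →L[ℂ] h')} {D D' : Submodule ℂ k}

/-- The component `φ^{ζ'}_ζ = (id ⊗ ω_{ζ',ζ}) ∘ φ ∈ L(V)` of a map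
`φ ∈ L(V; V ⊙ Op‡(D̂, D̂'))`. -/
def component (φ : V →ₗ[ℂ] V ⊗[ℂ] OpDagger (hatSub D) (hatSub D'))
    (ζ' : KHat k) (ζ : hatSub D) : V →ₗ[ℂ] V :=
  (TensorProduct.rid ℂ V).toLinearMap ∘ₗ
    LinearMap.lTensor V (omega ζ' ζ ∘ₗ (OpDagger (hatSub D) (hatSub D')).subtype) ∘ₗ φ

/-- `k` is a strong solution, on `h ⊙ Exps D`, of `dk_t = k_t • dΛ_φ(t)`, `k_0 = ι`: there is an
integrable process `K` on `V` with `ω_{ζ',ζ} • K_t = k_t ∘ φ^{ζ'}_ζ` and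
`k_t(x) = x ⊙ I + ∫₀ᵗ K_s(x) dΛ_s`. -/
def IsStrongSolution (φ : V →ₗ[ℂ] V ⊗[ℂ] OpDagger (hatSub D) (hatSub D'))
    (kk : OpFamily V D) : Prop :=
  (∀ x, IsProcess fun t => kk t x) ∧
  ∃ K : ℝ≥0 → V →ₗ[ℂ] Op (integrandDomain h D) (HTensor (HTensor h' (KHat k)) (NoiseFock k)),
    (∀ x, IsQSIntegrable fun t => K t x) ∧
    (∀ (t : ℝ≥0) (x : V) (ζ' : hatSub D') (ζ : hatSub D) (a : h) (e : Exps D)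
        (a' : h') (f : NoiseFock k),
      ⟪tmulH (tmulH a' (ζ' : KHat k)) f, K t x (domVec3 a ζ e)⟫_ℂ =
        ⟪tmulH a' f, column (kk t (component φ ζ' ζ x)) e a⟫_ℂ) ∧
    (∀ (t : ℝ≥0) (x : V) (a : h) (g : Step D),
      IsQSIntegralAt (fun s => K s x) t a g
        (column (kk t x) ⟨_, ev_mem g.2⟩ a - tmulH ((x : h →L[ℂ] h') a) (ev (g : ℝ → k))))

/-- `k` is a weak solution, for the domains `h' ⊙ Exps D'` and `h ⊙ Exps D`, of
`dk_t = k_t • dΛ_φ(t)`, `k_0 = ι`. -/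
structure IsWeakSolution (φ : V →ₗ[ℂ] V ⊗[ℂ] OpDagger (hatSub D) (hatSub D'))
    (kk : OpFamily V D) : Prop where
  isProcess : ∀ x, IsProcess fun t => kk t x
  continuous : ∀ (x : V) (ξ' : expDomain (⊤ : Submodule ℂ h') D')
    (ξ : expDomain (⊤ : Submodule ℂ h) D),
    Continuous fun t => ⟪(ξ' : HTensor h' (NoiseFock k)), kk t x ξ⟫_ℂ
  integral_eq : ∀ (t : ℝ≥0) (x : V) (a' : h') (g' : Step D') (a : h) (g : Step D),
    ⟪tmulH a' (ev (g' : ℝ → k)), column (kk t x) ⟨_, ev_mem g.2⟩ a⟫_ℂ -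
        ⟪a', (x : h →L[ℂ] h') a⟫_ℂ * ⟪ev (g' : ℝ → k), ev (g : ℝ → k)⟫_ℂ =
      ∫ s in (0 : ℝ)..t,
        ⟪tmulH a' (ev (g' : ℝ → k)),
          column (kk s.toNNReal (component φ (hat ((g' : ℝ → k) s))
            ⟨hat ((g : ℝ → k) s), hat_mem (Step.apply_mem g.2 s)⟩ x)) ⟨_, ev_mem g.2⟩ a⟫_ℂ

/-- `k = k^φ`: the process `k` maps `V` to `V` (in the sense of slices against all of
`Exps k`), it is a strong solution of the quantum stochastic differential equation, and every
linear weak solution coincides with it. -/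
structure IsGeneratedBy [CompleteSpace h']
    (φ : V →ₗ[ℂ] V ⊗[ℂ] OpDagger (hatSub D) (hatSub D')) (kk : OpFamily V D) : Prop where
  slices : SlicesInto kk (⊤ : Submodule ℂ k)
  strong : IsStrongSolution φ kk
  unique : ∀ kk' : OpFamily V D, IsWeakSolution φ kk' → kk' = kk

end QSDE

end

end QS

namespace QS

open Filter Topology Asymptotics

noncomputable section

universe u v w

/-! ### Extension of maps from dense subspaces -/

section Extension

variable {H : Type*} [NormedAddCommGroup H] [InnerProductSpace ℂ H]
variable {K : Type*} [NormedAddCommGroup K] [InnerProductSpace ℂ K]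

/-! Freeze the test functions at constants `c'`, `c`. The cocycle law then makes `k^{c',c}_t` a
one-parameter semigroup on the finite-dimensional space `V`. It is continuous at `0` by the Hölder
hypothesis, so it is differentiable there. The family of derivatives is the only candidate for the
components of `φ` at `ĉ'`, `ĉ`; what has to be shown is that it comes from operators on `D̂`, i.e.
that it depends sesquilinearly and separately boundedly on `ĉ'` and `ĉ`.

The increment `ω_{ε',ε} • k_t(x) - ⟪ε',ε⟫ x` is already sesquilinear in exponential vectors. For `ζ
= (z,d)` it is evaluated on the curve `(z-1) ε(0) + ε(d_{[0,t[})`, which differs from the linear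
expression `z ε(0) + d_{[0,t[}` by `O(t)` in norm. Adaptedness permits one of the two arguments to
be replaced by a vector independent of `t`, and the Hölder bound then controls the increment by `C
√t` times the norm of the other argument. The nonlinear error contributes `t⁻¹ · √t · t → 0`, so the
limit is additive and homogeneous; a vector `d_{[0,t[}` of norm `√t ‖d‖` contributes `t⁻¹ · √t · √t
‖d‖`, so the limit is bounded. The columns of `k` give this in the left argument, those of `k†` in
the right one (`IsHolderCocycle.limitForm_left`, `IsHolderCocycle.limitForm_right`). Riesz
representation of the coordinates of the limit form in a basis `b` of `V` gives operators `T_j` with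
adjoints, and `φ(x) = ∑ b_j ⊗ T_j(x)` (`IsHolderCocycle.exists_generator`).

For the equation itself, finite dimensionality of `V` lets each column be written `k_t(x)(a ε) = ∑
b_j a ⊗ m_t^j(x,ε)` with `m_t^j ∈ F`. The cocycle law, read in `F ≅ F ⊗ F` (past and future of a
time `r`), shows that `t ↦ m_t^j` is right-continuous and locally bounded
(`IsHolderCocycle.rightRegular_coefficient`), which settles measurability and square-integrability
of the integrand. Matrix elements between exponential vectors of step functions are continuous with
the expected right derivative, so they satisfy the integral equation
(`IsHolderCocycle.integral_eq`); density of `D'` then extends the test functions. For fixed test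
vectors, the difference of two weak solutions solves a homogeneous linear system indexed by a basis
of `V`, and Gronwall's inequality kills it (`IsHolderCocycle.eq_of_isWeakSolution`). -/

theorem inner_linearCombination_eq {I : Type*} {a : I → H} {b : I → K}
    (h : ∀ i j, ⟪a i, a j⟫_ℂ = ⟪b i, b j⟫_ℂ) (f g : I →₀ ℂ) :
    ⟪Finsupp.linearCombination ℂ a f, Finsupp.linearCombination ℂ a g⟫_ℂ =
      ⟪Finsupp.linearCombination ℂ b f, Finsupp.linearCombination ℂ b g⟫_ℂ := by
  simp only [Finsupp.linearCombination_apply, Finsupp.sum, sum_inner, inner_sum, inner_smul_left,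
    inner_smul_right, h]

/-- Two families with the same Gram matrix, the first of which is total, are intertwined by a
linear isometry. -/
theorem exists_isometry_of_gram [CompleteSpace K] {I : Type*} {a : I → H} {b : I → K}
    (h : ∀ i j, ⟪a i, a j⟫_ℂ = ⟪b i, b j⟫_ℂ)
    (ha : Dense (Submodule.span ℂ (Set.range a) : Set H)) :
    ∃ L : H →ₗᵢ[ℂ] K, ∀ i, L (a i) = b i := by
  have hn (f : I →₀ ℂ) :
      ‖Finsupp.linearCombination ℂ b f‖ = ‖Finsupp.linearCombination ℂ a f‖ := by
    rw [@norm_eq_sqrt_re_inner ℂ, @norm_eq_sqrt_re_inner ℂ, inner_linearCombination_eq h]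
  have hd : DenseRange (Finsupp.linearCombination ℂ a) := by
    rw [DenseRange, ← LinearMap.coe_range, Finsupp.range_linearCombination]
    exact ha
  have hb : ∃ C : ℝ, ∀ f : I →₀ ℂ,
      ‖Finsupp.linearCombination ℂ b f‖ ≤ C * ‖Finsupp.linearCombination ℂ a f‖ :=
    ⟨1, fun f => by rw [hn, one_mul]⟩
  let L := (Finsupp.linearCombination ℂ b).extendOfNorm (Finsupp.linearCombination ℂ a)
  have hL (f : I →₀ ℂ) : L (Finsupp.linearCombination ℂ a f) = Finsupp.linearCombination ℂ b f :=
    LinearMap.extendOfNorm_eq hd hb f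
  refine ⟨⟨L.toLinearMap, fun x => ?_⟩, fun i => ?_⟩
  · refine hd.induction_on (p := fun x => ‖L x‖ = ‖x‖) x
      (isClosed_eq (by fun_prop) (by fun_prop)) fun f => ?_
    rw [hL, hn]
  · simpa using hL (Finsupp.single i 1)

/-- The Riesz representation of a conjugate-linear functional that is bounded on a dense
subspace. -/
theorem exists_inner_eq_of_dense [CompleteSpace H] {E : Submodule ℂ H} (hE : Dense (E : Set H))
    (B : E →ₗ⋆[ℂ] ℂ) {C : ℝ} (hB : ∀ e, ‖B e‖ ≤ C * ‖e‖) :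
    ∃ f : H, ∀ e : E, ⟪(e : H), f⟫_ℂ = B e := by
  let l : E →ₗ[ℂ] ℂ :=
    { toFun := fun e => starRingEnd ℂ (B e)
      map_add' := fun x y => by simp
      map_smul' := fun c x => by simp }
  have hd : DenseRange E.subtype := by simpa [DenseRange] using hE
  have hb : ∃ C : ℝ, ∀ e : E, ‖l e‖ ≤ C * ‖E.subtype e‖ :=
    ⟨C, fun e => by simpa [l] using hB e⟩
  refine ⟨(InnerProductSpace.toDual ℂ H).symm (l.extendOfNorm E.subtype), fun e => ?_⟩
  rw [← inner_conj_symm, InnerProductSpace.toDual_symm_apply]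
  have := LinearMap.extendOfNorm_eq hd hb e
  simp only [Submodule.subtype_apply] at this
  rw [this]
  simp [l]

theorem eq_of_inner_dense {E : Submodule ℂ H} (hE : Dense (E : Set H)) {f g : H}
    (h : ∀ e ∈ E, ⟪e, f⟫_ℂ = ⟪e, g⟫_ℂ) : f = g :=
  hE.eq_of_inner_right ℂ fun e he => h e he

/-- The estimate is closed in `e`, so it may be applied to `e = f`, where it reads `‖f‖² ≤ C ‖f‖`.
-/
theorem norm_le_of_inner_dense {E : Submodule ℂ H} (hE : Dense (E : Set H)) {f : H} {C : ℝ}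
    (hC : 0 ≤ C) (h : ∀ e ∈ E, ‖⟪e, f⟫_ℂ‖ ≤ C * ‖e‖) : ‖f‖ ≤ C := by
  have h2 : ‖⟪f, f⟫_ℂ‖ ≤ C * ‖f‖ :=
    hE.induction (P := fun e => ‖⟪e, f⟫_ℂ‖ ≤ C * ‖e‖) h
      (isClosed_le (by fun_prop) (by fun_prop)) f
  rw [inner_self_eq_norm_sq_to_K, norm_pow, RCLike.norm_ofReal, abs_norm, sq] at h2
  rcases (norm_nonneg f).eq_or_lt with h0 | h0
  · rwa [← h0]
  · exact le_of_mul_le_mul_right h2 h0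

end Extension

/-! ### The Hilbert space tensor product -/

section HilbertTensor

variable {H : Type u} [NormedAddCommGroup H] [InnerProductSpace ℂ H]
variable {K : Type v} [NormedAddCommGroup K] [InnerProductSpace ℂ K]

theorem inner_tmulH (a c : H) (b d : K) :
    ⟪tmulH a b, tmulH c d⟫_ℂ = ⟪a, c⟫_ℂ * ⟪b, d⟫_ℂ := by
  change ⟪((a ⊗ₜ[ℂ] b : H ⊗[ℂ] K) : UniformSpace.Completion (H ⊗[ℂ] K)),
    ((c ⊗ₜ[ℂ] d : H ⊗[ℂ] K) : UniformSpace.Completion (H ⊗[ℂ] K))⟫_ℂ = _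
  rw [UniformSpace.Completion.inner_coe, TensorProduct.inner_tmul]

theorem toHTensor_tmul (a : H) (b : K) : toHTensor (a ⊗ₜ[ℂ] b) = tmulH a b := rfl

theorem ket_apply (a : H) (b : K) : ket b a = tmulH a b := rfl

variable (H K) in
/-- The bounded bilinear map `(u, ζ) ↦ u ⊗ ζ`. -/
def tmulL : H →L[ℂ] K →L[ℂ] HTensor H K :=
  ((ContinuousLinearMap.compL ℂ K (H ⊗[ℂ] K) (HTensor H K)) toHTensor).comp
    (TensorProduct.mkL ℂ H K)

theorem tmulH_add_left (a a' : H) (b : K) : tmulH (a + a') b = tmulH a b + tmulH a' b :=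
  map_add (ket b) a a'

theorem tmulH_smul_left (c : ℂ) (a : H) (b : K) : tmulH (c • a) b = c • tmulH a b :=
  map_smul (ket b) c a

theorem tmulH_add_right (a : H) (b b' : K) : tmulH a (b + b') = tmulH a b + tmulH a b' :=
  map_add (tmulL H K a) b b'

theorem tmulH_smul_right (c : ℂ) (a : H) (b : K) : tmulH a (c • b) = c • tmulH a b :=
  map_smul (tmulL H K a) c b

theorem tmulH_zero_right (a : H) : tmulH a (0 : K) = 0 := map_zero (tmulL H K a)

theorem continuous_tmulH : Continuous fun p : H × K => tmulH p.1 p.2 :=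
  ((tmulL H K).continuous.comp continuous_fst).clm_apply continuous_snd

theorem inner_bra [CompleteSpace H] (a : H) (b : K) (ξ : HTensor H K) :
    ⟪a, bra b ξ⟫_ℂ = ⟪tmulH a b, ξ⟫_ℂ :=
  ContinuousLinearMap.adjoint_inner_right _ _ _

theorem dense_algTensor {A : Submodule ℂ H} {B : Submodule ℂ K} (hA : Dense (A : Set H))
    (hB : Dense (B : Set K)) : Dense (algTensor A B : Set (HTensor H K)) := by
  have h1 (a : H) (b : K) : tmulH a b ∈ (algTensor A B).topologicalClosure := by
    have : Dense ((A : Set H) ×ˢ (B : Set K)) := hA.prod hB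
    refine this.induction (P := fun p : H × K => tmulH p.1 p.2 ∈ (algTensor A B).topologicalClosure)
      (fun p hp => ?_) ?_ (a, b)
    · exact Submodule.le_topologicalClosure _ (tmulH_mem hp.1 hp.2)
    · exact (Submodule.isClosed_topologicalClosure _).preimage continuous_tmulH
  have h2 (x : H ⊗[ℂ] K) : toHTensor x ∈ (algTensor A B).topologicalClosure := by
    induction x with
    | zero => rw [map_zero]; exact Submodule.zero_mem _
    | tmul a b => exact h1 a b
    | add x y hx hy => rw [map_add]; exact Submodule.add_mem _ hx hy
  rw [Submodule.dense_iff_topologicalClosure_eq_top, eq_top_iff]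
  rintro x -
  have hr : DenseRange (toHTensor : H ⊗[ℂ] K →L[ℂ] HTensor H K) :=
    UniformSpace.Completion.denseRange_coe
  exact hr.induction_on (p := fun x => x ∈ (algTensor A B).topologicalClosure) x
    (Submodule.isClosed_topologicalClosure _) h2

/-- The algebraic tensor product of two subspaces, as an abstract tensor product. -/
def algTensorEquiv (A : Submodule ℂ H) (B : Submodule ℂ K) : A ⊗[ℂ] B ≃ₗ[ℂ] algTensor A B :=
  LinearEquiv.ofBijective
    ((toHTensor.toLinearMap ∘ₗ TensorProduct.mapIncl A B).codRestrict (algTensor A B) fun x => by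
      induction x with
      | zero => rw [map_zero]; exact Submodule.zero_mem _
      | tmul a b => exact tmulH_mem a.2 b.2
      | add x y hx hy => rw [map_add]; exact Submodule.add_mem _ hx hy)
    ⟨by
      rw [← LinearMap.ker_eq_bot, LinearMap.ker_codRestrict, LinearMap.ker_eq_bot]
      refine Function.Injective.comp (g := (toHTensor : H ⊗[ℂ] K →L[ℂ] HTensor H K)) ?_ ?_
      · exact UniformSpace.Completion.coe_injective _
      · exact TensorProduct.map_injective_of_flat_flat _ _ A.injective_subtype
          B.injective_subtype,
    by
      rintro ⟨x, hx⟩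
      induction hx using Submodule.span_induction with
      | mem x hx =>
        obtain ⟨a, ha, b, hb, rfl⟩ := hx
        exact ⟨⟨a, ha⟩ ⊗ₜ ⟨b, hb⟩, Subtype.ext rfl⟩
      | zero => exact ⟨0, map_zero _⟩
      | add x y hx hy h1 h2 =>
        obtain ⟨p, hp⟩ := h1
        obtain ⟨q, hq⟩ := h2
        exact ⟨p + q, by rw [map_add, hp, hq]; rfl⟩
      | smul c x hx h =>
        obtain ⟨p, hp⟩ := h
        exact ⟨c • p, by rw [map_smul, hp]; rfl⟩⟩

theorem algTensorEquiv_symm_tmulH {A : Submodule ℂ H} {B : Submodule ℂ K} (a : A) (b : B) :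
    (algTensorEquiv A B).symm ⟨tmulH (a : H) (b : K), tmulH_mem a.2 b.2⟩ = a ⊗ₜ b := by
  rw [LinearEquiv.symm_apply_eq]
  rfl

variable {G : Type w} [NormedAddCommGroup G] [InnerProductSpace ℂ G]

/-- The exchange of the last two tensor factors. -/
theorem exists_exchange (H : Type u) [NormedAddCommGroup H] [InnerProductSpace ℂ H]
    (K : Type v) [NormedAddCommGroup K] [InnerProductSpace ℂ K]
    (G : Type w) [NormedAddCommGroup G] [InnerProductSpace ℂ G] :
    ∃ U : HTensor (HTensor H K) G →ₗᵢ[ℂ] HTensor (HTensor H G) K,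
      ∀ (a : H) (b : K) (c : G), U (tmulH (tmulH a b) c) = tmulH (tmulH a c) b := by
  have hd : Dense (Submodule.span ℂ (Set.range fun p : H × K × G =>
      tmulH (tmulH p.1 p.2.1) p.2.2) : Set (HTensor (HTensor H K) G)) := by
    have htop : Dense ((⊤ : Submodule ℂ H) : Set H) := by simp
    have htop' : Dense ((⊤ : Submodule ℂ K) : Set K) := by simp
    have htop'' : Dense ((⊤ : Submodule ℂ G) : Set G) := by simp
    refine (dense_algTensor (dense_algTensor htop htop') htop'').mono ?_
    refine Submodule.span_le.mpr ?_
    rintro _ ⟨x, hx, c, -, rfl⟩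
    induction hx using Submodule.span_induction with
    | mem x hx =>
      obtain ⟨a, -, b, -, rfl⟩ := hx
      exact Submodule.subset_span ⟨(a, b, c), rfl⟩
    | zero => rw [← ket_apply, map_zero]; exact Submodule.zero_mem _
    | add x y _ _ hx hy => rw [tmulH_add_left]; exact Submodule.add_mem _ hx hy
    | smul r x _ hx => rw [tmulH_smul_left]; exact Submodule.smul_mem _ _ hx
  obtain ⟨U, hU⟩ := exists_isometry_of_gram
    (a := fun p : H × K × G => tmulH (tmulH p.1 p.2.1) p.2.2)
    (b := fun p : H × K × G => tmulH (tmulH p.1 p.2.2) p.2.1)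
    (fun p q => by simp only [inner_tmulH]; ring) hd
  exact ⟨U, fun a b c => hU (a, b, c)⟩

end HilbertTensor

/-! ### Right-continuous, locally bounded functions -/

section RightRegular

variable {E : Type*} [NormedAddCommGroup E] {F : Type*} [NormedAddCommGroup F]
variable {G : Type*} [NormedAddCommGroup G] {α β : Type*}

/-- Right-continuous, locally bounded functions on `ℝ`. -/
structure RightRegular (f : ℝ → E) : Prop where
  right : ∀ r, ContinuousWithinAt f (Set.Ici r) r
  bounded : ∀ r, ∃ C : ℝ, ∀ᶠ s in 𝓝 r, ‖f s‖ ≤ C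

/-- Functions on `ℝ` that are constant on a right-neighbourhood `[r, r + δ[` and on a punctured
left-neighbourhood of every point `r`. -/
structure PiecewiseConst (f : ℝ → α) : Prop where
  right : ∀ r, ∀ᶠ s in 𝓝[≥] r, f s = f r
  left : ∀ r, ∃ c, ∀ᶠ s in 𝓝[<] r, f s = c

theorem PiecewiseConst.comp {f : ℝ → α} (hf : PiecewiseConst f) (ψ : α → β) :
    PiecewiseConst fun s => ψ (f s) where
  right r := (hf.right r).mono fun s hs => by rw [hs]
  left r := by
    obtain ⟨c, hc⟩ := hf.left r
    exact ⟨ψ c, hc.mono fun s hs => by rw [hs]⟩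

theorem PiecewiseConst.prodMk {f : ℝ → α} {g : ℝ → β} (hf : PiecewiseConst f)
    (hg : PiecewiseConst g) : PiecewiseConst fun s => (f s, g s) where
  right r := by
    filter_upwards [hf.right r, hg.right r] with s h1 h2
    rw [h1, h2]
  left r := by
    obtain ⟨c, hc⟩ := hf.left r
    obtain ⟨d, hd⟩ := hg.left r
    refine ⟨(c, d), ?_⟩
    filter_upwards [hc, hd] with s h1 h2
    rw [h1, h2]

theorem PiecewiseConst.rightRegular {f : ℝ → E} (hf : PiecewiseConst f) : RightRegular f where
  right r := by
    have : Tendsto f (𝓝[≥] r) (𝓝 (f r)) :=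
      tendsto_const_nhds.congr' ((hf.right r).mono fun s hs => hs.symm)
    exact this
  bounded r := by
    obtain ⟨c, hc⟩ := hf.left r
    refine ⟨max ‖c‖ ‖f r‖, ?_⟩
    rw [← nhdsLT_sup_nhdsGE, eventually_sup]
    exact ⟨hc.mono fun s hs => hs ▸ le_max_left _ _,
      (hf.right r).mono fun s hs => hs ▸ le_max_right _ _⟩

theorem _root_.Continuous.rightRegular {f : ℝ → E} (hf : Continuous f) : RightRegular f where
  right r := hf.continuousWithinAt
  bounded r := ⟨‖f r‖ + 1, (hf.norm.tendsto r).eventually_le_const (by linarith)⟩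

theorem RightRegular.add {f g : ℝ → E} (hf : RightRegular f) (hg : RightRegular g) :
    RightRegular fun s => f s + g s where
  right r := (hf.right r).add (hg.right r)
  bounded r := by
    obtain ⟨C, hC⟩ := hf.bounded r
    obtain ⟨C', hC'⟩ := hg.bounded r
    refine ⟨C + C', ?_⟩
    filter_upwards [hC, hC'] with s h1 h2
    exact norm_add_le_of_le h1 h2

theorem RightRegular.sum {ι : Type*} {S : Finset ι} {f : ι → ℝ → E}
    (hf : ∀ i ∈ S, RightRegular (f i)) : RightRegular fun s => ∑ i ∈ S, f i s := by
  classical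
  induction S using Finset.induction_on with
  | empty => simpa using (continuous_const : Continuous fun _ : ℝ => (0 : E)).rightRegular
  | insert i S hi ih =>
    simp only [Finset.sum_insert hi]
    exact (hf i (by simp)).add (ih fun j hj => hf j (by simp [hj]))

theorem RightRegular.clm₂ [NormedSpace ℂ E] [NormedSpace ℂ F] [NormedSpace ℂ G]
    (B : E →L[ℂ] F →L[ℂ] G) {f : ℝ → E} {g : ℝ → F}
    (hf : RightRegular f) (hg : RightRegular g) : RightRegular fun s => B (f s) (g s) where
  right r := (B.continuous.continuousAt.comp_continuousWithinAt (hf.right r)).clm_apply (hg.right r)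
  bounded r := by
    obtain ⟨C, hC⟩ := hf.bounded r
    obtain ⟨C', hC'⟩ := hg.bounded r
    refine ⟨‖B‖ * C * C', ?_⟩
    filter_upwards [hC, hC'] with s h1 h2
    refine (B.le_opNorm₂ _ _).trans ?_
    have := norm_nonneg (f s)
    gcongr
    exact mul_nonneg (ContinuousLinearMap.opNorm_nonneg B) (this.trans h1)

theorem RightRegular.clm [NormedSpace ℂ E] [NormedSpace ℂ F] (B : E →L[ℂ] F) {f : ℝ → E}
    (hf : RightRegular f) : RightRegular fun s => B (f s) where
  right r := B.continuous.continuousAt.comp_continuousWithinAt (hf.right r)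
  bounded r := by
    obtain ⟨C, hC⟩ := hf.bounded r
    refine ⟨‖B‖ * C, ?_⟩
    filter_upwards [hC] with s h1
    exact (B.le_opNorm _).trans (by gcongr)

theorem RightRegular.exists_bound {f : ℝ → E} (hf : RightRegular f) (a b : ℝ) :
    ∃ C : ℝ, ∀ s ∈ Set.Icc a b, ‖f s‖ ≤ C := by
  refine isCompact_Icc.induction_on (p := fun S => ∃ C : ℝ, ∀ s ∈ S, ‖f s‖ ≤ C) ⟨0, by simp⟩
    ?_ ?_ ?_
  · rintro S T hST ⟨C, hC⟩
    exact ⟨C, fun s hs => hC s (hST hs)⟩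
  · rintro S T ⟨C, hC⟩ ⟨C', hC'⟩
    refine ⟨max C C', ?_⟩
    rintro s (hs | hs)
    · exact (hC s hs).trans (le_max_left _ _)
    · exact (hC' s hs).trans (le_max_right _ _)
  · intro r _
    obtain ⟨C, hC⟩ := hf.bounded r
    exact ⟨_, mem_nhdsWithin_of_mem_nhds hC, C, fun s hs => hs⟩

/-- Right-continuity makes `f` a pointwise limit of functions that factor through `ℤ`. Such
functions are strongly measurable whatever the target, so no separability of `E` is needed. -/
theorem RightRegular.stronglyMeasurable {f : ℝ → E} (hf : RightRegular f) :
    StronglyMeasurable f := by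
  -- The right endpoint of the cell of length `1/(n+1)` containing `r`: it lies to the right of `r`
  -- and converges to `r`.
  let a (n : ℕ) (r : ℝ) : ℝ := (⌊((n : ℝ) + 1) * r⌋ + 1) / (n + 1)
  have ha1 (n : ℕ) (r : ℝ) : r ≤ a n r := by
    rw [le_div_iff₀ (by positivity), mul_comm]
    exact (Int.lt_floor_add_one _).le
  have ha2 (n : ℕ) (r : ℝ) : a n r ≤ r + 1 / ((n : ℝ) + 1) := by
    have hn : (0 : ℝ) < (n : ℝ) + 1 := by positivity
    rw [div_le_iff₀ hn, add_mul r, one_div, inv_mul_cancel₀ hn.ne', mul_comm r]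
    gcongr
    exact Int.floor_le _
  refine stronglyMeasurable_of_tendsto atTop (f := fun n r => f (a n r)) (fun n => ?_) ?_
  · have h1 : StronglyMeasurable fun z : ℤ => f ((z + 1) / ((n : ℝ) + 1)) :=
      StronglyMeasurable.of_discrete
    exact h1.comp_measurable (Int.measurable_floor.comp (measurable_const_mul _))
  · rw [tendsto_pi_nhds]
    intro r
    refine (hf.right r).tendsto.comp (tendsto_nhdsWithin_iff.mpr ⟨?_, .of_forall fun n => ha1 n r⟩)
    refine tendsto_of_tendsto_of_tendsto_of_le_of_le tendsto_const_nhds ?_ (fun n => ha1 n r)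
      fun n => ha2 n r
    simpa using tendsto_const_nhds.add (tendsto_one_div_add_atTop_nhds_zero_nat (𝕜 := ℝ))

theorem RightRegular.memLp {f : ℝ → E} (hf : RightRegular f) (p : ℝ≥0∞) (a b : ℝ) :
    MemLp f p (volume.restrict (Set.Icc a b)) := by
  obtain ⟨C, hC⟩ := hf.exists_bound a b
  refine MemLp.of_bound hf.stronglyMeasurable.aestronglyMeasurable C ?_
  filter_upwards [ae_restrict_mem measurableSet_Icc] with s hs using hC s hs

theorem RightRegular.intervalIntegrable [NormedSpace ℝ E] {f : ℝ → E} (hf : RightRegular f)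
    (a b : ℝ) :
    IntervalIntegrable f volume a b := by
  refine intervalIntegrable_iff.mpr (IntegrableOn.mono_set ?_ Set.uIoc_subset_uIcc)
  exact memLp_one_iff_integrable.mp (hf.memLp 1 _ _)

end RightRegular

/-! ### Semigroups in a Banach algebra -/

section Semigroup

variable {A : Type*} [NormedRing A] [CompleteSpace A]

/-- With truncated subtraction, `p s * p (r - s) = p (max s r) = p r * p (s - r)`, which treats both
sides of `r` at once. Near `r` the factor `p (r - s)` is close to `1`, hence invertible, and can be
divided out; this is what gives left continuity. -/
theorem continuous_of_semigroup {p : ℝ≥0 → A} (hadd : ∀ s t, p (s + t) = p s * p t)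
    (h0 : Tendsto p (𝓝 0) (𝓝 1)) : Continuous p := by
  refine continuous_iff_continuousAt.mpr fun r => ?_
  have hsub1 : Tendsto (fun s => p (r - s)) (𝓝 r) (𝓝 1) := by
    refine h0.comp ?_
    have : Continuous fun s : ℝ≥0 => r - s := by fun_prop
    simpa using this.tendsto r
  have hsub2 : Tendsto (fun s => p (s - r)) (𝓝 r) (𝓝 1) := by
    refine h0.comp ?_
    have : Continuous fun s : ℝ≥0 => s - r := by fun_prop
    simpa using this.tendsto r
  have hunit : ∀ᶠ s in 𝓝 r, IsUnit (p (r - s)) :=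
    hsub1.eventually (Units.isOpen.mem_nhds isUnit_one)
  have hinv : Tendsto (fun s => Ring.inverse (p (r - s))) (𝓝 r) (𝓝 1) := by
    have := (NormedRing.inverse_continuousAt (1 : Aˣ)).tendsto
    simp only [Units.val_one, Ring.inverse_one] at this
    exact this.comp hsub1
  have hlim : Tendsto (fun s => p r * p (s - r) * Ring.inverse (p (r - s))) (𝓝 r) (𝓝 (p r)) := by
    simpa using (tendsto_const_nhds.mul hsub2).mul hinv
  refine hlim.congr' ?_
  filter_upwards [hunit] with s hs
  have : p s * p (r - s) = p r * p (s - r) := by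
    rw [← hadd, ← hadd, add_tsub_eq_max, add_tsub_eq_max, max_comm]
  rw [← this, Ring.mul_inverse_cancel_right _ _ hs]

/-- The classical averaging argument: with `F a = ∫₀ᵃ p`, the product `(p t - 1) F a` is `∫ₐ^{a+t} p
- ∫₀ᵗ p`, which is differentiable in `t`, and `F a` is invertible for small `a`. -/
theorem exists_generator_of_semigroup [NormedAlgebra ℝ A] {p : ℝ≥0 → A} (hzero : p 0 = 1)
    (hadd : ∀ s t, p (s + t) = p s * p t) (h0 : Tendsto p (𝓝 0) (𝓝 1)) :
    ∃ ψ : A, Tendsto (fun t : ℝ => t⁻¹ • (p t.toNNReal - 1)) (𝓝[>] 0) (𝓝 ψ) := by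
  have hp := continuous_of_semigroup hadd h0
  let q : ℝ → A := fun t => p t.toNNReal
  have hq : Continuous q := hp.comp continuous_real_toNNReal
  have hq0 : q 0 = 1 := by simp [q, hzero]
  let F : ℝ → A := fun t => ∫ s in (0 : ℝ)..t, q s
  have hF (a : ℝ) : HasDerivAt F (q a) a := hq.integral_hasStrictDerivAt 0 a |>.hasDerivAt
  have hF0 : F 0 = 0 := by simp [F]
  have hslope (a : ℝ) : Tendsto (fun t => t⁻¹ • (F (a + t) - F a)) (𝓝[>] 0) (𝓝 (q a)) :=
    (hF a).tendsto_slope_zero_right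
  -- `t⁻¹ F t` tends to the unit `1` and the units are open; rescaling by `a ≠ 0` preserves
  -- invertibility.
  obtain ⟨a, ha, hu⟩ : ∃ a > 0, IsUnit (F a) := by
    have h1 : ∀ᶠ t in 𝓝[>] (0 : ℝ), IsUnit (t⁻¹ • (F (0 + t) - F 0)) :=
      (hslope 0).eventually (Units.isOpen.mem_nhds (hq0 ▸ isUnit_one))
    obtain ⟨a, hau, ha⟩ := (h1.and self_mem_nhdsWithin).exists
    refine ⟨a, ha, ?_⟩
    rw [zero_add, hF0, sub_zero] at hau
    have hne : a ≠ 0 := ne_of_gt ha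
    have := hau.smul (Units.mk0 a hne)
    simpa [Units.smul_def, smul_smul, hne] using this
  have hkey (t : ℝ) (ht : 0 < t) : (q t - 1) * F a = (F (a + t) - F a) - (F (0 + t) - F 0) := by
    have h1 : q t * F a = ∫ s in (0 : ℝ)..a, q (t + s) := by
      rw [← ContinuousLinearMap.mul_apply' ℝ A,
        ← ContinuousLinearMap.intervalIntegral_comp_comm _ (hq.intervalIntegrable _ _)]
      refine intervalIntegral.integral_congr fun s hs => ?_
      rw [Set.uIcc_of_le ha.le] at hs
      simp only [q, ContinuousLinearMap.mul_apply']
      rw [Real.toNNReal_add ht.le hs.1, hadd]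
    have h2 : (∫ s in (0 : ℝ)..a, q (t + s)) = F (a + t) - F t := by
      rw [intervalIntegral.integral_comp_add_left, add_zero, add_comm t a]
      exact (intervalIntegral.integral_interval_sub_left (hq.intervalIntegrable _ _)
        (hq.intervalIntegrable _ _)).symm
    rw [sub_mul, one_mul, h1, h2, hF0, zero_add]
    abel
  refine ⟨(q a - q 0) * Ring.inverse (F a), ?_⟩
  refine (((hslope a).sub (hslope 0)).mul_const _).congr' ?_
  filter_upwards [self_mem_nhdsWithin] with t ht
  rw [← smul_sub, ← hkey t ht, ← smul_mul_assoc, Ring.mul_inverse_cancel_right _ _ hu]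

end Semigroup

/-! ### Exponential vectors -/

section Fock

variable {H : Type u} [NormedAddCommGroup H] [InnerProductSpace ℂ H]

variable (H) in
-- Gives completeness of the symmetric Fock space, on which Riesz representation and adjoints are
-- used below.
theorem isClosed_symFock : IsClosed (symFock H : Set (FullFock H)) := by
  have : (symFock H : Set (FullFock H)) = ⋂ n : ℕ, {x : FullFock H | (x : ∀ n, TPow H n) n ∈
      (Submodule.span ℂ (Set.range fun f : H => tpow f n)).topologicalClosure} := by
    ext x
    simp only [Set.mem_iInter]
    rfl
  rw [this]
  refine isClosed_iInter fun n => ?_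
  refine (Submodule.isClosed_topologicalClosure _).preimage ?_
  exact (lp.evalCLM ℂ (fun n => TPow H n) 2 n).continuous

instance : CompleteSpace (symFock H) := (isClosed_symFock H).completeSpace_coe

theorem inner_tpow (f g : H) (n : ℕ) : ⟪tpow f n, tpow g n⟫_ℂ = ⟪f, g⟫_ℂ ^ n := by
  induction n with
  | zero =>
    change ⟪tpow f 0, tpow f 0⟫_ℂ = _
    rw [inner_self_eq_norm_sq_to_K, norm_tpow]
    simp
  | succ n ih =>
    change ⟪(tmulH f (tpow f n) : HTensor H (tensorPowerSp H n).carrier),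
      (tmulH g (tpow g n) : HTensor H (tensorPowerSp H n).carrier)⟫_ℂ = _
    rw [inner_tmulH, ih, pow_succ, mul_comm]

theorem tpow_smul (c : ℂ) (f : H) (n : ℕ) : tpow (c • f) n = c ^ n • tpow f n := by
  induction n with
  | zero => rw [pow_zero, one_smul]; rfl
  | succ n ih =>
    change (tmulH (c • f) (tpow (c • f) n) : HTensor H (tensorPowerSp H n).carrier) =
      c ^ (n + 1) • (tmulH f (tpow f n) : HTensor H (tensorPowerSp H n).carrier)
    rw [ih, tmulH_smul_left, tmulH_smul_right, smul_smul, pow_succ, mul_comm]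

theorem expVec_apply (f : H) (n : ℕ) : ((expVec f : FullFock H) : ∀ n, TPow H n) n =
    (((Real.sqrt (n.factorial : ℝ))⁻¹ : ℝ) : ℂ) • tpow f n := rfl

theorem inner_expVec (f g : H) : ⟪expVec f, expVec g⟫_ℂ = Complex.exp ⟪f, g⟫_ℂ := by
  rw [Submodule.coe_inner, lp.inner_eq_tsum, Complex.exp_eq_exp_ℂ, NormedSpace.exp_eq_tsum_div]
  refine tsum_congr fun n => ?_
  rw [expVec_apply, expVec_apply, inner_smul_left, inner_smul_right, inner_tpow,
    Complex.conj_ofReal, ← mul_assoc, ← Complex.ofReal_mul, ← mul_inv,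
    Real.mul_self_sqrt (by positivity), div_eq_inv_mul]
  push_cast
  rfl

theorem norm_expVec_sq (f : H) : ‖expVec f‖ ^ 2 = Real.exp (‖f‖ ^ 2) := by
  have h : ((‖expVec f‖ ^ 2 : ℝ) : ℂ) = ((Real.exp (‖f‖ ^ 2) : ℝ) : ℂ) := by
    push_cast
    have := inner_expVec f f
    rwa [inner_self_eq_norm_sq_to_K (𝕜 := ℂ) (expVec f),
      inner_self_eq_norm_sq_to_K (𝕜 := ℂ) f] at this
  exact_mod_cast h

theorem continuous_expVec : Continuous (expVec : H → symFock H) := by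
  refine continuous_iff_continuousAt.mpr fun f => ?_
  rw [ContinuousAt, tendsto_iff_norm_sub_tendsto_zero]
  have h (g : H) : ‖expVec g - expVec f‖ = Real.sqrt (Real.exp (‖g‖ ^ 2) -
      2 * (Complex.exp ⟪g, f⟫_ℂ).re + Real.exp (‖f‖ ^ 2)) := by
    rw [← inner_expVec, ← norm_expVec_sq, ← norm_expVec_sq]
    have := @norm_sub_sq ℂ _ _ _ _ (expVec g) (expVec f)
    simp only [RCLike.re_eq_complex_re] at this
    rw [← this, Real.sqrt_sq (norm_nonneg _)]
  simp only [h]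
  have h0 : Real.sqrt (Real.exp (‖f‖ ^ 2) - 2 * (Complex.exp ⟪f, f⟫_ℂ).re + Real.exp (‖f‖ ^ 2)) =
      0 := by rw [← h, sub_self, norm_zero]
  rw [← h0]
  have hc : Continuous fun g : H => Real.sqrt (Real.exp (‖g‖ ^ 2) -
      2 * (Complex.exp ⟪g, f⟫_ℂ).re + Real.exp (‖f‖ ^ 2)) := by fun_prop
  exact hc.tendsto f

/-- If `x` is orthogonal to all exponential vectors, then `z ↦ ⟪ε(z̄ f), x⟫` is a vanishing power
series, so every `⟪f^{⊗ n}, x_n⟫` vanishes. Since `x_n` lies in the closed span of the powers `f^{⊗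
n}`, it is orthogonal to itself. -/
theorem dense_span_expVec :
    Dense (Submodule.span ℂ (Set.range (expVec : H → symFock H)) : Set (symFock H)) := by
  rw [Submodule.dense_iff_topologicalClosure_eq_top,
    Submodule.topologicalClosure_eq_top_iff, Submodule.eq_bot_iff]
  intro x hx
  have hx1 (f : H) : ⟪expVec f, x⟫_ℂ = 0 :=
    (Submodule.mem_orthogonal _ _).mp hx _ (Submodule.subset_span ⟨f, rfl⟩)
  let X : ∀ n, TPow H n := ((x : FullFock H) : ∀ n, TPow H n)
  have hX (f : H) (n : ℕ) : ⟪tpow f n, X n⟫_ℂ = 0 := by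
    let a : ℕ → ℂ := fun n => (((Real.sqrt (n.factorial : ℝ))⁻¹ : ℝ) : ℂ) * ⟪tpow f n, X n⟫_ℂ
    have hs (z : ℂ) : HasSum (fun n => z ^ n * a n) 0 := by
      -- The conjugate compensates the conjugate-linearity of the inner product in its first
      -- argument and produces a series in `z`.
      have h1 := lp.hasSum_inner (𝕜 := ℂ) (expVec ((starRingEnd ℂ) z • f) : FullFock H)
        (x : FullFock H)
      rw [← Submodule.coe_inner, hx1] at h1
      refine Eq.subst (motive := fun F => HasSum F (0 : ℂ)) (funext fun n => ?_) h1
      rw [expVec_apply, tpow_smul, smul_smul, inner_smul_left]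
      simp only [a, X, map_mul, Complex.conj_ofReal, map_pow, Complex.conj_conj]
      ring
    have hp : HasFPowerSeriesAt (fun _ : ℂ => (0 : ℂ)) (FormalMultilinearSeries.ofScalars ℂ a) 0 := by
      rw [hasFPowerSeriesAt_iff]
      exact .of_forall fun z => by simpa [FormalMultilinearSeries.coeff_ofScalars] using hs z
    have h0 := hp.eq_zero
    have h1 : a n = 0 := by
      rw [← FormalMultilinearSeries.coeff_ofScalars (𝕜 := ℂ) (p := a) (n := n), h0]
      rfl
    simpa [a, Real.sqrt_eq_zero', Nat.factorial_ne_zero, Nat.factorial_pos] using h1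
  refine Subtype.ext (lp.ext (funext fun n => ?_))
  have hmem : X n ∈ (Submodule.span ℂ (Set.range fun f : H => tpow f n)).topologicalClosure := x.2 n
  have horth : X n ∈ ((Submodule.span ℂ (Set.range fun f : H => tpow f n)).topologicalClosure)ᗮ := by
    rw [Submodule.orthogonal_closure, Submodule.mem_orthogonal]
    intro y hy
    induction hy using Submodule.span_induction with
    | mem y hy => obtain ⟨f, rfl⟩ := hy; exact hX f n
    | zero => exact inner_zero_left _
    | add y z _ _ hy hz => rw [inner_add_left, hy, hz, add_zero]
    | smul c y _ hy => rw [inner_smul_left, hy, mul_zero]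
  exact inner_self_eq_zero.mp ((Submodule.mem_orthogonal _ _).mp horth _ hmem)

theorem mem_symFock_single (f : H) :
    (lp.single 2 1 (tpow f 1) : FullFock H) ∈ symFock H := by
  intro n
  by_cases hn : n = 1
  · subst hn
    rw [lp.single_apply_self]
    exact Submodule.le_topologicalClosure _ (Submodule.subset_span ⟨f, rfl⟩)
  · rw [lp.single_apply_ne _ _ _ hn]
    exact Submodule.zero_mem _

theorem tpow_one_add (f g : H) : tpow (f + g) 1 = tpow f 1 + tpow g 1 := by
  change (tmulH (f + g) (tpow f 0) : HTensor H (tensorPowerSp H 0).carrier) =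
    tmulH f (tpow f 0) + tmulH g (tpow f 0)
  exact tmulH_add_left _ _ _

variable (H) in
/-- The embedding of `H` in its symmetric Fock space as the one-particle space. -/
def oneParticle : H →ₗ[ℂ] symFock H where
  toFun f := ⟨lp.single 2 1 (tpow f 1), mem_symFock_single f⟩
  map_add' f g := Subtype.ext (by
    change lp.single 2 1 (tpow (f + g) 1) = lp.single 2 1 (tpow f 1) + lp.single 2 1 (tpow g 1)
    rw [tpow_one_add, lp.single_add])
  map_smul' c f := Subtype.ext (by
    change lp.single 2 1 (tpow (c • f) 1) = c • lp.single 2 1 (tpow f 1)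
    rw [tpow_smul, pow_one, lp.single_smul])

theorem inner_expVec_oneParticle (f g : H) : ⟪expVec f, oneParticle H g⟫_ℂ = ⟪f, g⟫_ℂ := by
  rw [Submodule.coe_inner]
  refine (lp.inner_single_right 1 (tpow g 1) (expVec f : FullFock H)).trans ?_
  rw [expVec_apply, inner_smul_left, inner_tpow]
  simp

theorem inner_oneParticle (f g : H) : ⟪oneParticle H f, oneParticle H g⟫_ℂ = ⟪f, g⟫_ℂ := by
  rw [Submodule.coe_inner]
  refine (lp.inner_single_right 1 (tpow g 1) (oneParticle H f : FullFock H)).trans ?_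
  change ⟪lp.single 2 1 (tpow f 1) 1, tpow g 1⟫_ℂ = _
  rw [lp.single_apply_self, inner_tpow, pow_one]

theorem norm_oneParticle (f : H) : ‖oneParticle H f‖ = ‖f‖ := by
  rw [@norm_eq_sqrt_re_inner ℂ, @norm_eq_sqrt_re_inner ℂ _ _ _ _ f, inner_oneParticle]

theorem norm_expVec_sub_sub_oneParticle_sq (f : H) :
    ‖expVec f - expVec 0 - oneParticle H f‖ ^ 2 = Real.exp (‖f‖ ^ 2) - 1 - ‖f‖ ^ 2 := by
  have h : (⟪expVec f - expVec 0 - oneParticle H f,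
      expVec f - expVec 0 - oneParticle H f⟫_ℂ : ℂ) = Complex.exp ⟪f, f⟫_ℂ - 1 - ⟪f, f⟫_ℂ := by
    have h1 (x : H) : ⟪oneParticle H f, expVec x⟫_ℂ = ⟪f, x⟫_ℂ := by
      rw [← inner_conj_symm (oneParticle H f), inner_expVec_oneParticle, inner_conj_symm]
    simp only [inner_sub_left, inner_sub_right, inner_expVec, inner_oneParticle,
      inner_expVec_oneParticle, h1, inner_zero_left, inner_zero_right, Complex.exp_zero]
    ring
  have h2 : ((‖expVec f - expVec 0 - oneParticle H f‖ ^ 2 : ℝ) : ℂ) =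
      ((Real.exp (‖f‖ ^ 2) - 1 - ‖f‖ ^ 2 : ℝ) : ℂ) := by
    push_cast
    rw [inner_self_eq_norm_sq_to_K (𝕜 := ℂ) f] at h
    exact (inner_self_eq_norm_sq_to_K (𝕜 := ℂ) _).symm.trans h
  exact_mod_cast h2

/-- For `f = d_{[0,t[}` the bound is `t ‖d‖²`: exponential vectors are affine in `d` up to an error
of order `t`. This is the estimate behind the linearity of the stochastic generator. -/
theorem norm_expVec_sub_sub_oneParticle_le {f : H} (hf : ‖f‖ ≤ 1) :
    ‖expVec f - expVec 0 - oneParticle H f‖ ≤ ‖f‖ ^ 2 := by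
  refine (sq_le_sq₀ (norm_nonneg _) (by positivity)).mp ?_
  rw [norm_expVec_sub_sub_oneParticle_sq]
  have hx : |‖f‖ ^ 2| ≤ 1 := by
    rw [abs_of_nonneg (by positivity)]
    exact pow_le_one₀ (norm_nonneg _) hf
  exact (le_abs_self _).trans (Real.abs_exp_sub_one_sub_id_le hx)

end Fock

/-! ### Step functions -/

section StepFunctions

variable {k : Type u} [NormedAddCommGroup k]

/-- The step function with value `c` on `[0, T[`. -/
def ind (c : k) (T : ℝ) : ℝ → k := (Set.Ico 0 T).indicator fun _ => c

theorem ind_zero (T : ℝ) : ind (0 : k) T = 0 := by simp [ind]; rfl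

theorem before_before (s t : ℝ≥0) (g : ℝ → k) :
    before s (before t g) = before (min s t) g := by
  rw [before, before, Set.indicator_indicator, Set.Ico_inter_Ico, max_self, before, NNReal.coe_min]

theorem after_before (t : ℝ≥0) (g : ℝ → k) : after t (before t g) = 0 := by
  rw [after, before, Set.indicator_indicator]
  rw [← Set.indicator_empty' g]
  congr 1
  ext s
  simp only [Set.mem_inter_iff, Set.mem_Ici, Set.mem_Ico, Set.mem_empty_iff_false, iff_false]
  grind

theorem before_ind (c : k) {t : ℝ≥0} {T : ℝ} (h : (t : ℝ) ≤ T) : before t (ind c T) = ind c t := by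
  rw [before, ind, Set.indicator_indicator, Set.Ico_inter_Ico, max_self, min_eq_left h, ind]

theorem shift_ind (c : k) (r : ℝ≥0) (T : ℝ) : shift r (ind c T) = ind c (T - r) := by
  ext s
  have hr := r.coe_nonneg
  simp only [shift, ind, Set.indicator_apply, Set.mem_Ici, Set.mem_Ico]
  split_ifs <;> first | rfl | (exfalso; grind)

theorem toL2_eq {f : ℝ → k} (hf : MemLp f 2 (volume.restrict (Set.Ici (0 : ℝ)))) :
    toL2 f = hf.toLp f := dif_pos hf

theorem toL2_add {f g : ℝ → k} (hf : MemLp f 2 (volume.restrict (Set.Ici (0 : ℝ))))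
    (hg : MemLp g 2 (volume.restrict (Set.Ici (0 : ℝ)))) : toL2 (f + g) = toL2 f + toL2 g := by
  rw [toL2_eq hf, toL2_eq hg, toL2_eq (hf.add hg)]
  rfl

variable [InnerProductSpace ℂ k] {D : Submodule ℂ k}

/-- Proposition-valued, so that the indicator of `[0,t[` becomes a function of the pair `0 ≤ s`, `t
≤ s` and inherits piecewise constancy by composition. -/
theorem piecewiseConst_le (a : ℝ) : PiecewiseConst fun s : ℝ => a ≤ s where
  right r := by
    rcases le_or_gt a r with h | h
    · filter_upwards [self_mem_nhdsWithin] with s hs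
      simpa [h] using h.trans hs
    · filter_upwards [mem_nhdsWithin_of_mem_nhds (Iio_mem_nhds h)] with s hs
      simpa [not_le.mpr h] using hs
  left r := by
    rcases lt_or_ge a r with h | h
    · refine ⟨True, ?_⟩
      filter_upwards [mem_nhdsWithin_of_mem_nhds (Ioi_mem_nhds h)] with s hs
      simpa using le_of_lt hs
    · refine ⟨False, ?_⟩
      filter_upwards [self_mem_nhdsWithin] with s hs
      simpa using lt_of_lt_of_le hs h

open Classical in
theorem Step.piecewiseConst {g : ℝ → k} (hg : g ∈ Step D) : PiecewiseConst g := by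
  induction hg using Submodule.span_induction with
  | mem f hf =>
    obtain ⟨d, -, t, -, rfl⟩ := hf
    convert ((piecewiseConst_le 0).prodMk (piecewiseConst_le t)).comp
      (fun p : Prop × Prop => if p.1 ∧ ¬ p.2 then d else 0) using 2 with s
    simp only [Set.indicator_apply, Set.mem_Ico, not_le]
  | zero => exact ⟨fun r => by simp, fun r => ⟨0, by simp⟩⟩
  | add f g _ _ hf hg => exact (hf.prodMk hg).comp fun p => p.1 + p.2
  | smul c f _ hf => exact hf.comp fun x => c • x

theorem Step.apply_of_neg {g : ℝ → k} (hg : g ∈ Step D) {s : ℝ} (hs : s < 0) : g s = 0 := by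
  induction hg using Submodule.span_induction with
  | mem f hf =>
    obtain ⟨d, -, t, -, rfl⟩ := hf
    simp [hs]
  | zero => rfl
  | add f g _ _ hf hg => rw [Pi.add_apply, hf, hg, add_zero]
  | smul c f _ hf => rw [Pi.smul_apply, hf, smul_zero]

theorem Step.mono {D₁ D₂ : Submodule ℂ k} (h : D₁ ≤ D₂) : Step D₁ ≤ Step D₂ :=
  Submodule.span_mono fun _ ⟨d, hd, t, ht, hf⟩ => ⟨d, h hd, t, ht, hf⟩

theorem ind_mem {c : k} (hc : c ∈ D) (T : ℝ) : ind c T ∈ Step D := Step.indicator_mem hc T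

/-- Uses that step functions vanish on the negative half-line, since `before` only retains `[0,t[`.
-/
theorem after_eq_sub {g : ℝ → k} (hg : g ∈ Step D) (t : ℝ≥0) : after t g = g - before t g := by
  ext s
  have ht := t.coe_nonneg
  by_cases hs : (t : ℝ) ≤ s
  · have : ¬ s < t := not_lt.mpr hs
    simp [after, before, hs, this]
  · rcases lt_or_ge s 0 with h0 | h0
    · simp [after, before, hs, Step.apply_of_neg hg h0]
    · simp [after, before, hs, h0, not_le.mp hs]

theorem Step.after_mem {g : ℝ → k} (hg : g ∈ Step D) (t : ℝ≥0) : after t g ∈ Step D := by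
  rw [after_eq_sub hg]
  exact Submodule.sub_mem _ hg (Step.before_mem hg t)

theorem toL2_zero : toL2 (0 : ℝ → k) = 0 := by
  rw [toL2_eq (Step.memLp (Submodule.zero_mem (Step (⊤ : Submodule ℂ k))))]
  exact MemLp.toLp_zero _

theorem toL2_smul {f : ℝ → k} (hf : MemLp f 2 (volume.restrict (Set.Ici (0 : ℝ)))) (c : ℂ) :
    toL2 (c • f) = c • toL2 f := by
  rw [toL2_eq hf, toL2_eq (hf.const_smul c)]
  rfl

theorem inner_toL2 {f g : ℝ → k} (hf : MemLp f 2 (volume.restrict (Set.Ici (0 : ℝ))))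
    (hg : MemLp g 2 (volume.restrict (Set.Ici (0 : ℝ)))) :
    ⟪toL2 f, toL2 g⟫_ℂ = ∫ s in Set.Ici (0 : ℝ), ⟪f s, g s⟫_ℂ := by
  rw [toL2_eq hf, toL2_eq hg, L2.inner_def]
  refine integral_congr_ae ?_
  filter_upwards [hf.coeFn_toLp, hg.coeFn_toLp] with s h1 h2
  rw [h1, h2]

theorem integrable_inner_step {D' : Submodule ℂ k} {g' g : ℝ → k} (hg' : g' ∈ Step D')
    (hg : g ∈ Step D) :
    IntegrableOn (fun s => ⟪g' s, g s⟫_ℂ) (Set.Ici (0 : ℝ)) := by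
  have h := L2.integrable_inner (𝕜 := ℂ) ((Step.memLp hg').toLp g') ((Step.memLp hg).toLp g)
  refine h.congr ?_
  filter_upwards [(Step.memLp hg').coeFn_toLp, (Step.memLp hg).coeFn_toLp] with s h1 h2
  rw [h1, h2]

theorem inner_toL2_before_add_after {D' : Submodule ℂ k} {g' g : ℝ → k} (hg' : g' ∈ Step D')
    (hg : g ∈ Step D) (t : ℝ≥0) :
    ⟪toL2 (before t g'), toL2 (before t g)⟫_ℂ + ⟪toL2 (after t g'), toL2 (after t g)⟫_ℂ =
      ⟪toL2 g', toL2 g⟫_ℂ := by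
  rw [inner_toL2 (Step.memLp (Step.before_mem hg' t)) (Step.memLp (Step.before_mem hg t)),
    inner_toL2 (Step.memLp (Step.after_mem hg' t)) (Step.memLp (Step.after_mem hg t)),
    inner_toL2 (Step.memLp hg') (Step.memLp hg), ← integral_add]
  · refine setIntegral_congr_fun measurableSet_Ici fun s hs => ?_
    by_cases h : s < t
    · simp [before, after, h, not_le.mpr h, Set.mem_Ici.mp hs]
    · simp [before, after, h, not_lt.mp h]
  · exact integrable_inner_step (Step.before_mem hg' t) (Step.before_mem hg t)
  · exact integrable_inner_step (Step.after_mem hg' t) (Step.after_mem hg t)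

theorem inner_toL2_shift {D' : Submodule ℂ k} {g' g : ℝ → k} (hg' : g' ∈ Step D')
    (hg : g ∈ Step D) (t : ℝ≥0) :
    ⟪toL2 (shift t g'), toL2 (shift t g)⟫_ℂ = ⟪toL2 (after t g'), toL2 (after t g)⟫_ℂ := by
  rw [inner_toL2 (Step.memLp (Step.shift_mem hg' t)) (Step.memLp (Step.shift_mem hg t)),
    inner_toL2 (Step.memLp (Step.after_mem hg' t)) (Step.memLp (Step.after_mem hg t))]
  have h1 : (∫ s in Set.Ici (0 : ℝ), ⟪shift t g' s, shift t g s⟫_ℂ) =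
      ∫ s : ℝ, (Set.Ici (t : ℝ)).indicator (fun s => ⟪g' s, g s⟫_ℂ) (s + t) := by
    rw [← integral_indicator measurableSet_Ici]
    congr 1
    ext s
    by_cases h : 0 ≤ s
    · simp [shift, h]
    · simp [h]
  rw [h1, integral_add_right_eq_self (μ := volume)
    (fun s : ℝ => (Set.Ici (t : ℝ)).indicator (fun s => ⟪g' s, g s⟫_ℂ) s),
    ← integral_indicator measurableSet_Ici]
  congr 1
  ext s
  have ht := t.coe_nonneg
  by_cases h : (t : ℝ) ≤ s
  · simp [after, h, ht.trans h]
  · simp [after, h, Set.indicator_apply]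

theorem norm_toL2_shift_le {g : ℝ → k} (hg : g ∈ Step D) (t : ℝ≥0) :
    ‖toL2 (shift t g)‖ ≤ ‖toL2 g‖ := by
  refine (sq_le_sq₀ (norm_nonneg _) (norm_nonneg _)).mp ?_
  rw [← inner_self_eq_norm_sq (𝕜 := ℂ), ← inner_self_eq_norm_sq (𝕜 := ℂ) (toL2 g),
    inner_toL2_shift hg hg, ← inner_toL2_before_add_after hg hg t, map_add]
  exact le_add_of_nonneg_left inner_self_nonneg

theorem inner_toL2_ind (c' c : k) {t : ℝ} (ht : 0 ≤ t) :
    ⟪toL2 (ind c' t), toL2 (ind c t)⟫_ℂ = t * ⟪c', c⟫_ℂ := by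
  rw [inner_toL2 (Step.memLp (ind_mem (D := ⊤) trivial t)) (Step.memLp (ind_mem (D := ⊤) trivial t))]
  have : (fun s => ⟪ind c' t s, ind c t s⟫_ℂ) = (Set.Ico 0 t).indicator fun _ => ⟪c', c⟫_ℂ := by
    ext s
    by_cases hs : s ∈ Set.Ico 0 t
    · simp [ind, hs]
    · simp [ind, hs]
  rw [this, setIntegral_indicator measurableSet_Ico, setIntegral_const,
    Set.inter_eq_self_of_subset_right Set.Ico_subset_Ici_self, Real.volume_real_Ico_of_le ht,
    sub_zero, Complex.real_smul]

theorem norm_toL2_ind (c : k) {t : ℝ} (ht : 0 ≤ t) : ‖toL2 (ind c t)‖ = √t * ‖c‖ := by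
  refine (sq_eq_sq₀ (norm_nonneg _) (by positivity)).mp ?_
  rw [← inner_self_eq_norm_sq (𝕜 := ℂ), inner_toL2_ind c c ht, mul_pow, Real.sq_sqrt ht,
    ← inner_self_eq_norm_sq (𝕜 := ℂ) c]
  exact Complex.re_ofReal_mul _ _

/-- If `x` is orthogonal to all `d_{[0,t[}` with `d` in the dense subspace `D`, then all integrals
`∫₀ᵗ x` vanish, and Lebesgue differentiation gives `x = 0` almost everywhere. -/
theorem dense_toL2_step [CompleteSpace k] (hD : Dense (D : Set k)) (f : L2 k) :
    f ∈ closure (toL2 '' (Step D : Set (ℝ → k))) := by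
  let W : Submodule ℂ (L2 k) := Submodule.span ℂ {x | ∃ d ∈ D, ∃ t : ℝ, 0 ≤ t ∧ x = toL2 (ind d t)}
  have hW : (W : Set (L2 k)) ⊆ toL2 '' (Step D : Set (ℝ → k)) := by
    intro x hx
    induction hx using Submodule.span_induction with
    | mem x hx =>
      obtain ⟨d, hd, t, -, rfl⟩ := hx
      exact ⟨_, ind_mem hd t, rfl⟩
    | zero => exact ⟨0, Submodule.zero_mem _, toL2_zero⟩
    | add x y _ _ hx hy =>
      obtain ⟨p, hp, rfl⟩ := hx
      obtain ⟨q, hq, rfl⟩ := hy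
      exact ⟨p + q, Submodule.add_mem _ hp hq, toL2_add (Step.memLp hp) (Step.memLp hq)⟩
    | smul c x _ hx =>
      obtain ⟨p, hp, rfl⟩ := hx
      exact ⟨c • p, Submodule.smul_mem _ c hp, toL2_smul (Step.memLp hp) c⟩
  refine closure_mono hW ?_
  suffices h : W.topologicalClosure = ⊤ by
    have : f ∈ W.topologicalClosure := h ▸ trivial
    exact this
  rw [Submodule.topologicalClosure_eq_top_iff, Submodule.eq_bot_iff]
  intro x hx
  -- Extension by zero to the whole line; its primitive has to vanish for negative `t` as well
  -- before differentiating.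
  let y : ℝ → k := (Set.Ici (0 : ℝ)).indicator x
  have hy2 : MemLp y 2 volume := (memLp_indicator_iff_restrict measurableSet_Ici).mpr (Lp.memLp x)
  have hloc : LocallyIntegrable y volume := hy2.locallyIntegrable (by norm_num)
  have hint (a b : ℝ) : IntervalIntegrable y volume a b :=
    intervalIntegrable_iff.mpr <|
      (hloc.integrableOn_isCompact isCompact_uIcc).mono_set Set.uIoc_subset_uIcc
  have hzero (t : ℝ) : ∫ s in (0 : ℝ)..t, y s = 0 := by
    rcases lt_or_ge t 0 with ht | ht
    · rw [intervalIntegral.integral_of_ge ht.le]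
      have : ∫ s in Set.Ioc t 0, y s = ∫ s in Set.Ioo t 0, y s := integral_Ioc_eq_integral_Ioo
      rw [this, setIntegral_congr_fun (g := fun _ => (0 : k)) measurableSet_Ioo]
      · simp
      · intro s hs
        simp [y, hs.2]
    · refine eq_of_inner_dense hD fun d hd => ?_
      have h1 : ⟪toL2 (ind d t), x⟫_ℂ = 0 :=
        (Submodule.mem_orthogonal _ _).mp hx _ (Submodule.subset_span ⟨d, hd, t, ht, rfl⟩)
      rw [toL2_eq (Step.memLp (ind_mem hd t)), L2.inner_def] at h1
      rw [inner_zero_right, ← h1, ← innerSL_apply_apply ℂ,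
        ← ContinuousLinearMap.intervalIntegral_comp_comm _ (hint 0 t),
        intervalIntegral.integral_of_le ht, ← integral_Ico_eq_integral_Ioc,
        ← Set.inter_eq_self_of_subset_right (Set.Ico_subset_Ici_self (a := t) (b := (0 : ℝ))),
        ← setIntegral_indicator measurableSet_Ico]
      refine integral_congr_ae ?_
      filter_upwards [(Step.memLp (ind_mem hd t)).coeFn_toLp,
        ae_restrict_mem measurableSet_Ici] with s h2 h3
      rw [h2]
      by_cases hs : s ∈ Set.Ico 0 t
      · simp [ind, hs, y, Set.mem_Ici.mp h3]
      · simp [ind, hs]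
  have h0 : ∀ᵐ s, y s = 0 := by
    filter_upwards [LocallyIntegrable.ae_hasDerivAt_integral hloc] with s hs
    have h1 := hs 0
    simp only [hzero] at h1
    exact h1.unique (hasDerivAt_const s (0 : k))
  rw [Lp.eq_zero_iff_ae_eq_zero]
  filter_upwards [ae_restrict_of_ae h0, ae_restrict_mem measurableSet_Ici] with s h1 h2
  simpa [y, Set.mem_Ici.mp h2] using h1

theorem tendsto_ev {x : ℝ → k} {G : ℕ → ℝ → k}
    (h : Tendsto (fun n => toL2 (G n)) atTop (𝓝 (toL2 x))) :
    Tendsto (fun n => ev (G n)) atTop (𝓝 (ev x)) :=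
  (continuous_expVec.tendsto _).comp h

theorem dense_exps [CompleteSpace k] (hD : Dense (D : Set k)) :
    Dense (Exps D : Set (NoiseFock k)) := by
  have h1 (f : L2 k) : expVec f ∈ (Exps D).topologicalClosure := by
    have h2 : toL2 '' (Step D : Set (ℝ → k)) ⊆
        expVec ⁻¹' ((Exps D).topologicalClosure : Set (NoiseFock k)) := by
      rintro _ ⟨g, hg, rfl⟩
      exact Submodule.le_topologicalClosure _ (ev_mem hg)
    have h3 : IsClosed (expVec ⁻¹' ((Exps D).topologicalClosure : Set (NoiseFock k))) :=
      (Submodule.isClosed_topologicalClosure _).preimage continuous_expVec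
    exact closure_minimal h2 h3 (dense_toL2_step hD f)
  rw [Submodule.dense_iff_topologicalClosure_eq_top, eq_top_iff,
    ← (Submodule.dense_iff_topologicalClosure_eq_top.mp (dense_span_expVec (H := L2 k)))]
  refine Submodule.topologicalClosure_minimal _ (Submodule.span_le.mpr ?_)
    (Submodule.isClosed_topologicalClosure _)
  rintro _ ⟨f, rfl⟩
  exact h1 f

theorem inner_ev (g' g : ℝ → k) : ⟪ev g', ev g⟫_ℂ = Complex.exp ⟪toL2 g', toL2 g⟫_ℂ :=
  inner_expVec _ _

theorem inner_ev_zero_left (g : ℝ → k) : ⟪ev (0 : ℝ → k), ev g⟫_ℂ = 1 := by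
  rw [inner_ev, toL2_zero, inner_zero_left, Complex.exp_zero]

theorem inner_ev_zero_right (g : ℝ → k) : ⟪ev g, ev (0 : ℝ → k)⟫_ℂ = 1 := by
  rw [inner_ev, toL2_zero, inner_zero_right, Complex.exp_zero]

theorem inner_ev_before_after {D' : Submodule ℂ k} {g' g : ℝ → k} (hg' : g' ∈ Step D')
    (hg : g ∈ Step D) (t : ℝ≥0) :
    ⟪ev (before t g'), ev (before t g)⟫_ℂ * ⟪ev (after t g'), ev (after t g)⟫_ℂ =
      ⟪ev g', ev g⟫_ℂ := by
  simp only [inner_ev]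
  rw [← Complex.exp_add, inner_toL2_before_add_after hg' hg]

theorem inner_ev_shift {D' : Submodule ℂ k} {g' g : ℝ → k} (hg' : g' ∈ Step D')
    (hg : g ∈ Step D) (t : ℝ≥0) :
    ⟪ev (shift t g'), ev (shift t g)⟫_ℂ = ⟪ev (after t g'), ev (after t g)⟫_ℂ := by
  simp only [inner_ev]
  rw [inner_toL2_shift hg' hg]

/-- The isometry `F → F ⊗ F` with `ε(g) ↦ ε(g_{[0,r[}) ⊗ ε(S_r^* g)`. -/
theorem exists_fock_splitting [CompleteSpace k] (r : ℝ≥0) :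
    ∃ L : NoiseFock k →ₗᵢ[ℂ] HTensor (NoiseFock k) (NoiseFock k),
      ∀ g ∈ Step (⊤ : Submodule ℂ k), L (ev g) = tmulH (ev (before r g)) (ev (shift r g)) := by
  obtain ⟨L, hL⟩ := exists_isometry_of_gram
    (a := fun g : Step (⊤ : Submodule ℂ k) => ev (g : ℝ → k))
    (b := fun g : Step (⊤ : Submodule ℂ k) =>
      tmulH (ev (before r (g : ℝ → k))) (ev (shift r (g : ℝ → k))))
    (fun g' g => by
      rw [inner_tmulH, inner_ev_shift g'.2 g.2, inner_ev_before_after g'.2 g.2]) (by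
      have h := dense_exps (D := (⊤ : Submodule ℂ k)) (by simp)
      refine h.mono (Submodule.span_mono ?_)
      rintro _ ⟨g, hg, rfl⟩
      exact ⟨⟨g, hg⟩, rfl⟩)
  exact ⟨L, fun g hg => hL ⟨g, hg⟩⟩

/-- The intervals are kept and only the values are approximated, so pointwise convergence, a uniform
bound and `L²` convergence hold simultaneously. All three enter the dominated convergence argument
for `isDivergence_of_dense`. -/
theorem exists_step_approx {D' : Submodule ℂ k} (hD' : Dense (D' : Set k)) {g : ℝ → k}
    (hg : g ∈ Step (⊤ : Submodule ℂ k)) :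
    ∃ G : ℕ → ℝ → k, (∀ n, G n ∈ Step D') ∧ (∀ s, Tendsto (fun n => G n s) atTop (𝓝 (g s))) ∧
      (∃ C : ℝ, ∀ n s, ‖G n s‖ ≤ C) ∧ Tendsto (fun n => toL2 (G n)) atTop (𝓝 (toL2 g)) := by
  induction hg using Submodule.span_induction with
  | mem f hf =>
    obtain ⟨d, -, t, ht, rfl⟩ := hf
    obtain ⟨x, hx, hlim⟩ := mem_closure_iff_seq_limit.mp (hD' d)
    obtain ⟨C, hC⟩ := hlim.norm.bddAbove_range
    have hC' (n : ℕ) : ‖x n‖ ≤ C := hC ⟨n, rfl⟩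
    have hC0 : 0 ≤ C := (norm_nonneg _).trans (hC' 0)
    refine ⟨fun n => ind (x n) t, fun n => ind_mem (hx n) t, fun s => ?_, ⟨C, fun n s => ?_⟩, ?_⟩
    · by_cases hs : s ∈ Set.Ico 0 t
      · simpa [ind, hs] using hlim
      · simp [ind, hs]
    · by_cases hs : s ∈ Set.Ico 0 t
      · simpa [ind, hs] using hC' n
      · simpa [ind, hs] using hC0
    · rw [tendsto_iff_norm_sub_tendsto_zero]
      have h1 (n : ℕ) : ‖toL2 (ind (x n) t) - toL2 (ind d t)‖ = √t * ‖x n - d‖ := by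
        rw [← norm_toL2_ind (x n - d) ht]
        congr 1
        rw [sub_eq_iff_eq_add, ← toL2_add (Step.memLp (ind_mem (D := ⊤) trivial t))
          (Step.memLp (ind_mem (D := ⊤) trivial t)), ind, ind, ind, ← Set.indicator_add']
        congr 2
        ext s
        simp
      change Tendsto (fun n => ‖toL2 (ind (x n) t) - toL2 (ind d t)‖) atTop (𝓝 0)
      simp only [h1]
      simpa using (tendsto_iff_norm_sub_tendsto_zero.mp hlim).const_mul √t
  | zero =>
    exact ⟨fun _ => 0, fun _ => Submodule.zero_mem _, fun s => tendsto_const_nhds,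
      ⟨0, fun n s => by simp⟩, tendsto_const_nhds⟩
  | add f g hf hg ihf ihg =>
    obtain ⟨F, hF, hF1, ⟨C, hC⟩, hF2⟩ := ihf
    obtain ⟨G, hG, hG1, ⟨C', hC'⟩, hG2⟩ := ihg
    refine ⟨fun n => F n + G n, fun n => Submodule.add_mem _ (hF n) (hG n),
      fun s => (hF1 s).add (hG1 s), ⟨C + C', fun n s => norm_add_le_of_le (hC n s) (hC' n s)⟩, ?_⟩
    rw [toL2_add (Step.memLp hf) (Step.memLp hg)]
    exact (hF2.add hG2).congr fun n => (toL2_add (Step.memLp (hF n)) (Step.memLp (hG n))).symm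
  | smul c f hf ihf =>
    obtain ⟨F, hF, hF1, ⟨C, hC⟩, hF2⟩ := ihf
    refine ⟨fun n => c • F n, fun n => Submodule.smul_mem _ c (hF n),
      fun s => (hF1 s).const_smul c, ⟨‖c‖ * C, fun n s => ?_⟩, ?_⟩
    · change ‖c • F n s‖ ≤ _
      rw [norm_smul]
      gcongr
      exact hC n s
    · rw [toL2_smul (Step.memLp hf)]
      exact (hF2.const_smul c).congr fun n => (toL2_smul (Step.memLp (hF n)) c).symm

end StepFunctions

/-! ### Slices of cocycles -/

section Slices

variable {k : Type u} [NormedAddCommGroup k] [InnerProductSpace ℂ k]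
variable {h : Type v} [NormedAddCommGroup h] [InnerProductSpace ℂ h]
variable {h' : Type w} [NormedAddCommGroup h'] [InnerProductSpace ℂ h']
variable {V : Submodule ℂ (h →L[ℂ] h')} {D D' : Submodule ℂ k}

/-- The exponential vector of a step function, as an element of `Exps D`. -/
def evE (g : Step D) : Exps D := ⟨ev (g : ℝ → k), ev_mem g.2⟩

/-- The restriction of a step function to `[0,t[`. -/
def beforeS (t : ℝ≥0) (g : Step D) : Step D := ⟨before t (g : ℝ → k), Step.before_mem g.2 t⟩

/-- The shift of a step function. -/
def shiftS (t : ℝ≥0) (g : Step D) : Step D := ⟨shift t (g : ℝ → k), Step.shift_mem g.2 t⟩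

/-- The step function with value `c ∈ D` on `[0,T[`. -/
def indS (c : D) (T : ℝ) : Step D := ⟨ind (c : k) T, ind_mem c.2 T⟩

theorem coe_evE (g : Step D) : (evE g : NoiseFock k) = ev (g : ℝ → k) := rfl

theorem exps_induction {p : Exps D → Prop} (hev : ∀ g : Step D, p (evE g)) (h0 : p 0)
    (hadd : ∀ x y, p x → p y → p (x + y)) (hsmul : ∀ (c : ℂ) (x), p x → p (c • x)) (e : Exps D) :
    p e := by
  obtain ⟨e, he⟩ := e
  induction he using Submodule.span_induction with
  | mem x hx =>
    obtain ⟨g, hg, rfl⟩ := hx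
    exact hev ⟨g, hg⟩
  | zero => exact h0
  | add x y hx hy ihx ihy => exact hadd ⟨x, hx⟩ ⟨y, hy⟩ ihx ihy
  | smul c x hx ih => exact hsmul c ⟨x, hx⟩ ih

theorem column_apply (T : Op (expDomain (⊤ : Submodule ℂ h) D) (HTensor h' (NoiseFock k)))
    (e : Exps D) (a : h) : column T e a = T (domVec ⟨a, trivial⟩ e) := rfl

theorem column_add_right (T : Op (expDomain (⊤ : Submodule ℂ h) D) (HTensor h' (NoiseFock k)))
    (e₁ e₂ : Exps D) (a : h) : column T (e₁ + e₂) a = column T e₁ a + column T e₂ a := by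
  simp only [column_apply, ← map_add]
  congr 1
  exact Subtype.ext (tmulH_add_right _ _ _)

theorem column_smul_right (T : Op (expDomain (⊤ : Submodule ℂ h) D) (HTensor h' (NoiseFock k)))
    (c : ℂ) (e : Exps D) (a : h) : column T (c • e) a = c • column T e a := by
  simp only [column_apply, ← map_smul]
  congr 1
  exact Subtype.ext (tmulH_smul_right _ _ _)

theorem ext_inner_apply {x y : V}
    (hxy : ∀ (a' : h') (a : h), ⟪a', (x : h →L[ℂ] h') a⟫_ℂ = ⟪a', (y : h →L[ℂ] h') a⟫_ℂ) :
    x = y :=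
  Subtype.ext (ContinuousLinearMap.ext fun a => ext_inner_left ℂ fun a' => hxy a' a)

theorem norm_le_of_inner_apply {x : V} {C : ℝ} (hC : 0 ≤ C)
    (hx : ∀ (a' : h') (a : h), ‖⟪a', (x : h →L[ℂ] h') a⟫_ℂ‖ ≤ C * ‖a'‖ * ‖a‖) : ‖x‖ ≤ C := by
  refine ContinuousLinearMap.opNorm_le_bound (x : h →L[ℂ] h') hC fun a => ?_
  have h1 := hx ((x : h →L[ℂ] h') a) a
  rw [inner_self_eq_norm_sq_to_K, norm_pow, RCLike.norm_ofReal, abs_norm, sq, mul_right_comm] at h1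
  rcases (norm_nonneg ((x : h →L[ℂ] h') a)).eq_or_lt with h0 | h0
  · rw [← h0]
    positivity
  · exact le_of_mul_le_mul_right h1 h0

variable [CompleteSpace h'] {kk : OpFamily V D}

theorem inner_sliceMap (hk : SlicesInto kk D') (t : ℝ≥0) (e' : Exps D') (e : Exps D) (x : V)
    (a' : h') (a : h) :
    ⟪a', (sliceMap hk t e' e x : h →L[ℂ] h') a⟫_ℂ =
      ⟪tmulH a' (e' : NoiseFock k), column (kk t x) e a⟫_ℂ := by
  have h1 : inclLin V (sliceMap hk t e' e x) = slice (e' : NoiseFock k) e (kk t x) :=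
    congrArg Subtype.val ((LinearEquiv.ofInjective (inclLin V) (inclLin_injective V)).apply_symm_apply
      ⟨slice (e' : NoiseFock k) e (kk t x), hk t x e' e⟩)
  have h2 : (sliceMap hk t e' e x : h →L[ℂ] h') a = bra (e' : NoiseFock k) (column (kk t x) e a) :=
    congrArg (fun l : h →ₗ[ℂ] h' => l a) h1
  rw [h2, inner_bra]

/-- The map `(e', e) ↦ ω_{e',e} • k_t(x) - ⟪e', e⟫ x`. -/
def increment (hk : SlicesInto kk D') (t : ℝ≥0) (x : V) : Exps D' →ₗ⋆[ℂ] Exps D →ₗ[ℂ] V :=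
  LinearMap.mk₂'ₛₗ (starRingEnd ℂ) (RingHom.id ℂ)
    (fun e' e => sliceMap hk t e' e x - ⟪(e' : NoiseFock k), (e : NoiseFock k)⟫_ℂ • x)
    (fun e₁ e₂ e => ext_inner_apply fun a' a => by
      simp only [Submodule.coe_sub, Submodule.coe_add, Submodule.coe_smul,
        _root_.sub_apply, _root_.add_apply, _root_.smul_apply,
        inner_sub_right, inner_add_right, inner_smul_right, inner_sliceMap, tmulH_add_right,
        inner_add_left, Submodule.coe_add]
      ring)
    (fun c e' e => ext_inner_apply fun a' a => by
      simp only [Submodule.coe_sub, Submodule.coe_smul,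
        _root_.sub_apply, _root_.smul_apply,
        inner_sub_right, inner_smul_right, inner_sliceMap, tmulH_smul_right, inner_smul_left]
      ring)
    (fun e' e₁ e₂ => ext_inner_apply fun a' a => by
      simp only [Submodule.coe_sub, Submodule.coe_add, Submodule.coe_smul,
        _root_.sub_apply, _root_.add_apply, _root_.smul_apply,
        inner_sub_right, inner_add_right, inner_smul_right, inner_sliceMap, column_add_right]
      ring)
    (fun c e' e => ext_inner_apply fun a' a => by
      simp only [Submodule.coe_sub, Submodule.coe_smul,
        _root_.sub_apply, _root_.smul_apply, RingHom.id_apply,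
        inner_sub_right, inner_smul_right, inner_sliceMap, column_smul_right]
      ring)

theorem increment_apply (hk : SlicesInto kk D') (t : ℝ≥0) (x : V) (e' : Exps D') (e : Exps D) :
    increment hk t x e' e = sliceMap hk t e' e x - ⟪(e' : NoiseFock k), (e : NoiseFock k)⟫_ℂ • x := rfl

theorem sliceMap_eq (hk : SlicesInto kk D') (t : ℝ≥0) (x : V) (e' : Exps D') (e : Exps D) :
    sliceMap hk t e' e x = increment hk t x e' e + ⟪(e' : NoiseFock k), (e : NoiseFock k)⟫_ℂ • x := by
  rw [increment_apply, sub_add_cancel]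

theorem kgg_eq_before (hk : SlicesInto kk D') (g' : Step D') (g : Step D) (t : ℝ≥0) :
    kgg hk g' g t = Complex.exp (-⟪toL2 (before t (g' : ℝ → k)), toL2 (before t (g : ℝ → k))⟫_ℂ) •
      sliceMap hk t (evE (beforeS t g')) (evE (beforeS t g)) := rfl

theorem kgg_congr (hk : SlicesInto kk D') {g₁' g₂' : Step D'} {g₁ g₂ : Step D} {t : ℝ≥0}
    (h1 : before t (g₁' : ℝ → k) = before t (g₂' : ℝ → k))
    (h2 : before t (g₁ : ℝ → k) = before t (g₂ : ℝ → k)) :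
    kgg hk g₁' g₁ t = kgg hk g₂' g₂ t := by
  have e1 : beforeS t g₁' = beforeS t g₂' := Subtype.ext h1
  have e2 : beforeS t g₁ = beforeS t g₂ := Subtype.ext h2
  rw [kgg_eq_before, kgg_eq_before, h1, h2, e1, e2]

end Slices

section CocycleSlices

variable {k : Type u} [NormedAddCommGroup k] [InnerProductSpace ℂ k]
variable {h : Type v} [NormedAddCommGroup h] [InnerProductSpace ℂ h]
variable {h' : Type w} [NormedAddCommGroup h'] [InnerProductSpace ℂ h'] [CompleteSpace h']
variable {V : Submodule ℂ (h →L[ℂ] h')} {D D' : Submodule ℂ k} {kk : OpFamily V D}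

theorem IsCocycle.sliceMap_adapted (hc : IsCocycle kk D') (t : ℝ≥0) (g' : Step D') (g : Step D)
    (x : V) :
    sliceMap hc.slices t (evE g') (evE g) x =
      ⟪ev (after t (g' : ℝ → k)), ev (after t (g : ℝ → k))⟫_ℂ •
        sliceMap hc.slices t (evE (beforeS t g')) (evE (beforeS t g)) x := by
  refine ext_inner_apply fun a' a => ?_
  rw [inner_sliceMap, Submodule.coe_smul, _root_.smul_apply, inner_smul_right,
    inner_sliceMap, mul_comm]
  exact (hc.isProcess x).adapted t ⟨a, trivial⟩ g g.2 a' g' (Step.mono le_top g'.2)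

/-- Adaptedness absorbs the truncations: the exponential vectors and the normalising factor no
longer depend on `t`, so continuity in `t` reduces to that of a fixed slice. -/
theorem IsCocycle.kgg_eq (hc : IsCocycle kk D') (t : ℝ≥0) (g' : Step D') (g : Step D) (x : V) :
    kgg hc.slices g' g t x =
      Complex.exp (-⟪toL2 (g' : ℝ → k), toL2 (g : ℝ → k)⟫_ℂ) •
        sliceMap hc.slices t (evE g') (evE g) x := by
  rw [hc.sliceMap_adapted, kgg_eq_before, smul_smul, inner_ev, ← Complex.exp_add,
    ← inner_toL2_before_add_after g'.2 g.2 t, LinearMap.smul_apply]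
  congr 2
  ring

theorem IsCocycle.sliceMap_ev (hc : IsCocycle kk D') (t : ℝ≥0) (g' : Step D') (g : Step D) (x : V) :
    sliceMap hc.slices t (evE g') (evE g) x =
      ⟪ev (g' : ℝ → k), ev (g : ℝ → k)⟫_ℂ • kgg hc.slices g' g t x := by
  rw [hc.kgg_eq, smul_smul, inner_ev, ← Complex.exp_add, add_neg_cancel, Complex.exp_zero, one_smul]

/-- The cocycle law without normalisation: the factor `⟪ε(g'), ε(g)⟫` splits into the factors of
past and shifted future, so the exponentials cancel. -/
theorem IsCocycle.sliceMap_add (hc : IsCocycle kk D') (r t : ℝ≥0) (g' : Step D') (g : Step D)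
    (x : V) :
    sliceMap hc.slices (r + t) (evE g') (evE g) x =
      sliceMap hc.slices r (evE (beforeS r g')) (evE (beforeS r g))
        (sliceMap hc.slices t (evE (shiftS r g')) (evE (shiftS r g)) x) := by
  have h1 : kgg hc.slices g' g (r + t) x =
      kgg hc.slices g' g r (kgg hc.slices (shiftS r g') (shiftS r g) t x) :=
    congrArg (fun l : V →ₗ[ℂ] V => l x) (hc.add g' g r t)
  have h2 : kgg hc.slices (beforeS r g') (beforeS r g) r = kgg hc.slices g' g r :=
    kgg_congr _ (by simp [beforeS, before_before]) (by simp [beforeS, before_before])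
  rw [hc.sliceMap_ev, hc.sliceMap_ev, hc.sliceMap_ev, map_smul, smul_smul, h1, h2]
  congr 1
  rw [← inner_ev_before_after g'.2 g.2 r, ← inner_ev_shift g'.2 g.2 r]
  rfl

theorem IsCocycle.increment_zero (hc : IsCocycle kk D') (x : V) (e' : Exps D') (e : Exps D) :
    increment hc.slices 0 x e' e = 0 := by
  induction e using exps_induction with
  | h0 => exact map_zero _
  | hadd e₁ e₂ h1 h2 => rw [map_add, h1, h2, add_zero]
  | hsmul c e h1 => rw [map_smul, h1, smul_zero]
  | hev g =>
    induction e' using exps_induction with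
    | h0 => rw [map_zero, LinearMap.zero_apply]
    | hadd e₁ e₂ h1 h2 => rw [map_add, LinearMap.add_apply, h1, h2, add_zero]
    | hsmul c e h1 => rw [LinearMap.map_smulₛₗ, LinearMap.smul_apply, h1, smul_zero]
    | hev g' =>
      rw [increment_apply, hc.sliceMap_ev, hc.zero]
      exact sub_self _

theorem IsCocycle.sliceMap_zero (hc : IsCocycle kk D') (x : V) (e' : Exps D') (e : Exps D) :
    sliceMap hc.slices 0 e' e x = ⟪(e' : NoiseFock k), (e : NoiseFock k)⟫_ℂ • x := by
  rw [sliceMap_eq, hc.increment_zero, zero_add]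

end CocycleSlices

/-! ### Uniform bounds for slices and increments, from the columns of `k` and of `k†` -/

section HolderBounds

variable {k : Type u} [NormedAddCommGroup k] [InnerProductSpace ℂ k]
variable {h : Type v} [NormedAddCommGroup h] [InnerProductSpace ℂ h]
variable {h' : Type w} [NormedAddCommGroup h'] [InnerProductSpace ℂ h'] [CompleteSpace h']
variable {V : Submodule ℂ (h →L[ℂ] h')} {D D' : Submodule ℂ k} {kk : OpFamily V D}

theorem dense_expDomain_top [CompleteSpace k] (H : Type*) [NormedAddCommGroup H] [InnerProductSpace ℂ H]
    (hD : Dense (D : Set k)) :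
    Dense (expDomain (⊤ : Submodule ℂ H) D : Set (HTensor H (NoiseFock k))) :=
  dense_algTensor (by simp) (dense_exps hD)

theorem inner_opConj {H K : Type*} [NormedAddCommGroup H] [InnerProductSpace ℂ H] [CompleteSpace H]
    [NormedAddCommGroup K] [InnerProductSpace ℂ K] {E : Submodule ℂ H} {E' : Submodule ℂ K}
    (hE : Dense (E : Set H)) (T : Op E K) (hT : T ∈ OpDagger E E') (y : E') (x : E) :
    ⟪opConj T hT y, (x : H)⟫_ℂ = ⟪(y : K), T x⟫_ℂ :=
  LinearPMap.adjoint_isFormalAdjoint (T := ⟨E, T⟩) hE (Submodule.inclusion hT y) x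

theorem IsHolderCocycle.exists_norm_sliceMap_le (hk : IsHolderCocycle kk D') (t : ℝ≥0) (x : V)
    (e : Exps D) : ∃ C : ℝ, 0 ≤ C ∧ ∀ e' : Exps D',
      ‖sliceMap hk.cocycle.slices t e' e x‖ ≤ C * ‖(e' : NoiseFock k)‖ := by
  obtain ⟨C, hC⟩ := hk.holder.bounded t x e
  refine ⟨max C 0, le_max_right _ _, fun e' => norm_le_of_inner_apply (by positivity) fun a' a => ?_⟩
  rw [inner_sliceMap]
  refine (norm_inner_le_norm _ _).trans ?_
  rw [norm_tmulH]
  calc ‖a'‖ * ‖(e' : NoiseFock k)‖ * ‖column (kk t x) e a‖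
      ≤ ‖a'‖ * ‖(e' : NoiseFock k)‖ * (max C 0 * ‖a‖) := by
        gcongr
        exact (hC a).trans (by gcongr; exact le_max_left _ _)
    _ = max C 0 * ‖(e' : NoiseFock k)‖ * ‖a'‖ * ‖a‖ := by ring

/-- Hölder continuity of the column of `k` at the fixed vector `e`; the constant is uniform in the
left argument `e'`. -/
theorem IsHolderCocycle.exists_norm_increment_le_left (hk : IsHolderCocycle kk D') (x : V)
    (e : Exps D) : ∃ C : ℝ, 0 ≤ C ∧ ∃ δ : ℝ≥0, 0 < δ ∧ ∀ s : ℝ≥0, s < δ → ∀ e' : Exps D',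
      ‖increment hk.cocycle.slices s x e' e‖ ≤ C * √s * ‖(e' : NoiseFock k)‖ := by
  obtain ⟨C, δ, hδ, hC⟩ := hk.holder.holder x e
  refine ⟨max C 0, le_max_right _ _, δ, hδ, fun s hs e' => norm_le_of_inner_apply
    (by positivity) fun a' a => ?_⟩
  rw [increment_apply, ← hk.cocycle.sliceMap_zero, Submodule.coe_sub, _root_.sub_apply,
    inner_sub_right, inner_sliceMap, inner_sliceMap, ← inner_sub_right]
  refine (norm_inner_le_norm _ _).trans ?_
  rw [norm_tmulH]
  calc ‖a'‖ * ‖(e' : NoiseFock k)‖ * ‖column (kk s x) e a - column (kk 0 x) e a‖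
      ≤ ‖a'‖ * ‖(e' : NoiseFock k)‖ * (max C 0 * √s * ‖a‖) := by
        gcongr
        exact (hC s hs a).trans (by gcongr; exact le_max_left _ _)
    _ = max C 0 * √s * ‖(e' : NoiseFock k)‖ * ‖a'‖ * ‖a‖ := by ring

/-- The mirror estimate, obtained from the column of `k†` at the fixed vector `e'` by moving the
operator to the other side of the inner product; the constant is uniform in `e`. -/
theorem IsHolderCocycle.exists_norm_increment_le_right [CompleteSpace k]
    (hk : IsHolderCocycle kk D') (hD : Dense (D : Set k)) (x : V)
    (e' : Exps D') : ∃ C : ℝ, 0 ≤ C ∧ ∃ δ : ℝ≥0, 0 < δ ∧ ∀ s : ℝ≥0, s < δ → ∀ e : Exps D,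
      ‖increment hk.cocycle.slices s x e' e‖ ≤ C * √s * ‖(e : NoiseFock k)‖ := by
  obtain ⟨C, δ, hδ, hC⟩ := hk.holder_conj.holder x e'
  have hadj (t : ℝ≥0) (a' : h') (a : h) (e : Exps D) :
      ⟪tmulH a' (e' : NoiseFock k), column (kk t x) e a⟫_ℂ =
        ⟪column (opConj (kk t x) (hk.dagger t x)) e' a', tmulH a (e : NoiseFock k)⟫_ℂ :=
    (inner_opConj (dense_expDomain_top h hD) (kk t x) (hk.dagger t x)
      (domVec ⟨a', trivial⟩ e') (domVec ⟨a, trivial⟩ e)).symm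
  refine ⟨max C 0, le_max_right _ _, δ, hδ, fun s hs e => norm_le_of_inner_apply
    (by positivity) fun a' a => ?_⟩
  rw [increment_apply, ← hk.cocycle.sliceMap_zero, Submodule.coe_sub, _root_.sub_apply,
    inner_sub_right, inner_sliceMap, inner_sliceMap, hadj, hadj, ← inner_sub_left]
  refine (norm_inner_le_norm _ _).trans ?_
  rw [norm_tmulH]
  calc _ ≤ (max C 0 * √s * ‖a'‖) * (‖a‖ * ‖(e : NoiseFock k)‖) := by
        gcongr
        exact (hC s hs a').trans (by gcongr; exact le_max_left _ _)
    _ = max C 0 * √s * ‖(e : NoiseFock k)‖ * ‖a'‖ * ‖a‖ := by ring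

end HolderBounds

/-! ### Associated semigroups -/

section FiniteDimensionalSemigroup

variable {W : Type*} [NormedAddCommGroup W] [NormedSpace ℂ W] [FiniteDimensional ℂ W]

/-- In finite dimensions pointwise continuity at `0` is norm continuity, so the Banach algebra
results apply in the algebra of bounded operators on `W`. -/
theorem semigroup_of_finiteDimensional {p : ℝ≥0 → W →ₗ[ℂ] W} (hzero : p 0 = LinearMap.id)
    (hadd : ∀ s t, p (s + t) = p s ∘ₗ p t) (h0 : ∀ x, Tendsto (fun t => p t x) (𝓝 0) (𝓝 x)) :
    (∀ x, Continuous fun t => p t x) ∧ ∃ ψ : W → W, ∀ x,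
      Tendsto (fun t : ℝ => (t : ℂ)⁻¹ • (p t.toNNReal x - x)) (𝓝[>] 0) (𝓝 (ψ x)) := by
  have : CompleteSpace W := FiniteDimensional.complete ℂ W
  let q : ℝ≥0 → W →L[ℂ] W := fun t => (p t).toContinuousLinearMap
  have hq0 : q 0 = 1 := by
    ext x
    simp [q, hzero]
  have hqadd (s t : ℝ≥0) : q (s + t) = q s * q t := by
    ext x
    simp [q, hadd]
  have hqlim : Tendsto q (𝓝 0) (𝓝 1) := by
    rw [← hq0]
    refine (continuousAt_clm_apply (f := q)).mpr fun x => ?_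
    have : q 0 x = x := by rw [hq0]; rfl
    rw [ContinuousAt, this]
    exact h0 x
  refine ⟨fun x => (continuous_clm_apply (f := q)).mp (continuous_of_semigroup hqadd hqlim) x, ?_⟩
  obtain ⟨ψ, hψ⟩ := exists_generator_of_semigroup hq0 hqadd hqlim
  refine ⟨fun x => ψ x, fun x => ?_⟩
  have h1 := ((ContinuousLinearMap.apply ℂ W x).continuous.tendsto ψ).comp hψ
  refine h1.congr fun t => ?_
  rw [← Complex.ofReal_inv, Complex.coe_smul]
  rfl

end FiniteDimensionalSemigroup

section Semigroups

variable {k : Type u} [NormedAddCommGroup k] [InnerProductSpace ℂ k]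
variable {h : Type v} [NormedAddCommGroup h] [InnerProductSpace ℂ h]
variable {h' : Type w} [NormedAddCommGroup h'] [InnerProductSpace ℂ h'] [CompleteSpace h']
variable {V : Submodule ℂ (h →L[ℂ] h')} {D D' : Submodule ℂ k} {kk : OpFamily V D}

/-- The semigroup `P^{c',c}` on `V` associated with a cocycle. -/
def assocSemigroup (hs : SlicesInto kk D') (c' : D') (c : D) (t : ℝ≥0) : V →ₗ[ℂ] V :=
  kgg hs (indS c' t) (indS c t) t

theorem kgg_eq_assocSemigroup (hs : SlicesInto kk D') {c' : D'} {c : D} {g' : Step D'} {g : Step D}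
    {t : ℝ≥0} (h1 : before t (g' : ℝ → k) = ind (c' : k) t)
    (h2 : before t (g : ℝ → k) = ind (c : k) t) :
    kgg hs g' g t = assocSemigroup hs c' c t :=
  kgg_congr hs (h1.trans (before_ind _ le_rfl).symm) (h2.trans (before_ind _ le_rfl).symm)

theorem IsCocycle.assocSemigroup_zero (hc : IsCocycle kk D') (c' : D') (c : D) :
    assocSemigroup hc.slices c' c 0 = LinearMap.id := hc.zero _ _

/-- A constant function is unchanged by the shift, apart from its horizon, so the cocycle law
becomes the semigroup law. -/
theorem IsCocycle.assocSemigroup_add (hc : IsCocycle kk D') (c' : D') (c : D) (r t : ℝ≥0) :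
    assocSemigroup hc.slices c' c (r + t) =
      assocSemigroup hc.slices c' c r ∘ₗ assocSemigroup hc.slices c' c t := by
  rw [assocSemigroup, hc.add]
  congr 1
  · exact kgg_eq_assocSemigroup _ (before_ind _ (by simp)) (before_ind _ (by simp))
  · refine kgg_eq_assocSemigroup _ ?_ ?_ <;>
    · change before t (shift r (ind _ _)) = _
      rw [shift_ind, before_ind]
      simp

theorem IsCocycle.increment_ind (hc : IsCocycle kk D') (c' : D') (c : D) (t : ℝ≥0) (x : V) :
    increment hc.slices t x (evE (indS c' t)) (evE (indS c t)) =
      Complex.exp (t * ⟪(c' : k), (c : k)⟫_ℂ) • (assocSemigroup hc.slices c' c t x - x) := by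
  have h1 : ⟪(evE (indS c' t) : NoiseFock k), (evE (indS c t) : NoiseFock k)⟫_ℂ =
      Complex.exp (t * ⟪(c' : k), (c : k)⟫_ℂ) := by
    rw [coe_evE, coe_evE, inner_ev]
    exact congrArg Complex.exp (inner_toL2_ind _ _ t.coe_nonneg)
  rw [increment_apply, hc.sliceMap_ev, ← coe_evE, ← coe_evE, h1]
  exact (smul_sub (Complex.exp (t * ⟪(c' : k), (c : k)⟫_ℂ))
    (assocSemigroup hc.slices c' c t x) x).symm

theorem IsHolderCocycle.tendsto_increment (hk : IsHolderCocycle kk D') (x : V) (e' : Exps D')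
    (e : Exps D) :
    Tendsto (fun s => increment hk.cocycle.slices s x e' e) (𝓝 0) (𝓝 0) := by
  obtain ⟨C, hC, δ, hδ, hb⟩ := hk.exists_norm_increment_le_left x e
  refine squeeze_zero_norm' (a := fun s : ℝ≥0 => C * √s * ‖(e' : NoiseFock k)‖) ?_ ?_
  · filter_upwards [Iio_mem_nhds hδ] with s hs using hb s hs e'
  · have : Continuous fun s : ℝ≥0 => C * √(s : ℝ) * ‖(e' : NoiseFock k)‖ := by fun_prop
    simpa using this.tendsto 0

theorem IsHolderCocycle.tendsto_assocSemigroup (hk : IsHolderCocycle kk D') (c' : D') (c : D)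
    (x : V) : Tendsto (fun t => assocSemigroup hk.cocycle.slices c' c t x) (𝓝 0) (𝓝 x) := by
  -- With the fixed horizon `1` the slicing vectors do not move with `s`; for `s ≤ 1` the result is
  -- the semigroup.
  have h1 : Tendsto (fun s => kgg hk.cocycle.slices (indS c' 1) (indS c 1) s x) (𝓝 0)
      (𝓝 (kgg hk.cocycle.slices (indS c' 1) (indS c 1) 0 x)) := by
    simp only [hk.cocycle.kgg_eq, sliceMap_eq]
    refine Tendsto.const_smul (Tendsto.add_const _ ?_) _
    rw [hk.cocycle.increment_zero]
    exact hk.tendsto_increment x _ _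
  rw [hk.cocycle.zero] at h1
  refine h1.congr' ?_
  filter_upwards [Iic_mem_nhds (zero_lt_one : (0 : ℝ≥0) < 1)] with s hs
  rw [kgg_eq_assocSemigroup _ (before_ind _ (by exact_mod_cast hs))
      (before_ind _ (by exact_mod_cast hs))]

variable [FiniteDimensional ℂ V]

theorem IsHolderCocycle.continuous_assocSemigroup (hk : IsHolderCocycle kk D') (c' : D') (c : D)
    (x : V) : Continuous fun t => assocSemigroup hk.cocycle.slices c' c t x := by
  have h1 := semigroup_of_finiteDimensional (W := V) (hk.cocycle.assocSemigroup_zero c' c)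
    (hk.cocycle.assocSemigroup_add c' c)
  exact (h1 (hk.tendsto_assocSemigroup c' c)).1 x

/-- The increment along `ε(c'_{[0,t[})`, `ε(c_{[0,t[})` is `exp(t⟪c',c⟫)` times that of the
semigroup, and this factor tends to `1`, so both quotients have the same limit. -/
theorem IsHolderCocycle.exists_increment_limit (hk : IsHolderCocycle kk D') (c' : D') (c : D) :
    ∃ ψ : V → V, ∀ x, Tendsto (fun t : ℝ => (t : ℂ)⁻¹ •
      increment hk.cocycle.slices t.toNNReal x (evE (indS c' t)) (evE (indS c t)))
        (𝓝[>] 0) (𝓝 (ψ x)) ∧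
      Tendsto (fun t : ℝ => (t : ℂ)⁻¹ •
      (assocSemigroup hk.cocycle.slices c' c t.toNNReal x - x)) (𝓝[>] 0) (𝓝 (ψ x)) := by
  have h1 := semigroup_of_finiteDimensional (W := V) (hk.cocycle.assocSemigroup_zero c' c)
    (hk.cocycle.assocSemigroup_add c' c)
  obtain ⟨ψ, hψ⟩ := (h1 (hk.tendsto_assocSemigroup c' c)).2
  refine ⟨ψ, fun x => ⟨?_, hψ x⟩⟩
  have hexp : Tendsto (fun t : ℝ => Complex.exp (t * ⟪(c' : k), (c : k)⟫_ℂ)) (𝓝[>] 0) (𝓝 1) := by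
    have : Continuous fun t : ℝ => Complex.exp (t * ⟪(c' : k), (c : k)⟫_ℂ) := by fun_prop
    simpa using (this.tendsto 0).mono_left nhdsWithin_le_nhds
  have h1 := hexp.smul (hψ x)
  rw [one_smul] at h1
  refine h1.congr' ?_
  filter_upwards [self_mem_nhdsWithin] with t ht
  have h2 := hk.cocycle.increment_ind c' c t.toNNReal x
  rw [Real.coe_toNNReal t (le_of_lt ht)] at h2
  rw [h2, smul_comm]

end Semigroups

/-! ### First-order behaviour of exponential vectors -/

section FirstOrder

variable {k : Type u} [NormedAddCommGroup k]

theorem ind_add (c d : k) (t : ℝ) : ind (c + d) t = ind c t + ind d t :=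
  Set.indicator_add _ _ _

variable [InnerProductSpace ℂ k] {D : Submodule ℂ k}

theorem snd_mem_of_mem_hatSub {ζ : KHat k} (hζ : ζ ∈ hatSub D) : ζ.snd ∈ D := by
  induction hζ using Submodule.span_induction with
  | mem x hx =>
    obtain ⟨c, hc, rfl⟩ := hx
    exact hc
  | zero => exact D.zero_mem
  | add x y _ _ hx hy => exact D.add_mem hx hy
  | smul c x _ hx => exact D.smul_mem c hx

/-- The `k`-component of an element of `D̂`. -/
def sndD (ζ : hatSub D) : D := ⟨(ζ : KHat k).snd, snd_mem_of_mem_hatSub ζ.2⟩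

/-- `ĉ` as an element of `D̂`. -/
def hatS (c : D) : hatSub D := ⟨hat (c : k), hat_mem c.2⟩

/-- The curve `(z - 1) ε(0) + ε(d_{[0,t[})` associated with `ζ = (z, d) ∈ D̂`. -/
def expCurve (t : ℝ) (ζ : hatSub D) : Exps D :=
  ((ζ : KHat k).fst - 1) • evE (indS 0 t) + evE (indS (sndD ζ) t)

/-- The linear part `z ε(0) + d_{[0,t[}` of the curve `expCurve`. -/
def linCurve (t : ℝ) (ζ : hatSub D) : NoiseFock k :=
  (ζ : KHat k).fst • ev (0 : ℝ → k) + oneParticle (L2 k) (toL2 (ind (ζ : KHat k).snd t))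

theorem ind_smul (a : ℂ) (c : k) (t : ℝ) : ind (a • c) t = a • ind c t :=
  Set.indicator_const_smul _ _ _

theorem toL2_ind_add (c d : k) (t : ℝ) : toL2 (ind (c + d) t) = toL2 (ind c t) + toL2 (ind d t) := by
  rw [ind_add, toL2_add (Step.memLp (ind_mem (D := ⊤) trivial t))
    (Step.memLp (ind_mem (D := ⊤) trivial t))]

theorem toL2_ind_smul (a : ℂ) (c : k) (t : ℝ) : toL2 (ind (a • c) t) = a • toL2 (ind c t) := by
  rw [ind_smul, toL2_smul (Step.memLp (ind_mem (D := ⊤) trivial t))]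

theorem linCurve_smul_add (t : ℝ) (a : ℂ) (ζ₁ ζ₂ : hatSub D) :
    linCurve t (a • ζ₁ + ζ₂) = a • linCurve t ζ₁ + linCurve t ζ₂ := by
  simp only [linCurve, Submodule.coe_add, Submodule.coe_smul, WithLp.add_fst, WithLp.smul_fst,
    WithLp.add_snd, WithLp.smul_snd, toL2_ind_add, toL2_ind_smul, map_add, map_smul, smul_eq_mul]
  module

theorem expCurve_sub_linCurve (t : ℝ) (ζ : hatSub D) :
    (expCurve t ζ : NoiseFock k) - linCurve t ζ =
      expVec (toL2 (ind (ζ : KHat k).snd t)) - expVec 0 -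
        oneParticle (L2 k) (toL2 (ind (ζ : KHat k).snd t)) := by
  have h1 : (evE (indS (0 : D) t) : NoiseFock k) = expVec 0 := by
    change expVec (toL2 (ind (0 : k) t)) = _
    rw [ind_zero, toL2_zero]
  have h2 : (evE (indS (sndD ζ) t) : NoiseFock k) = expVec (toL2 (ind (ζ : KHat k).snd t)) := rfl
  have h3 : ev (0 : ℝ → k) = expVec 0 := by rw [ev, toL2_zero]
  rw [expCurve, linCurve, Submodule.coe_add, Submodule.coe_smul, h1, h2, h3]
  module

theorem norm_expCurve_sub_linCurve_le {t : ℝ} (ht : 0 ≤ t) (ζ : hatSub D)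
    (hζ : √t * ‖(ζ : KHat k).snd‖ ≤ 1) :
    ‖(expCurve t ζ : NoiseFock k) - linCurve t ζ‖ ≤ t * ‖(ζ : KHat k).snd‖ ^ 2 := by
  rw [expCurve_sub_linCurve]
  have h1 := norm_toL2_ind (ζ : KHat k).snd ht
  refine (norm_expVec_sub_sub_oneParticle_le (h1.trans_le hζ)).trans_eq ?_
  rw [h1, mul_pow, Real.sq_sqrt ht]

theorem eventually_norm_expCurve_sub_linCurve_le (ζ : hatSub D) :
    ∀ᶠ t in 𝓝[>] (0 : ℝ),
      ‖(expCurve t ζ : NoiseFock k) - linCurve t ζ‖ ≤ t * ‖(ζ : KHat k).snd‖ ^ 2 := by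
  have h1 : Tendsto (fun t : ℝ => √t * ‖(ζ : KHat k).snd‖) (𝓝[>] 0) (𝓝 0) := by
    have : Continuous fun t : ℝ => √t * ‖(ζ : KHat k).snd‖ := by fun_prop
    simpa using (this.tendsto 0).mono_left nhdsWithin_le_nhds
  filter_upwards [h1.eventually_le_const zero_lt_one, self_mem_nhdsWithin] with t h2 h3
  exact norm_expCurve_sub_linCurve_le (le_of_lt h3) ζ h2

/-- `linCurve` is exactly linear in `ζ` and `expCurve` differs from it by `O(t)`. -/
theorem expCurve_smul_add_isBigO (a : ℂ) (ζ₁ ζ₂ : hatSub D) :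
    (fun t : ℝ => ((expCurve t (a • ζ₁ + ζ₂) - a • expCurve t ζ₁ - expCurve t ζ₂ : Exps D) :
      NoiseFock k)) =O[𝓝[>] 0] fun t => t := by
  have h1 (ζ : hatSub D) : (fun t : ℝ => (expCurve t ζ : NoiseFock k) - linCurve t ζ)
      =O[𝓝[>] 0] fun t => t := by
    refine IsBigO.of_bound (‖(ζ : KHat k).snd‖ ^ 2) ?_
    filter_upwards [eventually_norm_expCurve_sub_linCurve_le ζ, self_mem_nhdsWithin] with t ht h0
    rwa [Real.norm_of_nonneg (le_of_lt h0), mul_comm]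
  refine (((h1 (a • ζ₁ + ζ₂)).sub ((h1 ζ₁).const_smul_left a)).sub (h1 ζ₂)).congr_left fun t => ?_
  rw [linCurve_smul_add, Submodule.coe_sub, Submodule.coe_sub, Submodule.coe_smul]
  simp only [Pi.smul_apply]
  module

variable {W : Type*} [NormedAddCommGroup W] [NormedSpace ℂ W] {σ : ℂ →+* ℂ}

/-- The orders of magnitude are `t⁻¹ · √t · t = √t`. -/
theorem tendsto_smul_of_holder {b : ℝ → Exps D → W} {C : ℝ}
    (hb : ∀ᶠ t in 𝓝[>] (0 : ℝ), ∀ e, ‖b t e‖ ≤ C * √t * ‖(e : NoiseFock k)‖) {v : ℝ → Exps D}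
    (hv : (fun t => (v t : NoiseFock k)) =O[𝓝[>] 0] fun t => t) :
    Tendsto (fun t : ℝ => (t : ℂ)⁻¹ • b t (v t)) (𝓝[>] 0) (𝓝 0) := by
  obtain ⟨C', hC', hv⟩ := hv.exists_nonneg
  refine squeeze_zero_norm' (a := fun t : ℝ => |C| * √t * C') ?_ ?_
  · filter_upwards [hb, hv.bound, self_mem_nhdsWithin] with t h1 h2 (h3 : 0 < t)
    rw [norm_smul, norm_inv, Complex.norm_real, Real.norm_of_nonneg h3.le]
    rw [Real.norm_of_nonneg h3.le] at h2
    calc t⁻¹ * ‖b t (v t)‖ ≤ t⁻¹ * (|C| * √t * (C' * t)) := by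
          gcongr
          refine (h1 _).trans ?_
          gcongr
          exact le_abs_self C
      _ = |C| * √t * C' := by field_simp
  · have : Continuous fun t : ℝ => |C| * √t * C' := by fun_prop
    simpa using (this.tendsto 0).mono_left nhdsWithin_le_nhds

/-- The linearity defect of `expCurve` is invisible in the limit. The homomorphism `σ` is the
identity for the right argument of the increment and conjugation for the left one. -/
theorem limit_smul_add_of_holder {b : ℝ → Exps D → W} {C : ℝ}
    (hlin : ∀ t a e₁ e₂ e₃, b t (e₁ - a • e₂ - e₃) = b t e₁ - σ a • b t e₂ - b t e₃)
    (hb : ∀ᶠ t in 𝓝[>] (0 : ℝ), ∀ e, ‖b t e‖ ≤ C * √t * ‖(e : NoiseFock k)‖) {L : hatSub D → W}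
    (hL : ∀ ζ, Tendsto (fun t : ℝ => (t : ℂ)⁻¹ • b t (expCurve t ζ)) (𝓝[>] 0) (𝓝 (L ζ)))
    (a : ℂ) (ζ₁ ζ₂ : hatSub D) : L (a • ζ₁ + ζ₂) = σ a • L ζ₁ + L ζ₂ := by
  have h1 := tendsto_smul_of_holder hb (expCurve_smul_add_isBigO a ζ₁ ζ₂)
  have h2 := ((hL (a • ζ₁ + ζ₂)).sub ((hL ζ₁).const_smul (σ a))).sub (hL ζ₂)
  have h3 : L (a • ζ₁ + ζ₂) - σ a • L ζ₁ - L ζ₂ = 0 := by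
    refine tendsto_nhds_unique h2 (h1.congr fun t => ?_)
    rw [hlin, smul_sub, smul_sub, smul_comm (σ a)]
  rwa [sub_sub, sub_eq_zero] at h3

/-- The Hölder exponent `1/2` matches the growth `‖d_{[0,t[}‖ = √t ‖d‖` exactly: for `ζ = (0,d)` the
quotient stays below `|C| (‖d‖ + √t ‖d‖²)`. The remaining direction `(1,0)` is one-dimensional. -/
theorem limit_bounded_of_holder (hσ : ∀ z, ‖σ z‖ = ‖z‖) {b : ℝ → Exps D → W} {C : ℝ}
    (hlin : ∀ t a e₁ e₂ e₃, b t (e₁ - a • e₂ - e₃) = b t e₁ - σ a • b t e₂ - b t e₃)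
    (hb : ∀ᶠ t in 𝓝[>] (0 : ℝ), ∀ e, ‖b t e‖ ≤ C * √t * ‖(e : NoiseFock k)‖) {L : hatSub D → W}
    (hL : ∀ ζ, Tendsto (fun t : ℝ => (t : ℂ)⁻¹ • b t (expCurve t ζ)) (𝓝[>] 0) (𝓝 (L ζ))) :
    ∃ C' : ℝ, ∀ ζ, ‖L ζ‖ ≤ C' * ‖ζ‖ := by
  have h0 (ζ : hatSub D) (hζ : (ζ : KHat k).fst = 0) : ‖L ζ‖ ≤ |C| * ‖(ζ : KHat k).snd‖ := by
    set n := ‖(ζ : KHat k).snd‖ with hn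
    have hlim : Tendsto (fun t : ℝ => |C| * (n + √t * n ^ 2)) (𝓝[>] 0) (𝓝 (|C| * n)) := by
      have : Continuous fun t : ℝ => |C| * (n + √t * n ^ 2) := by fun_prop
      simpa using (this.tendsto 0).mono_left nhdsWithin_le_nhds
    refine le_of_tendsto_of_tendsto (hL ζ).norm hlim ?_
    filter_upwards [hb, eventually_norm_expCurve_sub_linCurve_le ζ, self_mem_nhdsWithin]
      with t h1 h2 (h3 : 0 < t)
    have h4 : ‖linCurve t ζ‖ = √t * n := by
      rw [linCurve, hζ, zero_smul, zero_add, norm_oneParticle, norm_toL2_ind _ h3.le]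
    have h5 : ‖(expCurve t ζ : NoiseFock k)‖ ≤ √t * n + t * n ^ 2 := by
      calc ‖(expCurve t ζ : NoiseFock k)‖
          = ‖linCurve t ζ + ((expCurve t ζ : NoiseFock k) - linCurve t ζ)‖ := by
            rw [add_sub_cancel]
        _ ≤ _ := norm_add_le_of_le h4.le h2
    rw [norm_smul, norm_inv, Complex.norm_real, Real.norm_of_nonneg h3.le]
    calc t⁻¹ * ‖b t (expCurve t ζ)‖ ≤ t⁻¹ * (|C| * √t * (√t * n + t * n ^ 2)) := by
          gcongr
          refine (h1 _).trans ?_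
          gcongr
          exact le_abs_self C
      _ = t⁻¹ * (√t * √t) * |C| * n + t⁻¹ * t * |C| * (√t * n ^ 2) := by ring
      _ = |C| * (n + √t * n ^ 2) := by
          rw [Real.mul_self_sqrt h3.le, inv_mul_cancel₀ h3.ne']
          ring
  refine ⟨‖L (hatS 0)‖ + |C|, fun ζ => ?_⟩
  -- Splitting of `ζ = (z,d)` as `z (1,0) + (0,d)`; linearity of `L` is already available.
  let ζ₁ : hatSub D := ζ - (ζ : KHat k).fst • hatS 0
  have h1 : ζ = (ζ : KHat k).fst • hatS 0 + ζ₁ := by simp [ζ₁]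
  have hfst : (ζ₁ : KHat k).fst = 0 := by simp [ζ₁, hatS, hat]
  have hsnd : (ζ₁ : KHat k).snd = (ζ : KHat k).snd := by simp [ζ₁, hatS, hat]
  have hn := WithLp.prod_norm_sq_eq_of_L2 (ζ : KHat k)
  have hn1 : ‖(ζ : KHat k).fst‖ ≤ ‖ζ‖ := by
    refine (sq_le_sq₀ (norm_nonneg _) (norm_nonneg _)).mp ?_
    rw [Submodule.coe_norm, hn]
    exact le_add_of_nonneg_right (by positivity)
  have hn2 : ‖(ζ : KHat k).snd‖ ≤ ‖ζ‖ := by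
    refine (sq_le_sq₀ (norm_nonneg _) (norm_nonneg _)).mp ?_
    rw [Submodule.coe_norm, hn]
    exact le_add_of_nonneg_left (by positivity)
  rw [h1, limit_smul_add_of_holder hlin hb hL, ← h1]
  refine (norm_add_le _ _).trans ?_
  rw [norm_smul, hσ, add_mul, mul_comm ‖L (hatS 0)‖]
  refine add_le_add (by gcongr) ((h0 ζ₁ hfst).trans ?_)
  rw [hsnd]
  gcongr

end FirstOrder

/-! ### The stochastic generator -/

section LimitForm

variable {k : Type u} [NormedAddCommGroup k] [InnerProductSpace ℂ k]
variable {h : Type v} [NormedAddCommGroup h] [InnerProductSpace ℂ h]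
variable {h' : Type w} [NormedAddCommGroup h'] [InnerProductSpace ℂ h'] [CompleteSpace h']
variable {V : Submodule ℂ (h →L[ℂ] h')} {D D' : Submodule ℂ k} {kk : OpFamily V D}

theorem beforeS_indS (c : D) {t : ℝ≥0} {T : ℝ} (hT : (t : ℝ) ≤ T) :
    beforeS t (indS c T) = indS c t := Subtype.ext (before_ind (c : k) hT)

theorem after_of_beforeS {t : ℝ≥0} {g : Step D} (hg : beforeS t g = g) :
    after t (g : ℝ → k) = 0 := by
  rw [← hg]
  exact after_before t _

/-- When `g` lives on `[0,t[`, its future is the vacuum, and `⟪ε(g'_{[t,∞[}), ε(0)⟫ = 1`: whatever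
`g'` does after `t` has no effect. -/
theorem IsCocycle.increment_beforeS_left (hc : IsCocycle kk D') {t : ℝ≥0} (x : V) (g' : Step D')
    {g : Step D} (hg : beforeS t g = g) :
    increment hc.slices t x (evE (beforeS t g')) (evE g) =
      increment hc.slices t x (evE g') (evE g) := by
  have h1 : ⟪ev (after t (g' : ℝ → k)), ev (after t (g : ℝ → k))⟫_ℂ = 1 := by
    rw [after_of_beforeS hg, inner_ev_zero_right]
  have h2 : ⟪ev (g' : ℝ → k), ev (g : ℝ → k)⟫_ℂ =
      ⟪ev (beforeS t g' : ℝ → k), ev (g : ℝ → k)⟫_ℂ := by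
    rw [← inner_ev_before_after g'.2 g.2 t, h1, mul_one]
    conv_rhs => rw [← hg]
    rfl
  rw [increment_apply, increment_apply, hc.sliceMap_adapted t g' g, h1, one_smul, hg, coe_evE,
    coe_evE, coe_evE, h2]

theorem IsCocycle.increment_beforeS_right (hc : IsCocycle kk D') {t : ℝ≥0} (x : V) {g' : Step D'}
    (g : Step D) (hg' : beforeS t g' = g') :
    increment hc.slices t x (evE g') (evE (beforeS t g)) =
      increment hc.slices t x (evE g') (evE g) := by
  have h1 : ⟪ev (after t (g' : ℝ → k)), ev (after t (g : ℝ → k))⟫_ℂ = 1 := by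
    rw [after_of_beforeS hg', inner_ev_zero_left]
  have h2 : ⟪ev (g' : ℝ → k), ev (g : ℝ → k)⟫_ℂ =
      ⟪ev (g' : ℝ → k), ev (beforeS t g : ℝ → k)⟫_ℂ := by
    rw [← inner_ev_before_after g'.2 g.2 t, h1, mul_one]
    conv_rhs => rw [← hg']
    rfl
  rw [increment_apply, increment_apply, hc.sliceMap_adapted t g' g, h1, one_smul, hg', coe_evE,
    coe_evE, coe_evE, h2]

/-- Freezes the left argument at a vector independent of `t`. The Hölder constant depends on that
argument, so without freezing it could not be used in the limit. -/
theorem IsCocycle.increment_expCurve_left (hc : IsCocycle kk D') {t : ℝ≥0} (ht : t ≤ 1) (x : V)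
    (ζ' : hatSub D') (ζ : hatSub D) :
    increment hc.slices t x (expCurve 1 ζ') (expCurve t ζ) =
      increment hc.slices t x (expCurve t ζ') (expCurve t ζ) := by
  have ht' : (t : ℝ) ≤ 1 := ht
  have h1 (c' : D') (c : D) : increment hc.slices t x (evE (indS c' 1)) (evE (indS c t)) =
      increment hc.slices t x (evE (indS c' t)) (evE (indS c t)) := by
    rw [← hc.increment_beforeS_left x (indS c' 1) (beforeS_indS c le_rfl), beforeS_indS c' ht']
  simp only [expCurve, map_add, LinearMap.map_smulₛₗ, LinearMap.add_apply, LinearMap.smul_apply, h1]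

theorem IsCocycle.increment_expCurve_right (hc : IsCocycle kk D') {t : ℝ≥0} (ht : t ≤ 1) (x : V)
    (ζ' : hatSub D') (ζ : hatSub D) :
    increment hc.slices t x (expCurve t ζ') (expCurve 1 ζ) =
      increment hc.slices t x (expCurve t ζ') (expCurve t ζ) := by
  have ht' : (t : ℝ) ≤ 1 := ht
  have h1 (c' : D') (c : D) : increment hc.slices t x (evE (indS c' t)) (evE (indS c 1)) =
      increment hc.slices t x (evE (indS c' t)) (evE (indS c t)) := by
    rw [← hc.increment_beforeS_right x (indS c 1) (beforeS_indS c' le_rfl), beforeS_indS c ht']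
  simp only [expCurve, map_add, LinearMap.map_smulₛₗ, LinearMap.add_apply, LinearMap.smul_apply, h1]

theorem expCurve_hatS (t : ℝ) (c : D) : expCurve t (hatS c) = evE (indS c t) := by
  have h1 : ((hatS c : hatSub D) : KHat k).fst = 1 := rfl
  have h2 : sndD (hatS c) = c := rfl
  rw [expCurve, h1, h2, sub_self, zero_smul, zero_add]

/-- `Φ` is the derivative at `0` of the increments of the cocycle along the curves `expCurve`. -/
def IsLimitForm (hs : SlicesInto kk D') (Φ : hatSub D' → hatSub D → V → V) : Prop :=
  ∀ ζ' ζ x, Tendsto (fun t : ℝ => (t : ℂ)⁻¹ •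
    increment hs t.toNNReal x (expCurve t ζ') (expCurve t ζ)) (𝓝[>] 0) (𝓝 (Φ ζ' ζ x))

/-- Each curve is a combination of two exponential vectors with coefficients independent of `t`, so
the increment expands into four increments along constants, each with a known limit. -/
theorem IsHolderCocycle.exists_limitForm [FiniteDimensional ℂ V] (hk : IsHolderCocycle kk D') :
    ∃ Φ, IsLimitForm hk.cocycle.slices Φ := by
  choose ψ hψ using fun c' c => hk.exists_increment_limit c' c
  have h1 (ζ' : hatSub D') (ζ : hatSub D) (x : V) : ∃ y, Tendsto (fun t : ℝ => (t : ℂ)⁻¹ •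
      increment hk.cocycle.slices t.toNNReal x (expCurve t ζ') (expCurve t ζ))
        (𝓝[>] 0) (𝓝 y) := by
    let z := (ζ : KHat k).fst - 1
    let z' := starRingEnd ℂ ((ζ' : KHat k).fst - 1)
    refine ⟨z' • z • ψ 0 0 x + z' • ψ 0 (sndD ζ) x + (z • ψ (sndD ζ') 0 x +
      ψ (sndD ζ') (sndD ζ) x), ?_⟩
    have h2 := (((((hψ 0 0 x).1).const_smul z).const_smul z').add
      (((hψ 0 (sndD ζ) x).1).const_smul z')).add
      ((((hψ (sndD ζ') 0 x).1).const_smul z).add (hψ (sndD ζ') (sndD ζ) x).1)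
    refine h2.congr fun t => ?_
    simp only [expCurve, map_add, LinearMap.map_smulₛₗ, LinearMap.add_apply, LinearMap.smul_apply,
      smul_add, RingHom.id_apply]
    rw [smul_comm z, smul_comm z', smul_comm z' (t : ℂ)⁻¹, smul_comm z, smul_comm z z']
    abel
  choose Φ hΦ using h1
  exact ⟨Φ, hΦ⟩

theorem IsHolderCocycle.tendsto_assocSemigroup_deriv [FiniteDimensional ℂ V]
    (hk : IsHolderCocycle kk D') {Φ : hatSub D' → hatSub D → V → V}
    (hΦ : IsLimitForm hk.cocycle.slices Φ) (c' : D') (c : D) (x : V) :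
    Tendsto (fun t : ℝ => (t : ℂ)⁻¹ • (assocSemigroup hk.cocycle.slices c' c t.toNNReal x - x))
      (𝓝[>] 0) (𝓝 (Φ (hatS c') (hatS c) x)) := by
  obtain ⟨ψ, hψ⟩ := hk.exists_increment_limit c' c
  have h1 := hΦ (hatS c') (hatS c) x
  simp only [expCurve_hatS] at h1
  rw [tendsto_nhds_unique h1 (hψ x).1]
  exact (hψ x).2

theorem IsLimitForm.map_smul_add {hs : SlicesInto kk D'} {Φ : hatSub D' → hatSub D → V → V}
    (hΦ : IsLimitForm hs Φ) (ζ' : hatSub D') (ζ : hatSub D) (a : ℂ) (x y : V) :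
    Φ ζ' ζ (a • x + y) = a • Φ ζ' ζ x + Φ ζ' ζ y := by
  have h1 := ((hΦ ζ' ζ x).const_smul a).add (hΦ ζ' ζ y)
  refine tendsto_nhds_unique (hΦ ζ' ζ (a • x + y)) (h1.congr fun t => ?_)
  simp only [increment_apply, map_add, map_smul]
  module

theorem eventually_toNNReal_lt {δ : ℝ≥0} (hδ : 0 < δ) :
    ∀ᶠ t in 𝓝[>] (0 : ℝ), t.toNNReal < δ := by
  filter_upwards [mem_nhdsWithin_of_mem_nhds (Iio_mem_nhds (NNReal.coe_pos.mpr hδ)),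
    self_mem_nhdsWithin] with t ht h0
  exact (Real.toNNReal_lt_iff_lt_coe (le_of_lt h0)).mpr ht

/-- With the left argument frozen at `expCurve 1 ζ'`, the columns of `k†` supply the Hölder bound in
the right argument. -/
theorem IsHolderCocycle.limitForm_right [CompleteSpace k] (hk : IsHolderCocycle kk D')
    (hD : Dense (D : Set k)) {Φ : hatSub D' → hatSub D → V → V}
    (hΦ : IsLimitForm hk.cocycle.slices Φ) (ζ' : hatSub D') (x : V) :
    (∀ (a : ℂ) (ζ₁ ζ₂ : hatSub D), Φ ζ' (a • ζ₁ + ζ₂) x = a • Φ ζ' ζ₁ x + Φ ζ' ζ₂ x) ∧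
      ∃ C : ℝ, ∀ ζ, ‖Φ ζ' ζ x‖ ≤ C * ‖ζ‖ := by
  obtain ⟨C, -, δ, hδ, hC⟩ := hk.exists_norm_increment_le_right hD x (expCurve 1 ζ')
  obtain ⟨b, hbdef⟩ : ∃ b : ℝ → Exps D → V, ∀ t e, b t e =
    increment hk.cocycle.slices t.toNNReal x (expCurve 1 ζ') e := ⟨_, fun _ _ => rfl⟩
  have hlin (t : ℝ) (a : ℂ) (e₁ e₂ e₃ : Exps D) :
      b t (e₁ - a • e₂ - e₃) = b t e₁ - RingHom.id ℂ a • b t e₂ - b t e₃ := by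
    simp only [hbdef, map_sub, map_smul, RingHom.id_apply]
  have hb : ∀ᶠ t in 𝓝[>] (0 : ℝ), ∀ e, ‖b t e‖ ≤ C * √t * ‖(e : NoiseFock k)‖ := by
    filter_upwards [eventually_toNNReal_lt hδ, self_mem_nhdsWithin] with t ht h0 e
    have h1 := hC _ ht e
    rw [Real.coe_toNNReal t (le_of_lt h0)] at h1
    rw [hbdef]
    exact h1
  have hL (ζ : hatSub D) :
      Tendsto (fun t : ℝ => (t : ℂ)⁻¹ • b t (expCurve t ζ)) (𝓝[>] 0) (𝓝 (Φ ζ' ζ x)) := by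
    have h3 : (fun t : ℝ => (t : ℂ)⁻¹ • increment hk.cocycle.slices t.toNNReal x
        (expCurve t ζ') (expCurve t ζ)) =ᶠ[𝓝[>] 0] fun t => (t : ℂ)⁻¹ • b t (expCurve t ζ) := by
      filter_upwards [self_mem_nhdsWithin,
        mem_nhdsWithin_of_mem_nhds (Iic_mem_nhds (zero_lt_one (α := ℝ)))] with t h0 h1
      have h2 := hk.cocycle.increment_expCurve_left (t := t.toNNReal)
        (Real.toNNReal_le_one.mpr h1) x ζ' ζ
      rw [Real.coe_toNNReal t (le_of_lt h0)] at h2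
      rw [hbdef, ← h2]
    exact Tendsto.congr' h3 (hΦ ζ' ζ x)
  have h1 := @limit_smul_add_of_holder k _ _ D V _ _ (RingHom.id ℂ) b C
  have h2 := h1 hlin
  have h3 := @h2 hb
  have h4 := @limit_bounded_of_holder k _ _ D V _ _ (RingHom.id ℂ) (fun _ => rfl) b C
  have h5 := h4 hlin
  have h6 := @h5 hb
  exact ⟨@h3 (fun ζ => Φ ζ' ζ x) hL, @h6 (fun ζ => Φ ζ' ζ x) hL⟩

/-- The same with the roles exchanged: the right argument is frozen, and the bound comes from the
columns of `k`. -/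
theorem IsHolderCocycle.limitForm_left (hk : IsHolderCocycle kk D')
    {Φ : hatSub D' → hatSub D → V → V}
    (hΦ : IsLimitForm hk.cocycle.slices Φ) (ζ : hatSub D) (x : V) :
    (∀ (a : ℂ) (ζ₁ ζ₂ : hatSub D'), Φ (a • ζ₁ + ζ₂) ζ x =
      starRingEnd ℂ a • Φ ζ₁ ζ x + Φ ζ₂ ζ x) ∧
      ∃ C : ℝ, ∀ ζ', ‖Φ ζ' ζ x‖ ≤ C * ‖ζ'‖ := by
  obtain ⟨C, -, δ, hδ, hC⟩ := hk.exists_norm_increment_le_left x (expCurve 1 ζ)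
  obtain ⟨b, hbdef⟩ : ∃ b : ℝ → Exps D' → V, ∀ t e, b t e =
    increment hk.cocycle.slices t.toNNReal x e (expCurve 1 ζ) := ⟨_, fun _ _ => rfl⟩
  have hlin (t : ℝ) (a : ℂ) (e₁ e₂ e₃ : Exps D') :
      b t (e₁ - a • e₂ - e₃) = b t e₁ - starRingEnd ℂ a • b t e₂ - b t e₃ := by
    simp only [hbdef, map_sub, LinearMap.map_smulₛₗ, LinearMap.sub_apply, LinearMap.smul_apply]
  have hb : ∀ᶠ t in 𝓝[>] (0 : ℝ), ∀ e, ‖b t e‖ ≤ C * √t * ‖(e : NoiseFock k)‖ := by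
    filter_upwards [eventually_toNNReal_lt hδ, self_mem_nhdsWithin] with t ht h0 e
    have h1 := hC _ ht e
    rw [Real.coe_toNNReal t (le_of_lt h0)] at h1
    rw [hbdef]
    exact h1
  have hL (ζ' : hatSub D') :
      Tendsto (fun t : ℝ => (t : ℂ)⁻¹ • b t (expCurve t ζ')) (𝓝[>] 0) (𝓝 (Φ ζ' ζ x)) := by
    have h3 : (fun t : ℝ => (t : ℂ)⁻¹ • increment hk.cocycle.slices t.toNNReal x
        (expCurve t ζ') (expCurve t ζ)) =ᶠ[𝓝[>] 0] fun t => (t : ℂ)⁻¹ • b t (expCurve t ζ') := by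
      filter_upwards [self_mem_nhdsWithin,
        mem_nhdsWithin_of_mem_nhds (Iic_mem_nhds (zero_lt_one (α := ℝ)))] with t h0 h1
      have h2 := hk.cocycle.increment_expCurve_right (t := t.toNNReal)
        (Real.toNNReal_le_one.mpr h1) x ζ' ζ
      rw [Real.coe_toNNReal t (le_of_lt h0)] at h2
      rw [hbdef, ← h2]
    exact Tendsto.congr' h3 (hΦ ζ' ζ x)
  have h1 := @limit_smul_add_of_holder k _ _ D' V _ _ (starRingEnd ℂ) b C
  have h2 := h1 hlin
  have h3 := @h2 hb
  have h4 := @limit_bounded_of_holder k _ _ D' V _ _ (starRingEnd ℂ)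
    (fun z => RCLike.norm_conj z) b C
  have h5 := h4 hlin
  have h6 := @h5 hb
  exact ⟨@h3 (fun ζ' => Φ ζ' ζ x) hL, @h6 (fun ζ' => Φ ζ' ζ x) hL⟩

end LimitForm

section Generator

theorem exists_bound_of_finiteDimensional {W : Type*} [NormedAddCommGroup W] [NormedSpace ℂ W]
    [FiniteDimensional ℂ W] (l : W →ₗ[ℂ] ℂ) : ∃ C : ℝ, 0 ≤ C ∧ ∀ y : W, ‖l y‖ ≤ C * ‖y‖ :=
  ⟨‖l.toContinuousLinearMap‖, norm_nonneg _, fun y => l.toContinuousLinearMap.le_opNorm y⟩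

/-- A sesquilinear form on dense domains that is separately bounded, and depends linearly on a
parameter, is represented by operators with adjoints. -/
theorem exists_opDagger {H K X : Type*} [NormedAddCommGroup H] [InnerProductSpace ℂ H]
    [CompleteSpace H] [NormedAddCommGroup K] [InnerProductSpace ℂ K] [CompleteSpace K]
    [AddCommGroup X] [Module ℂ X] {E : Submodule ℂ H} {E' : Submodule ℂ K}
    (hE' : Dense (E' : Set K)) (B : E' → E → X → ℂ)
    (hl : ∀ (e : E) (x : X) (a : ℂ) (e₁ e₂ : E'),
      B (a • e₁ + e₂) e x = starRingEnd ℂ a * B e₁ e x + B e₂ e x)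
    (hr : ∀ (e' : E') (x : X) (a : ℂ) (e₁ e₂ : E), B e' (a • e₁ + e₂) x = a * B e' e₁ x + B e' e₂ x)
    (hx : ∀ (e' : E') (e : E) (a : ℂ) (x y : X), B e' e (a • x + y) = a * B e' e x + B e' e y)
    (hlb : ∀ (e : E) (x : X), ∃ C : ℝ, ∀ e', ‖B e' e x‖ ≤ C * ‖e'‖)
    (hrb : ∀ (e' : E') (x : X), ∃ C : ℝ, ∀ e, ‖B e' e x‖ ≤ C * ‖e‖) :
    ∃ T : X →ₗ[ℂ] OpDagger E E', ∀ (e' : E') (e : E) (x : X),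
      ⟪(e' : K), (T x : Op E K) e⟫_ℂ = B e' e x := by
  have h1 (e : E) (x : X) : ∃ f : K, ∀ e' : E', ⟪(e' : K), f⟫_ℂ = B e' e x := by
    have h0 : B 0 e x = 0 := by simpa using hl e x 1 0 0
    let b : E' →ₗ⋆[ℂ] ℂ :=
      { toFun := fun e' => B e' e x
        map_add' := fun e₁ e₂ => by simpa using hl e x 1 e₁ e₂
        map_smul' := fun a e₁ => by simpa [h0] using hl e x a e₁ 0 }
    obtain ⟨C, hC⟩ := hlb e x
    exact exists_inner_eq_of_dense hE' b hC
  choose f hf using h1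
  have hext {y z : K} (hyz : ∀ e' : E', ⟪(e' : K), y⟫_ℂ = ⟪(e' : K), z⟫_ℂ) : y = z :=
    eq_of_inner_dense hE' fun e he => hyz ⟨e, he⟩
  have hfr (x : X) (a : ℂ) (e₁ e₂ : E) : f (a • e₁ + e₂) x = a • f e₁ x + f e₂ x :=
    hext fun e' => by rw [inner_add_right, inner_smul_right, hf, hf, hf, hr]
  have hfx (e : E) (a : ℂ) (x y : X) : f e (a • x + y) = a • f e x + f e y :=
    hext fun e' => by rw [inner_add_right, inner_smul_right, hf, hf, hf, hx]
  have hfr0 (x : X) : f 0 x = 0 := by simpa using hfr x (-1) 0 0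
  have hfx0 (e : E) : f e 0 = 0 := by simpa using hfx e (-1) 0 0
  let T (x : X) : Op E K :=
    { toFun := fun e => f e x
      map_add' := fun e₁ e₂ => by simpa using hfr x 1 e₁ e₂
      map_smul' := fun a e => by simpa [hfr0] using hfr x a e 0 }
  -- Boundedness in the left argument has produced the values `T x e`; boundedness in the right
  -- argument says precisely that `E'` lies in the domain of the adjoint.
  have hT (x : X) : T x ∈ OpDagger E E' := by
    intro y hy
    change Continuous fun e : E => ⟪y, T x e⟫_ℂ
    obtain ⟨C, hC⟩ := hrb ⟨y, hy⟩ x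
    have := (((innerSL ℂ y).toLinearMap ∘ₗ T x).mkContinuous C fun e => by
      have h2 : ⟪y, f e x⟫_ℂ = B ⟨y, hy⟩ e x := hf e x ⟨y, hy⟩
      have h3 := hC e
      rw [← h2] at h3
      exact h3).continuous
    exact this
  refine ⟨{ toFun := fun x => ⟨T x, hT x⟩, map_add' := fun x y => ?_, map_smul' := fun a x => ?_ },
    fun e' e x => hf e x e'⟩
  · refine Subtype.ext (LinearMap.ext fun e => ?_)
    have h2 : f e (x + y) = f e x + f e y := by simpa using hfx e 1 x y
    exact h2
  · refine Subtype.ext (LinearMap.ext fun e => ?_)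
    have h2 : f e (a • x) = a • f e x := by simpa [hfx0] using hfx e a x 0
    exact h2

variable {k : Type u} [NormedAddCommGroup k] [InnerProductSpace ℂ k] {D D' : Submodule ℂ k}

/-- Every pair `(z,d)` with `d ∈ D` equals `(z - 1) 0̂ + d̂`, so `D̂` contains the dense set `ℂ ×
D`. -/
theorem dense_hatSub (hD : Dense (D : Set k)) : Dense (hatSub D : Set (KHat k)) := by
  have h1 : DenseRange fun p : ℂ × D => (WithLp.toLp 2 (p.1, (p.2 : k)) : KHat k) := by
    have h2 : DenseRange fun p : ℂ × D => (p.1, (p.2 : k)) :=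
      denseRange_id.prodMap (by simpa [DenseRange] using hD)
    exact (WithLp.toLp_surjective 2).denseRange.comp h2 (WithLp.prod_continuous_toLp 2 ℂ k)
  refine h1.mono ?_
  rintro _ ⟨⟨z, d⟩, rfl⟩
  have h3 : (WithLp.toLp 2 (z, (d : k)) : KHat k) = (z - 1) • hat 0 + hat (d : k) := by
    refine (WithLp.ofLp_injective 2) (Prod.ext ?_ ?_) <;> simp [hat]
  change WithLp.toLp 2 (z, (d : k)) ∈ hatSub D
  rw [h3]
  exact Submodule.add_mem _ (Submodule.smul_mem _ _ (hat_mem D.zero_mem)) (hat_mem d.2)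

variable {h : Type v} [NormedAddCommGroup h] [InnerProductSpace ℂ h]
variable {h' : Type w} [NormedAddCommGroup h'] [InnerProductSpace ℂ h']
variable {V : Submodule ℂ (h →L[ℂ] h')} [CompleteSpace k]

/-- The map `x ↦ ∑ⱼ bⱼ ⊗ Tⱼ(x)`. -/
def sumTensor {ι : Type*} [Fintype ι] (b : ι → V)
    (T : ι → V →ₗ[ℂ] OpDagger (hatSub D) (hatSub D')) :
    V →ₗ[ℂ] V ⊗[ℂ] OpDagger (hatSub D) (hatSub D') :=
  ∑ j, TensorProduct.mk ℂ V (OpDagger (hatSub D) (hatSub D')) (b j) ∘ₗ T j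

theorem component_sumTensor {ι : Type*} [Fintype ι] (b : ι → V)
    (T : ι → V →ₗ[ℂ] OpDagger (hatSub D) (hatSub D')) (ζ' : KHat k) (ζ : hatSub D) (x : V) :
    component (sumTensor b T) ζ' ζ x =
      ∑ j, ⟪ζ', (T j x : Op (hatSub D) (KHat k)) ζ⟫_ℂ • b j := by
  have h1 : sumTensor b T x = ∑ j, b j ⊗ₜ[ℂ] T j x := by
    simp only [sumTensor, LinearMap.sum_apply, LinearMap.comp_apply, TensorProduct.mk_apply]
  change (TensorProduct.rid ℂ V).toLinearMap (LinearMap.lTensor V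
    (omega ζ' ζ ∘ₗ (OpDagger (hatSub D) (hatSub D')).subtype) (sumTensor b T x)) = _
  rw [h1, map_sum, map_sum]
  exact Finset.sum_congr rfl fun j _ => TensorProduct.rid_tmul _ _

/-- The coordinates of the limit form in the basis `b` are scalar sesquilinear forms; each is
represented by an operator `T j x`, and summing against `b j` recovers the form. -/
theorem IsHolderCocycle.exists_generator [CompleteSpace h'] [FiniteDimensional ℂ V]
    {kk : OpFamily V D} (hk : IsHolderCocycle kk D') (hD : Dense (D : Set k))
    (hD' : Dense (D' : Set k)) {ι : Type*} [Fintype ι] (b : Module.Basis ι ℂ V) :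
    ∃ T : ι → V →ₗ[ℂ] OpDagger (hatSub D) (hatSub D'), ∀ (c' : D') (c : D) (x : V),
      Tendsto (fun t : ℝ => (t : ℂ)⁻¹ • (assocSemigroup hk.cocycle.slices c' c t.toNNReal x - x))
        (𝓝[>] 0) (𝓝 (component (sumTensor b T) (hat (c' : k)) (hatS c) x)) := by
  obtain ⟨Φ, hΦ⟩ := hk.exists_limitForm
  have hcoord (j : ι) : ∃ C : ℝ, 0 ≤ C ∧ ∀ y : V, ‖b.coord j y‖ ≤ C * ‖y‖ :=
    exists_bound_of_finiteDimensional (W := V) (b.coord j)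
  have h1 (j : ι) := exists_opDagger (E := hatSub D) (E' := hatSub D') (X := V) (dense_hatSub hD')
    (fun ζ' ζ x => b.coord j (Φ ζ' ζ x))
    (fun ζ x a ζ₁ ζ₂ => by rw [(hk.limitForm_left hΦ ζ x).1, map_add, map_smul, smul_eq_mul])
    (fun ζ' x a ζ₁ ζ₂ => by rw [(hk.limitForm_right hD hΦ ζ' x).1, map_add, map_smul, smul_eq_mul])
    (fun ζ' ζ a x y => by rw [hΦ.map_smul_add, map_add, map_smul, smul_eq_mul])
    (fun ζ x => by
      obtain ⟨C, hC⟩ := (hk.limitForm_left hΦ ζ x).2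
      obtain ⟨C', hC0, hC'⟩ := hcoord j
      refine ⟨C' * C, fun ζ' => (hC' _).trans ?_⟩
      rw [mul_assoc]
      gcongr
      exact hC ζ')
    (fun ζ' x => by
      obtain ⟨C, hC⟩ := (hk.limitForm_right hD hΦ ζ' x).2
      obtain ⟨C', hC0, hC'⟩ := hcoord j
      refine ⟨C' * C, fun ζ => (hC' _).trans ?_⟩
      rw [mul_assoc]
      gcongr
      exact hC ζ)
  choose T hT using h1
  refine ⟨T, fun c' c x => ?_⟩
  have h2 : component (sumTensor b T) (hat (c' : k)) (hatS c) x = Φ (hatS c') (hatS c) x := by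
    rw [component_sumTensor, ← b.sum_repr (Φ (hatS c') (hatS c) x)]
    exact Finset.sum_congr rfl fun j _ => congrArg (· • b j) (hT j (hatS c') (hatS c) x)
  rw [h2]
  exact hk.tendsto_assocSemigroup_deriv hΦ c' c x

end Generator

/-! ### Coefficients of the columns of a cocycle -/

section Norms

variable {k : Type u} [NormedAddCommGroup k] [InnerProductSpace ℂ k]

theorem norm_ev_shift_le {D : Submodule ℂ k} {g : ℝ → k} (hg : g ∈ Step D) (t : ℝ≥0) :
    ‖ev (shift t g)‖ ≤ ‖ev g‖ := by
  refine (sq_le_sq₀ (norm_nonneg _) (norm_nonneg _)).mp ?_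
  rw [ev, ev, norm_expVec_sq, norm_expVec_sq]
  gcongr
  exact norm_toL2_shift_le hg t

theorem norm_ev_zero : ‖ev (0 : ℝ → k)‖ = 1 := by
  have h1 : ‖ev (0 : ℝ → k)‖ ^ 2 = 1 := by rw [ev, norm_expVec_sq, toL2_zero]; simp
  simpa using (pow_eq_one_iff_of_nonneg (norm_nonneg _) two_ne_zero).mp h1

theorem exists_norm_coord_le {h : Type v} [NormedAddCommGroup h] [InnerProductSpace ℂ h]
    {h' : Type w} [NormedAddCommGroup h'] [InnerProductSpace ℂ h'] {V : Submodule ℂ (h →L[ℂ] h')}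
    [FiniteDimensional ℂ V] {ι : Type*} (b : Module.Basis ι ℂ V) (j : ι) :
    ∃ C : ℝ, 0 ≤ C ∧ ∀ y : V, ‖b.coord j y‖ ≤ C * ‖y‖ :=
  exists_bound_of_finiteDimensional (W := V) (b.coord j)

end Norms

/-! ### Separation of points by exponential vectors, and joining of past and future -/

section Joining

variable {k : Type u} [NormedAddCommGroup k] [InnerProductSpace ℂ k] [CompleteSpace k]
variable {H : Type*} [NormedAddCommGroup H] [InnerProductSpace ℂ H] {D : Submodule ℂ k}

theorem eq_of_inner_ev (hD : Dense (D : Set k)) {y z : NoiseFock k}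
    (hyz : ∀ g : Step D, ⟪ev (g : ℝ → k), y⟫_ℂ = ⟪ev (g : ℝ → k), z⟫_ℂ) : y = z := by
  refine eq_of_inner_dense (dense_exps hD) fun e he => ?_
  induction he using Submodule.span_induction with
  | mem e he =>
    obtain ⟨g, hg, rfl⟩ := he
    exact hyz ⟨g, hg⟩
  | zero => simp only [inner_zero_left]
  | add e₁ e₂ _ _ h1 h2 => simp only [inner_add_left, h1, h2]
  | smul c e _ h1 => simp only [inner_smul_left, h1]

theorem eq_of_inner_tmulH_exps (hD : Dense (D : Set k)) {y z : HTensor H (NoiseFock k)}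
    (hyz : ∀ (a : H) (e : Exps D),
      ⟪tmulH a (e : NoiseFock k), y⟫_ℂ = ⟪tmulH a (e : NoiseFock k), z⟫_ℂ) : y = z := by
  refine eq_of_inner_dense (dense_expDomain_top H hD) fun ξ hξ => ?_
  induction hξ using Submodule.span_induction with
  | mem ξ hξ =>
    obtain ⟨a, -, e, he, rfl⟩ := hξ
    exact hyz a ⟨e, he⟩
  | zero => simp only [inner_zero_left]
  | add e₁ e₂ _ _ h1 h2 => simp only [inner_add_left, h1, h2]
  | smul c e _ h1 => simp only [inner_smul_left, h1]

/-- The adjoint of the splitting isometry of Fock space at time `r`. -/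
theorem exists_fock_joining (r : ℝ≥0) :
    ∃ J : HTensor (NoiseFock k) (NoiseFock k) →L[ℂ] NoiseFock k,
      (∀ ξ, ‖J ξ‖ ≤ ‖ξ‖) ∧ ∀ g ∈ Step (⊤ : Submodule ℂ k), ∀ y z,
        ⟪ev g, J (tmulH y z)⟫_ℂ = ⟪ev (before r g), y⟫_ℂ * ⟪ev (shift r g), z⟫_ℂ := by
  obtain ⟨L, hL⟩ := exists_fock_splitting (k := k) r
  refine ⟨L.toContinuousLinearMap.adjoint, fun ξ => ?_, fun g hg y z => ?_⟩
  · refine (ContinuousLinearMap.le_opNorm _ _).trans ?_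
    rw [LinearIsometryEquiv.norm_map]
    exact mul_le_of_le_one_left (norm_nonneg _) L.norm_toContinuousLinearMap_le
  · rw [ContinuousLinearMap.adjoint_inner_right]
    exact (congrArg (⟪·, tmulH y z⟫_ℂ) (hL g hg)).trans (inner_tmulH _ _ _ _)

end Joining

section Coefficients

variable {k : Type u} [NormedAddCommGroup k] [InnerProductSpace ℂ k]
variable {h : Type v} [NormedAddCommGroup h] [InnerProductSpace ℂ h]
variable {h' : Type w} [NormedAddCommGroup h'] [InnerProductSpace ℂ h'] [CompleteSpace h']
variable {V : Submodule ℂ (h →L[ℂ] h')} {D D' : Submodule ℂ k} {kk : OpFamily V D}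
variable {ι : Type*}

/-- The vectors `m` are the coefficients of the columns of `k` with respect to the basis `b`:
`⟪e', m_t^j(x, e)⟫ = b_j^*(ω_{e',e} • k_t(x))`. -/
def IsCoefficient (hs : SlicesInto kk D') (b : Module.Basis ι ℂ V)
    (m : ℝ≥0 → ι → V → Exps D → NoiseFock k) : Prop :=
  ∀ t j x e (e' : Exps D'), ⟪(e' : NoiseFock k), m t j x e⟫_ℂ = b.coord j (sliceMap hs t e' e x)

theorem sliceMap_add_left (hs : SlicesInto kk D') (t : ℝ≥0) (e₁ e₂ : Exps D') (e : Exps D)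
    (x : V) : sliceMap hs t (e₁ + e₂) e x = sliceMap hs t e₁ e x + sliceMap hs t e₂ e x := by
  simp only [sliceMap_eq, map_add, LinearMap.add_apply, Submodule.coe_add, inner_add_left, add_smul]
  abel

theorem sliceMap_smul_left (hs : SlicesInto kk D') (t : ℝ≥0) (c : ℂ) (e' : Exps D') (e : Exps D)
    (x : V) : sliceMap hs t (c • e') e x = starRingEnd ℂ c • sliceMap hs t e' e x := by
  simp only [sliceMap_eq, LinearMap.map_smulₛₗ, LinearMap.smul_apply, Submodule.coe_smul,
    inner_smul_left, smul_add, smul_smul]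

variable [CompleteSpace k]

/-- A coordinate of the slice is conjugate-linear in `e'` and bounded because the column at `e` is
bounded; Riesz representation on the dense space `Exps D'` gives the vector. -/
theorem IsHolderCocycle.exists_coefficient [FiniteDimensional ℂ V] (hk : IsHolderCocycle kk D')
    (hD' : Dense (D' : Set k)) (b : Module.Basis ι ℂ V) :
    ∃ m, IsCoefficient hk.cocycle.slices b m := by
  have h1 (t : ℝ≥0) (j : ι) (x : V) (e : Exps D) : ∃ f : NoiseFock k, ∀ e' : Exps D',
      ⟪(e' : NoiseFock k), f⟫_ℂ = b.coord j (sliceMap hk.cocycle.slices t e' e x) := by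
    obtain ⟨C, hC0, hC⟩ := hk.exists_norm_sliceMap_le t x e
    obtain ⟨C', hC0', hC'⟩ := exists_norm_coord_le b j
    refine exists_inner_eq_of_dense (C := C' * C) (dense_exps hD')
      { toFun := fun e' => b.coord j (sliceMap hk.cocycle.slices t e' e x)
        map_add' := fun e₁ e₂ => by rw [sliceMap_add_left, map_add]
        map_smul' := fun c e' => by rw [sliceMap_smul_left, map_smul] } fun e' => ?_
    refine (hC' _).trans ?_
    rw [mul_assoc]
    gcongr
    exact hC e'
  choose m hm using h1
  exact ⟨m, hm⟩

variable {b : Module.Basis ι ℂ V} {m : ℝ≥0 → ι → V → Exps D → NoiseFock k}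

theorem IsCoefficient.column_eq [Fintype ι] {hs : SlicesInto kk D'} (hm : IsCoefficient hs b m)
    (hD' : Dense (D' : Set k)) (t : ℝ≥0) (x : V) (e : Exps D) (a : h) :
    column (kk t x) e a = ∑ j, tmulH ((b j : h →L[ℂ] h') a) (m t j x e) := by
  refine eq_of_inner_tmulH_exps hD' fun a' e' => ?_
  rw [← inner_sliceMap hs, inner_sum]
  conv_lhs => rw [← b.sum_repr (sliceMap hs t e' e x)]
  rw [Submodule.coe_sum, _root_.sum_apply, inner_sum]
  refine Finset.sum_congr rfl fun j _ => ?_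
  rw [inner_tmulH, hm, Submodule.coe_smul, _root_.smul_apply, inner_smul_right, mul_comm]
  rfl

/-- Once the column is `∑ b_j a ⊗ m_j`, slicing it against any Fock vector yields a combination of
the `b_j`. -/
theorem IsCoefficient.slicesInto_top [Fintype ι] {hs : SlicesInto kk D'} (hm : IsCoefficient hs b m)
    (hD' : Dense (D' : Set k)) : SlicesInto kk (⊤ : Submodule ℂ k) := by
  intro t x e' e
  refine ⟨∑ j, ⟪(e' : NoiseFock k), m t j x e⟫_ℂ • b j, LinearMap.ext fun a => ?_⟩
  refine ext_inner_left ℂ fun a' => ?_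
  change ⟪a', ((∑ j, ⟪(e' : NoiseFock k), m t j x e⟫_ℂ • b j : V) : h →L[ℂ] h') a⟫_ℂ =
    ⟪a', bra (e' : NoiseFock k) (column (kk t x) e a)⟫_ℂ
  rw [inner_bra, hm.column_eq hD', inner_sum, Submodule.coe_sum, _root_.sum_apply,
    inner_sum]
  refine Finset.sum_congr rfl fun j _ => ?_
  rw [inner_tmulH, Submodule.coe_smul, _root_.smul_apply, inner_smul_right, mul_comm]

/-- Convergence is in norm, because the Hölder estimate is uniform over the test vector `e'`. -/
theorem IsHolderCocycle.tendsto_coefficient_zero [FiniteDimensional ℂ V]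
    (hk : IsHolderCocycle kk D') (hm : IsCoefficient hk.cocycle.slices b m)
    (hD' : Dense (D' : Set k)) (j : ι) (x : V) (e : Exps D) :
    Tendsto (fun s => m s j x e) (𝓝 0) (𝓝 (m 0 j x e)) := by
  obtain ⟨C, hC0, δ, hδ, hC⟩ := hk.exists_norm_increment_le_left x e
  obtain ⟨C', hC0', hC'⟩ := exists_norm_coord_le b j
  have h1 : ∀ᶠ s : ℝ≥0 in 𝓝 0, ‖m s j x e - m 0 j x e‖ ≤ C' * (C * √s) := by
    filter_upwards [Iio_mem_nhds hδ] with s hs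
    refine norm_le_of_inner_dense (dense_exps hD') (by positivity) fun e' he' => ?_
    have h2 : ⟪e', m s j x e - m 0 j x e⟫_ℂ =
        b.coord j (increment hk.cocycle.slices s x ⟨e', he'⟩ e) := by
      rw [inner_sub_right, increment_apply, ← hk.cocycle.sliceMap_zero, map_sub]
      exact congrArg₂ _ (hm s j x e ⟨e', he'⟩) (hm 0 j x e ⟨e', he'⟩)
    rw [h2, mul_assoc]
    refine (hC' _).trans ?_
    gcongr
    exact hC s hs ⟨e', he'⟩
  refine tendsto_iff_norm_sub_tendsto_zero.mpr (squeeze_zero' (.of_forall fun _ => norm_nonneg _)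
    h1 ?_)
  have : Continuous fun s : ℝ≥0 => C' * (C * √s) := by fun_prop
  simpa using this.tendsto 0

/-- Adaptedness in vector form: the part of the coefficient after time `r` is the exponential vector
of the future of `g`. -/
theorem IsCocycle.coefficient_adapted (hc : IsCocycle kk D')
    (hm : IsCoefficient hc.slices b m) (hD' : Dense (D' : Set k)) {r : ℝ≥0}
    {J : HTensor (NoiseFock k) (NoiseFock k) →L[ℂ] NoiseFock k}
    (hJ : ∀ g ∈ Step (⊤ : Submodule ℂ k), ∀ y z,
        ⟪ev g, J (tmulH y z)⟫_ℂ = ⟪ev (before r g), y⟫_ℂ * ⟪ev (shift r g), z⟫_ℂ)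
    (j : ι) (x : V) (g : Step D) :
    m r j x (evE g) = J (tmulH (m r j x (evE (beforeS r g))) (ev (shift r (g : ℝ → k)))) := by
  refine eq_of_inner_ev hD' fun g' => ?_
  rw [hJ _ (Step.mono le_top g'.2), inner_ev_shift g'.2 g.2]
  refine (hm r j x (evE g) (evE g')).trans ?_
  rw [hc.sliceMap_adapted, map_smul, smul_eq_mul, mul_comm]
  exact congrArg (· * _) (hm r j x (evE (beforeS r g)) (evE (beforeS r g'))).symm

/-- The converse passage: on joining the coefficient with the vacuum, only its past component is
tested, which discards the future of `g`. -/
theorem IsCocycle.coefficient_before (hc : IsCocycle kk D')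
    (hm : IsCoefficient hc.slices b m) (hD' : Dense (D' : Set k)) {r : ℝ≥0}
    {J : HTensor (NoiseFock k) (NoiseFock k) →L[ℂ] NoiseFock k}
    (hJ : ∀ g ∈ Step (⊤ : Submodule ℂ k), ∀ y z,
        ⟪ev g, J (tmulH y z)⟫_ℂ = ⟪ev (before r g), y⟫_ℂ * ⟪ev (shift r g), z⟫_ℂ)
    (j : ι) (x : V) (g : Step D) :
    m r j x (evE (beforeS r g)) = J (tmulH (m r j x (evE g)) (ev (0 : ℝ → k))) := by
  refine eq_of_inner_ev hD' fun g' => ?_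
  rw [hJ _ (Step.mono le_top g'.2), inner_ev_zero_right, mul_one]
  refine (hm r j x (evE (beforeS r g)) (evE g')).trans
    (Eq.trans ?_ (hm r j x (evE g) (evE (beforeS r g'))).symm)
  have h1 : beforeS r (beforeS r g) = beforeS r g :=
    Subtype.ext (by simp [beforeS, before_before])
  have h1' : beforeS r (beforeS r g') = beforeS r g' :=
    Subtype.ext (by simp [beforeS, before_before])
  rw [hc.sliceMap_adapted r g', hc.sliceMap_adapted r (beforeS r g') g, h1, h1']
  congr 2
  have h2 : after r ((beforeS r g : Step D) : ℝ → k) = 0 := after_before r _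
  have h2' : after r ((beforeS r g' : Step D') : ℝ → k) = 0 := after_before r _
  rw [h2, h2', inner_ev_zero_left, inner_ev_zero_right]

/-- The cocycle law in vector form: the slice over the later interval is expanded in the basis, and
each basis element is evolved over `[0,r[`. -/
theorem IsCocycle.coefficient_add [Fintype ι] (hc : IsCocycle kk D')
    (hm : IsCoefficient hc.slices b m) (hD' : Dense (D' : Set k)) {r : ℝ≥0}
    {J : HTensor (NoiseFock k) (NoiseFock k) →L[ℂ] NoiseFock k}
    (hJ : ∀ g ∈ Step (⊤ : Submodule ℂ k), ∀ y z,
        ⟪ev g, J (tmulH y z)⟫_ℂ = ⟪ev (before r g), y⟫_ℂ * ⟪ev (shift r g), z⟫_ℂ)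
    (t : ℝ≥0) (j : ι) (x : V) (g : Step D) :
    m (r + t) j x (evE g) =
      ∑ l, J (tmulH (m r j (b l) (evE (beforeS r g))) (m t l x (evE (shiftS r g)))) := by
  refine eq_of_inner_ev hD' fun g' => ?_
  refine (hm (r + t) j x (evE g) (evE g')).trans ?_
  rw [hc.sliceMap_add, ← b.sum_repr (sliceMap hc.slices t (evE (shiftS r g')) (evE (shiftS r g)) x),
    map_sum, map_sum, inner_sum]
  refine Finset.sum_congr rfl fun l _ => ?_
  rw [hJ _ (Step.mono le_top g'.2), map_smul, map_smul, smul_eq_mul, mul_comm]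
  exact congrArg₂ _ (hm r j (b l) (evE (beforeS r g)) (evE (beforeS r g'))).symm
    (hm t l x (evE (shiftS r g)) (evE (shiftS r g'))).symm

/-- If `f` and `f₁` agree on `[0,t[`, then the coefficients at time `t` for `f` are dominated by
those for `f₁`. -/
theorem IsCocycle.norm_coefficient_le (hc : IsCocycle kk D') (hm : IsCoefficient hc.slices b m)
    (hD' : Dense (D' : Set k)) {t : ℝ≥0} {f f₁ : Step D} (hf : beforeS t f = beforeS t f₁)
    (j : ι) (x : V) : ‖m t j x (evE f)‖ ≤ ‖m t j x (evE f₁)‖ * ‖ev (f : ℝ → k)‖ := by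
  obtain ⟨J, hJ1, hJ⟩ := exists_fock_joining (k := k) t
  rw [hc.coefficient_adapted hm hD' hJ, hf, hc.coefficient_before hm hD' hJ]
  refine (hJ1 _).trans ?_
  rw [norm_tmulH]
  gcongr
  · refine (hJ1 _).trans ?_
    rw [norm_tmulH, norm_ev_zero, mul_one]
  · exact norm_ev_shift_le f.2 t

/-- Factorising at `r` reduces right-continuity there to continuity at `0` for the shifted function.
For the left side, the factorisation point is fixed slightly before `r`, where `g` is already
constant; the second factor then involves one constant function and small times only, and is
bounded. -/
theorem IsHolderCocycle.rightRegular_coefficient [FiniteDimensional ℂ V] [Fintype ι]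
    (hk : IsHolderCocycle kk D') (hm : IsCoefficient hk.cocycle.slices b m)
    (hD' : Dense (D' : Set k)) (j : ι) (x : V) (g : Step D) :
    RightRegular fun s : ℝ => m s.toNNReal j x (evE g) := by
  have hright (r : ℝ) :
      Tendsto (fun s : ℝ => m s.toNNReal j x (evE g)) (𝓝[≥] r) (𝓝 (m r.toNNReal j x (evE g))) := by
    rcases lt_or_ge r 0 with hr | hr
    · refine tendsto_const_nhds.congr' ?_
      filter_upwards [mem_nhdsWithin_of_mem_nhds (Iio_mem_nhds hr)] with s (hs : s < 0)
      rw [Real.toNNReal_of_nonpos hs.le, Real.toNNReal_of_nonpos hr.le]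
    obtain ⟨J, hJ1, hJ⟩ := exists_fock_joining (k := k) r.toNNReal
    have h0 : Tendsto (fun s : ℝ => (s - r).toNNReal) (𝓝[≥] r) (𝓝 0) := by
      have : Continuous fun s : ℝ => (s - r).toNNReal := by fun_prop
      simpa using (this.tendsto r).mono_left nhdsWithin_le_nhds
    have h1 (l : ι) : Tendsto (fun s : ℝ => J (tmulH
        (m r.toNNReal j (b l) (evE (beforeS r.toNNReal g)))
        (m (s - r).toNNReal l x (evE (shiftS r.toNNReal g))))) (𝓝[≥] r)
        (𝓝 (J (tmulH (m r.toNNReal j (b l) (evE (beforeS r.toNNReal g)))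
          (m 0 l x (evE (shiftS r.toNNReal g)))))) :=
      ((J ∘L tmulL _ _ (m r.toNNReal j (b l) (evE (beforeS r.toNNReal g)))).continuous.tendsto
        _).comp ((hk.tendsto_coefficient_zero hm hD' l x (evE (shiftS r.toNNReal g))).comp h0)
    have h2 := tendsto_finsetSum Finset.univ fun l _ => h1 l
    rw [← hk.cocycle.coefficient_add hm hD' hJ, add_zero] at h2
    refine h2.congr' ?_
    filter_upwards [self_mem_nhdsWithin] with s (hs : r ≤ s)
    rw [← hk.cocycle.coefficient_add hm hD' hJ, ← Real.toNNReal_add hr (sub_nonneg.mpr hs),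
      add_sub_cancel]
  refine ⟨hright, fun r => ?_⟩
  suffices h : ∃ C : ℝ, ∀ᶠ s in 𝓝[<] r, ‖m s.toNNReal j x (evE g)‖ ≤ C by
    obtain ⟨C, hC⟩ := h
    have h1 := (hright r).norm.eventually_le_const
      (lt_add_one ‖m r.toNNReal j x (evE g)‖)
    refine ⟨max C (‖m r.toNNReal j x (evE g)‖ + 1), ?_⟩
    rw [← nhdsLT_sup_nhdsGE r, eventually_sup]
    exact ⟨hC.mono fun s hs => hs.trans (le_max_left _ _),
      h1.mono fun s hs => hs.trans (le_max_right _ _)⟩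
  rcases le_or_gt r 0 with hr | hr
  · refine ⟨‖m 0 j x (evE g)‖, ?_⟩
    filter_upwards [self_mem_nhdsWithin] with s (hs : s < r)
    rw [Real.toNNReal_of_nonpos (hs.le.trans hr)]
  obtain ⟨c, hc⟩ := (Step.piecewiseConst g.2).left r
  have hcD : c ∈ D := by
    obtain ⟨s, hs⟩ := hc.exists
    exact hs ▸ Step.apply_mem g.2 s
  obtain ⟨r₀, hr₀, hcr₀⟩ := (mem_nhdsLT_iff_exists_Ioo_subset' hr).mp hc
  have h1 : ∀ᶠ s : ℝ≥0 in 𝓝 0, ∀ l,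
      ‖m s l x (evE (indS ⟨c, hcD⟩ 1))‖ ≤ ‖m 0 l x (evE (indS ⟨c, hcD⟩ 1))‖ + 1 :=
    eventually_all.mpr fun l => (hk.tendsto_coefficient_zero hm hD' l x _).norm.eventually_le_const
      (lt_add_one _)
  obtain ⟨δ, hδ, hδ1⟩ := Metric.eventually_nhds_iff.mp h1
  -- Above `r₀` the function `g` equals `c` up to `r`; above `r - δ` the remaining time is in the
  -- range of the bound near `0`; above `r - 1` it is within the horizon of `indS c 1`.
  obtain ⟨r₁, hr₁, hr₁r⟩ : ∃ r₁, max (max r₀ 0) (max (r - δ) (r - 1)) < r₁ ∧ r₁ < r :=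
    exists_between (max_lt (max_lt hr₀ hr) (max_lt (by linarith) (by linarith)))
  simp only [max_lt_iff] at hr₁
  obtain ⟨⟨hr₁₀, hr₁0⟩, hr₁δ, hr₁1⟩ := hr₁
  obtain ⟨J, hJ1, hJ⟩ := exists_fock_joining (k := k) r₁.toNNReal
  refine ⟨∑ l, ‖m r₁.toNNReal j (b l) (evE (beforeS r₁.toNNReal g))‖ *
    ((‖m 0 l x (evE (indS ⟨c, hcD⟩ 1))‖ + 1) * ‖ev (shiftS r₁.toNNReal g : ℝ → k)‖), ?_⟩
  filter_upwards [Ioo_mem_nhdsLT hr₁r] with s hs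
  have h2 : s.toNNReal = r₁.toNNReal + (s - r₁).toNNReal := by
    rw [← Real.toNNReal_add hr₁0.le (sub_nonneg.mpr hs.1.le), add_sub_cancel]
  -- The shifted function depends on `r₁`, but on `[0, s - r₁[` it agrees with the constant `c`,
  -- whose bound was fixed before `r₁` was chosen. `norm_coefficient_le` compares the two.
  have h3 : beforeS (s - r₁).toNNReal (shiftS r₁.toNNReal g) =
      beforeS (s - r₁).toNNReal (indS ⟨c, hcD⟩ 1) := by
    refine Subtype.ext (Set.indicator_congr fun y hy => ?_)
    rw [Real.coe_toNNReal _ (sub_nonneg.mpr hs.1.le)] at hy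
    have h4 : (shiftS r₁.toNNReal g : ℝ → k) y = (g : ℝ → k) (y + r₁) := by
      change shift r₁.toNNReal (g : ℝ → k) y = _
      simp only [shift, Set.indicator_apply, Set.mem_Ici, hy.1, if_true,
        Real.coe_toNNReal _ hr₁0.le]
    have h5 : (indS ⟨c, hcD⟩ 1 : ℝ → k) y = c :=
      Set.indicator_of_mem (s := Set.Ico 0 1) ⟨hy.1, by linarith [hy.2, hs.2]⟩ fun _ => c
    rw [h4, h5]
    exact hcr₀ ⟨by linarith [hy.1], by linarith [hy.2, hs.2]⟩
  rw [h2, hk.cocycle.coefficient_add hm hD' hJ]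
  refine (norm_sum_le _ _).trans (Finset.sum_le_sum fun l _ => ?_)
  refine (hJ1 _).trans ?_
  rw [norm_tmulH]
  gcongr
  refine (hk.cocycle.norm_coefficient_le hm hD' h3 l x).trans ?_
  gcongr
  refine hδ1 ?_ l
  rw [NNReal.dist_eq, Real.coe_toNNReal _ (sub_nonneg.mpr hs.1.le), NNReal.coe_zero, sub_zero,
    abs_of_pos (sub_pos.mpr hs.1)]
  linarith [hs.2]

theorem IsHolderCocycle.rightRegular_column [FiniteDimensional ℂ V] (hk : IsHolderCocycle kk D')
    (hD' : Dense (D' : Set k)) (x : V) (e : Exps D) (a : h) :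
    RightRegular fun s : ℝ => column (kk s.toNNReal x) e a := by
  induction e using exps_induction with
  | h0 =>
    have h1 (s : ℝ) : column (kk s.toNNReal x) 0 a = 0 := by
      simpa using column_smul_right (kk s.toNNReal x) 0 0 a
    simpa only [h1] using (continuous_const (y := (0 : HTensor h' (NoiseFock k)))).rightRegular
  | hadd e₁ e₂ h1 h2 => simpa only [column_add_right] using h1.add h2
  | hsmul c e h1 =>
    simp only [column_smul_right]
    exact h1.clm (c • ContinuousLinearMap.id ℂ _)
  | hev g =>
    obtain ⟨m, hm⟩ := hk.exists_coefficient hD' (Module.finBasis ℂ V)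
    simp only [hm.column_eq hD']
    exact RightRegular.sum fun j _ => (hk.rightRegular_coefficient hm hD' j x g).clm (tmulL h' _ _)

end Coefficients

/-! ### The integrand process -/

section Exchange

variable {k : Type u} [NormedAddCommGroup k] [InnerProductSpace ℂ k]
variable {h : Type v} [NormedAddCommGroup h] [InnerProductSpace ℂ h]
variable {h' : Type w} [NormedAddCommGroup h'] [InnerProductSpace ℂ h']
variable {D : Submodule ℂ k}

theorem eq_of_inner_tmulH {H : Type*} [NormedAddCommGroup H] [InnerProductSpace ℂ H]
    {K : Type*} [NormedAddCommGroup K] [InnerProductSpace ℂ K] {y z : HTensor H K}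
    (hyz : ∀ (a : H) (b : K), ⟪tmulH a b, y⟫_ℂ = ⟪tmulH a b, z⟫_ℂ) : y = z := by
  refine eq_of_inner_dense (dense_algTensor (A := (⊤ : Submodule ℂ H)) (B := (⊤ : Submodule ℂ K))
    (by simp) (by simp)) fun ξ hξ => ?_
  induction hξ using Submodule.span_induction with
  | mem ξ hξ =>
    obtain ⟨a, -, b, -, rfl⟩ := hξ
    exact hyz a b
  | zero => simp only [inner_zero_left]
  | add e₁ e₂ _ _ h1 h2 => simp only [inner_add_left, h1, h2]
  | smul c e _ h1 => simp only [inner_smul_left, h1]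

variable (h' k) in
/-- The isometry `(a ⊗ f) ⊗ ζ ↦ (a ⊗ ζ) ⊗ f`. -/
def exchange : HTensor (HTensor h' (NoiseFock k)) (KHat k) →ₗᵢ[ℂ]
    HTensor (HTensor h' (KHat k)) (NoiseFock k) :=
  (exists_exchange h' (NoiseFock k) (KHat k)).choose

theorem exchange_tmulH (a : h') (f : NoiseFock k) (ζ : KHat k) :
    exchange k h' (tmulH (tmulH a f) ζ) = tmulH (tmulH a ζ) f :=
  (exists_exchange h' (NoiseFock k) (KHat k)).choose_spec a f ζ

theorem inner_exchange (a : h') (f : NoiseFock k) (ζ κ : KHat k) (y : HTensor h' (NoiseFock k)) :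
    ⟪tmulH (tmulH a ζ) f, exchange k h' (tmulH y κ)⟫_ℂ = ⟪ζ, κ⟫_ℂ * ⟪tmulH a f, y⟫_ℂ := by
  rw [← exchange_tmulH, LinearIsometry.inner_map_map, inner_tmulH, mul_comm]

/-- The operator `u ζ ε ↦ A(u ε) ⊗ B ζ`, as a linear function of `B`. -/
def ampliation (A : Op (expDomain (⊤ : Submodule ℂ h) D) (HTensor h' (NoiseFock k))) :
    Op (hatSub D) (KHat k) →ₗ[ℂ]
      Op (integrandDomain h D) (HTensor (HTensor h' (KHat k)) (NoiseFock k)) :=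
  (LinearMap.llcomp ℂ _ _ _ ((exchange k h').toLinearMap ∘ₗ toHTensor.toLinearMap)) ∘ₗ
    (LinearMap.lcomp ℂ _ ((TensorProduct.rightComm ℂ (⊤ : Submodule ℂ h) (hatSub D)
      (Exps D)).toLinearMap ∘ₗ
      LinearMap.rTensor (Exps D) (algTensorEquiv (⊤ : Submodule ℂ h) (hatSub D)).symm.toLinearMap ∘ₗ
        (algTensorEquiv (algTensor (⊤ : Submodule ℂ h) (hatSub D)) (Exps D)).symm.toLinearMap)) ∘ₗ
      (TensorProduct.mapBilinear (RingHom.id ℂ) _ _ _ _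
        (A ∘ₗ (algTensorEquiv (⊤ : Submodule ℂ h) (Exps D)).toLinearMap))

theorem ampliation_domVec3
    (A : Op (expDomain (⊤ : Submodule ℂ h) D) (HTensor h' (NoiseFock k)))
    (B : Op (hatSub D) (KHat k)) (a : h) (ζ : hatSub D) (e : Exps D) :
    ampliation A B (domVec3 a ζ e) = exchange k h' (tmulH (column A e a) (B ζ)) := by
  have h1 : (algTensorEquiv (algTensor (⊤ : Submodule ℂ h) (hatSub D)) (Exps D)).symm
      (domVec3 a ζ e) = ⟨tmulH a (ζ : KHat k), tmulH_mem Submodule.mem_top ζ.2⟩ ⊗ₜ e :=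
    algTensorEquiv_symm_tmulH _ _
  have h2 : (algTensorEquiv (⊤ : Submodule ℂ h) (hatSub D)).symm
      ⟨tmulH a (ζ : KHat k), tmulH_mem Submodule.mem_top ζ.2⟩ = ⟨a, trivial⟩ ⊗ₜ ζ :=
    algTensorEquiv_symm_tmulH (A := (⊤ : Submodule ℂ h)) ⟨a, trivial⟩ ζ
  change exchange k h' (toHTensor (TensorProduct.map _ B (TensorProduct.rightComm ℂ _ _ _
    (LinearMap.rTensor (Exps D) _ ((algTensorEquiv (algTensor (⊤ : Submodule ℂ h) (hatSub D))
      (Exps D)).symm (domVec3 a ζ e)))))) = _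
  rw [h1, LinearMap.rTensor_tmul, LinearEquiv.coe_coe, h2, TensorProduct.rightComm_tmul,
    TensorProduct.map_tmul, toHTensor_tmul]
  rfl

theorem algTensor_induction {H : Type*} [NormedAddCommGroup H] [InnerProductSpace ℂ H]
    {K : Type*} [NormedAddCommGroup K] [InnerProductSpace ℂ K] {A : Submodule ℂ H}
    {B : Submodule ℂ K} {p : algTensor A B → Prop}
    (hv : ∀ (a : A) (b : B), p ⟨tmulH (a : H) (b : K), tmulH_mem a.2 b.2⟩) (h0 : p 0)
    (hadd : ∀ x y, p x → p y → p (x + y)) (hsmul : ∀ (c : ℂ) (x), p x → p (c • x))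
    (ξ : algTensor A B) : p ξ := by
  obtain ⟨ξ, hξ⟩ := ξ
  induction hξ using Submodule.span_induction with
  | mem ξ hξ =>
    obtain ⟨a, ha, b, hb, rfl⟩ := hξ
    exact hv ⟨a, ha⟩ ⟨b, hb⟩
  | zero => exact h0
  | add x y hx hy ihx ihy => exact hadd ⟨x, hx⟩ ⟨y, hy⟩ ihx ihy
  | smul c x hx ih => exact hsmul c ⟨x, hx⟩ ih

theorem column_sum {V : Submodule ℂ (h →L[ℂ] h')} {kk : OpFamily V D} {ι : Type*} {b : ι → V}
    {S : Finset ι} (t : ℝ≥0) (c : ι → ℂ) (e : Exps D) (a : h) :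
    column (kk t (∑ j ∈ S, c j • b j)) e a = ∑ j ∈ S, c j • column (kk t (b j)) e a := by
  simp only [column_apply, map_sum, map_smul, LinearMap.sum_apply, LinearMap.smul_apply]

variable {H : Type*} [NormedAddCommGroup H] [InnerProductSpace ℂ H] {Dom : Submodule ℂ H}

theorem domVec_zero_left (e : Exps D) : domVec (0 : Dom) e = 0 :=
  Subtype.ext (map_zero (ket (e : NoiseFock k)))

theorem domVec_add_left (w₁ w₂ : Dom) (e : Exps D) :
    domVec (w₁ + w₂) e = domVec w₁ e + domVec w₂ e :=
  Subtype.ext (tmulH_add_left _ _ _)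

theorem domVec_smul_left (c : ℂ) (w : Dom) (e : Exps D) : domVec (c • w) e = c • domVec w e :=
  Subtype.ext (tmulH_smul_left _ _ _)

theorem integrandDomain_induction {p : integrandDomain h D → Prop}
    (hv : ∀ a ζ e, p (domVec3 a ζ e)) (h0 : p 0) (hadd : ∀ x y, p x → p y → p (x + y))
    (hsmul : ∀ (c : ℂ) (x), p x → p (c • x)) (ξ : integrandDomain h D) : p ξ := by
  refine algTensor_induction (p := p) (fun w e => ?_) h0 hadd hsmul ξ
  refine algTensor_induction (p := fun w => p (domVec w e)) (fun a ζ => hv a ζ e) ?_ ?_ ?_ w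
  · rw [domVec_zero_left]
    exact h0
  · intro w₁ w₂ h1 h2
    rw [domVec_add_left]
    exact hadd _ _ h1 h2
  · intro c w h1
    rw [domVec_smul_left]
    exact hsmul _ _ h1

/-- Carries adaptedness from simple tensors `a ⊗ ζ` to arbitrary `w ∈ h ⊙ D̂`, with `L₁`, `L₂` the
bras of the test functions. -/
theorem map_domVec_eq_smul {G G' : Type*} [AddCommGroup G] [Module ℂ G] [AddCommGroup G']
    [Module ℂ G'] (X : integrandDomain h D →ₗ[ℂ] G) (L₁ L₂ : G →ₗ[ℂ] G') {c : ℂ} {e₁ e₂ : Exps D}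
    (hX : ∀ (a : h) (ζ : hatSub D), L₁ (X (domVec3 a ζ e₁)) = c • L₂ (X (domVec3 a ζ e₂)))
    (w : algTensor (⊤ : Submodule ℂ h) (hatSub D)) :
    L₁ (X (domVec w e₁)) = c • L₂ (X (domVec w e₂)) := by
  induction w using algTensor_induction with
  | hv a ζ => exact hX a ζ
  | h0 => rw [domVec_zero_left, domVec_zero_left, map_zero, map_zero, map_zero, smul_zero]
  | hadd w₁ w₂ h2 h3 =>
    rw [domVec_add_left, domVec_add_left, map_add, map_add, map_add, map_add, h2, h3, smul_add]
  | hsmul c w h2 =>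
    rw [domVec_smul_left, domVec_smul_left, map_smul, map_smul, map_smul, map_smul, h2, smul_comm]

end Exchange

section Integrand

variable {k : Type u} [NormedAddCommGroup k] [InnerProductSpace ℂ k] [CompleteSpace k]
variable {h : Type v} [NormedAddCommGroup h] [InnerProductSpace ℂ h]
variable {h' : Type w} [NormedAddCommGroup h'] [InnerProductSpace ℂ h']
variable {V : Submodule ℂ (h →L[ℂ] h')} {D D' : Submodule ℂ k} {ι : Type*} [Fintype ι]

/-- The integrand `x ↦ ∑ⱼ k_t(bⱼ) ⊗ Tⱼ(x)`, with the tensor factors in the appropriate order. -/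
def integrand (kk : OpFamily V D) (b : ι → V)
    (T : ι → V →ₗ[ℂ] OpDagger (hatSub D) (hatSub D')) (t : ℝ≥0) :
    V →ₗ[ℂ] Op (integrandDomain h D) (HTensor (HTensor h' (KHat k)) (NoiseFock k)) :=
  ∑ j, ampliation (kk t (b j)) ∘ₗ (OpDagger (hatSub D) (hatSub D')).subtype ∘ₗ T j

variable {kk : OpFamily V D} {b : ι → V} {T : ι → V →ₗ[ℂ] OpDagger (hatSub D) (hatSub D')}

theorem integrand_domVec3 (t : ℝ≥0) (x : V) (a : h) (ζ : hatSub D) (e : Exps D) :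
    integrand kk b T t x (domVec3 a ζ e) = ∑ j, exchange k h'
      (tmulH (column (kk t (b j)) e a) ((T j x : Op (hatSub D) (KHat k)) ζ)) := by
  rw [integrand, LinearMap.sum_apply, LinearMap.sum_apply]
  exact Finset.sum_congr rfl fun j _ => ampliation_domVec3 _ _ _ _ _

theorem inner_integrand_domVec3 (t : ℝ≥0) (x : V) (a : h) (ζ : hatSub D) (e : Exps D)
    (a' : h') (ζ' : KHat k) (f : NoiseFock k) :
    ⟪tmulH (tmulH a' ζ') f, integrand kk b T t x (domVec3 a ζ e)⟫_ℂ =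
      ⟪tmulH a' f, column (kk t (component (sumTensor b T) ζ' ζ x)) e a⟫_ℂ := by
  rw [integrand_domVec3, component_sumTensor, column_sum, inner_sum, inner_sum]
  refine Finset.sum_congr rfl fun j _ => ?_
  rw [inner_exchange, inner_smul_right]

theorem isProcess_integrand (hp : ∀ x, IsProcess fun t => kk t x) (x : V) :
    IsProcess fun t => integrand kk b T t x where
  measurable ξ' ξ := by
    induction ξ using integrandDomain_induction with
    | h0 => simp only [map_zero, inner_zero_right, measurable_const]
    | hadd ξ₁ ξ₂ h1 h2 =>
      simp only [map_add, inner_add_right]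
      exact h1.add h2
    | hsmul c ξ h1 =>
      simp only [map_smul, inner_smul_right]
      exact h1.const_mul c
    | hv a ζ e =>
      simp only [integrand_domVec3, inner_sum]
      refine Finset.measurable_sum _ fun j _ => ?_
      -- Tensoring with the fixed vector `T j x ζ` is bounded, so its adjoint moves to the test
      -- vector and measurability is that of `k`.
      let B : HTensor h' (NoiseFock k) →L[ℂ] HTensor (HTensor h' (KHat k)) (NoiseFock k) :=
        (exchange k h').toContinuousLinearMap ∘L ket ((T j x : Op (hatSub D) (KHat k)) ζ)
      have h1 := (hp (b j)).measurable (B.adjoint ξ') (domVec ⟨a, trivial⟩ e)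
      simp only [ContinuousLinearMap.adjoint_inner_left] at h1
      exact h1
  adapted t w g hg a' g' hg' := by
    -- Stated for bras because the test vector `a'` ranges over all of `h' ⊗ k̂`, whereas the matrix
    -- elements of the integrand are known only at simple tensors.
    have h1 (a : h) (ζ : hatSub D) :
        bra (ev g') (integrand kk b T t x (domVec3 a ζ ⟨ev g, ev_mem hg⟩)) =
          ⟪ev (after t g'), ev (after t g)⟫_ℂ • bra (ev (before t g'))
            (integrand kk b T t x (domVec3 a ζ ⟨ev (before t g), ev_mem (Step.before_mem hg t)⟩)) := by
      refine eq_of_inner_tmulH fun a' ζ' => ?_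
      rw [inner_smul_right, inner_bra, inner_bra, inner_integrand_domVec3, inner_integrand_domVec3,
        mul_comm]
      exact (hp _).adapted t ⟨a, trivial⟩ g hg a' g' hg'
    suffices h2 : bra (ev g') (integrand kk b T t x (domVec w ⟨ev g, ev_mem hg⟩)) =
        ⟪ev (after t g'), ev (after t g)⟫_ℂ • bra (ev (before t g')) (integrand kk b T t x
          (domVec w ⟨ev (before t g), ev_mem (Step.before_mem hg t)⟩)) by
      rw [← inner_bra, h2, inner_smul_right, inner_bra, mul_comm]
    exact map_domVec_eq_smul _ (bra (ev g')).toLinearMap (bra (ev (before t g'))).toLinearMap h1 w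

end Integrand

section RegularIntegrand

variable {k : Type u} [NormedAddCommGroup k] [InnerProductSpace ℂ k] [CompleteSpace k]
variable {h : Type v} [NormedAddCommGroup h] [InnerProductSpace ℂ h]
variable {h' : Type w} [NormedAddCommGroup h'] [InnerProductSpace ℂ h'] [CompleteSpace h']
variable {V : Submodule ℂ (h →L[ℂ] h')} {D D' : Submodule ℂ k} {ι : Type*} [Fintype ι]
variable {kk : OpFamily V D} {b : ι → V} {T : ι → V →ₗ[ℂ] OpDagger (hatSub D) (hatSub D')}

theorem IsHolderCocycle.rightRegular_integrand [FiniteDimensional ℂ V]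
    (hk : IsHolderCocycle kk D') (hD' : Dense (D' : Set k)) (x : V) (a : h) (e : Exps D)
    {ζ : ℝ → hatSub D} (hζ : PiecewiseConst ζ) :
    RightRegular fun s : ℝ => integrand kk b T s.toNNReal x (domVec3 a (ζ s) e) := by
  simp only [integrand_domVec3]
  refine RightRegular.sum fun j _ => ?_
  have h1 := (hζ.comp fun ζ => (T j x : Op (hatSub D) (KHat k)) ζ).rightRegular
  exact ((hk.rightRegular_column hD' (b j) e a).clm₂ (tmulL _ _) h1).clm
    (exchange k h').toContinuousLinearMap

theorem IsHolderCocycle.isQSIntegrable_integrand [FiniteDimensional ℂ V]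
    (hk : IsHolderCocycle kk D') (hD' : Dense (D' : Set k)) (x : V) :
    IsQSIntegrable fun t => integrand kk b T t x where
  isProcess := isProcess_integrand hk.cocycle.isProcess x
  memLp t a ζ e := (hk.rightRegular_integrand hD' x a e
    (⟨fun _ => .of_forall fun _ => rfl, fun _ => ⟨ζ, .of_forall fun _ => rfl⟩⟩ :
      PiecewiseConst fun _ : ℝ => ζ)).memLp 2 0 t

end RegularIntegrand

/-! ### The integral equation -/

section Functional

theorem continuous_functional {h : Type v} [NormedAddCommGroup h] [InnerProductSpace ℂ h]
    {h' : Type w} [NormedAddCommGroup h'] [InnerProductSpace ℂ h'] {V : Submodule ℂ (h →L[ℂ] h')}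
    [FiniteDimensional ℂ V] (l : V →ₗ[ℂ] ℂ) : Continuous l :=
  LinearMap.continuous_of_finiteDimensional (E := V) l

/-- The functional `y ↦ c ⟪a', y a⟫`. -/
def matrixFunctional {h : Type v} [NormedAddCommGroup h] [InnerProductSpace ℂ h]
    {h' : Type w} [NormedAddCommGroup h'] [InnerProductSpace ℂ h'] {V : Submodule ℂ (h →L[ℂ] h')}
    (c : ℂ) (a' : h') (a : h) : V →ₗ[ℂ] ℂ where
  toFun y := c * ⟪a', (y : h →L[ℂ] h') a⟫_ℂ
  map_add' y z := by rw [Submodule.coe_add, _root_.add_apply, inner_add_right, mul_add]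
  map_smul' r y := by
    rw [Submodule.coe_smul, _root_.smul_apply, inner_smul_right, RingHom.id_apply, smul_eq_mul,
      mul_left_comm]

end Functional

section IntegralEquation

variable {k : Type u} [NormedAddCommGroup k] [InnerProductSpace ℂ k]
variable {D D' : Submodule ℂ k}

/-- The value of a `D`-valued step function, as an element of `D`. -/
def valS (g : Step D) (s : ℝ) : D := ⟨(g : ℝ → k) s, Step.apply_mem g.2 s⟩

theorem piecewiseConst_valS (g : Step D) : PiecewiseConst (valS g) where
  right r := ((Step.piecewiseConst g.2).right r).mono fun _ hs => Subtype.ext hs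
  left r := by
    obtain ⟨c, hc⟩ := (Step.piecewiseConst g.2).left r
    obtain ⟨s, hs⟩ := hc.exists
    exact ⟨valS g s, hc.mono fun y hy => Subtype.ext (hy.trans hs.symm)⟩

theorem before_shift_eq_ind {g : Step D} {r σ : ℝ≥0} {c : D}
    (hg : ∀ y : ℝ, (r : ℝ) ≤ y → y < r + σ → valS g y = c) :
    before σ (shift r (g : ℝ → k)) = ind (c : k) σ := by
  refine Set.indicator_congr fun y hy => ?_
  rw [← hg (y + r) (by linarith [hy.1]) (by linarith [hy.2])]
  simp only [shift, Set.indicator_apply, Set.mem_Ici, hy.1, if_true, valS]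

variable {h : Type v} [NormedAddCommGroup h] [InnerProductSpace ℂ h]
variable {h' : Type w} [NormedAddCommGroup h'] [InnerProductSpace ℂ h'] [CompleteSpace h']
variable {V : Submodule ℂ (h →L[ℂ] h')} {kk : OpFamily V D}

theorem IsCocycle.matrixFunctional_kgg (hc : IsCocycle kk D') (s : ℝ≥0) (x : V) (a' : h')
    (g' : Step D') (a : h) (g : Step D) :
    matrixFunctional ⟪ev (g' : ℝ → k), ev (g : ℝ → k)⟫_ℂ a' a (kgg hc.slices g' g s x) =
      ⟪tmulH a' (ev (g' : ℝ → k)), column (kk s x) (evE g) a⟫_ℂ := by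
  rw [← coe_evE, ← inner_sliceMap hc.slices, hc.sliceMap_ev, Submodule.coe_smul,
    _root_.smul_apply, inner_smul_right]
  rfl

/-- On an interval where both step functions are constant, the cocycle evolves by the associated
semigroup, which acts first on `x`. -/
theorem IsCocycle.kgg_add_of_const (hc : IsCocycle kk D') {g' : Step D'} {g : Step D} {r s : ℝ}
    (hr : 0 ≤ r) (hrs : r ≤ s) {c' : D'} {c : D} (hg' : ∀ y, r ≤ y → y < s → valS g' y = c')
    (hg : ∀ y, r ≤ y → y < s → valS g y = c) (x : V) :
    kgg hc.slices g' g s.toNNReal x =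
      kgg hc.slices g' g r.toNNReal (assocSemigroup hc.slices c' c (s - r).toNNReal x) := by
  have h1 : s.toNNReal = r.toNNReal + (s - r).toNNReal := by
    rw [← Real.toNNReal_add hr (sub_nonneg.mpr hrs), add_sub_cancel]
  have h2 (y : ℝ) : (r.toNNReal : ℝ) ≤ y → y < r.toNNReal + (s - r).toNNReal → r ≤ y ∧ y < s := by
    rw [Real.coe_toNNReal _ hr, Real.coe_toNNReal _ (sub_nonneg.mpr hrs), add_sub_cancel]
    exact And.intro
  rw [h1, hc.add]
  refine congrArg (kgg hc.slices g' g r.toNNReal) ?_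
  rw [kgg_eq_assocSemigroup hc.slices
    (before_shift_eq_ind fun y h3 h4 => hg' y (h2 y h3 h4).1 (h2 y h3 h4).2)
    (before_shift_eq_ind fun y h3 h4 => hg y (h2 y h3 h4).1 (h2 y h3 h4).2)]

theorem eventually_const_right {g : Step D} (r : ℝ) :
    ∀ᶠ s in 𝓝[>] r, ∀ y, r ≤ y → y < s → valS g y = valS g r := by
  obtain ⟨u, hu, hru⟩ := (mem_nhdsGE_iff_exists_Ico_subset).mp ((piecewiseConst_valS g).right r)
  filter_upwards [Ioo_mem_nhdsGT hu] with s hs y h1 h2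
  exact hru ⟨h1, h2.trans hs.2⟩

theorem exists_const_left (g : Step D) (r : ℝ) :
    ∃ c : D, ∀ᶠ s in 𝓝[<] r, ∀ y, s ≤ y → y < r → valS g y = c := by
  obtain ⟨c, hc⟩ := (piecewiseConst_valS g).left r
  obtain ⟨u, hu, hru⟩ := (mem_nhdsLT_iff_exists_Ioo_subset).mp hc
  refine ⟨c, ?_⟩
  filter_upwards [Ioo_mem_nhdsLT hu] with s hs y h1 h2
  exact hru ⟨hs.1.trans_le h1, h2⟩

variable [FiniteDimensional ℂ V]

/-- Step functions are constant on some interval to the right of `r`, so the difference quotient is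
that of the semigroup at `0`, mapped by the fixed linear map `l ∘ k^{g',g}_r`. -/
theorem IsHolderCocycle.hasDerivWithinAt_kgg (hk : IsHolderCocycle kk D') {g' : Step D'}
    {g : Step D} {r : ℝ} (hr : 0 ≤ r) {x y : V}
    (hy : Tendsto (fun t : ℝ => (t : ℂ)⁻¹ •
      (assocSemigroup hk.cocycle.slices (valS g' r) (valS g r) t.toNNReal x - x)) (𝓝[>] 0) (𝓝 y))
    (l : V →ₗ[ℂ] ℂ) :
    HasDerivWithinAt (fun s : ℝ => l (kgg hk.cocycle.slices g' g s.toNNReal x))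
      (l (kgg hk.cocycle.slices g' g r.toNNReal y)) (Set.Ioi r) r := by
  rw [hasDerivWithinAt_iff_tendsto_slope' (by simp)]
  have h1 : Tendsto (fun s : ℝ => s - r) (𝓝[>] r) (𝓝[>] 0) := by
    refine tendsto_nhdsWithin_iff.mpr ⟨?_, ?_⟩
    · have : Continuous fun s : ℝ => s - r := by fun_prop
      simpa using (this.tendsto r).mono_left nhdsWithin_le_nhds
    · filter_upwards [self_mem_nhdsWithin] with s (hs : r < s) using sub_pos.mpr hs
  have h2 := ((continuous_functional (l ∘ₗ kgg hk.cocycle.slices g' g r.toNNReal)).tendsto y).comp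
    (hy.comp h1)
  refine h2.congr' ?_
  filter_upwards [self_mem_nhdsWithin, eventually_const_right (g := g') r,
    eventually_const_right (g := g) r] with s (hs : r < s) h3 h4
  rw [slope, vsub_eq_sub, hk.cocycle.kgg_add_of_const hr hs.le h3 h4, ← map_sub, ← map_sub,
    ← Complex.coe_smul, Complex.ofReal_inv, ← map_smul, ← map_smul]
  rfl

/-- Near `r` on either side the function is a semigroup orbit: started at `r` itself on the right,
and at an earlier `r₁`, after the last jump, on the left. At negative arguments `toNNReal` makes it
constant. -/
theorem IsHolderCocycle.continuous_kgg (hk : IsHolderCocycle kk D') (g' : Step D') (g : Step D)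
    (x : V) (l : V →ₗ[ℂ] ℂ) :
    Continuous fun s : ℝ => l (kgg hk.cocycle.slices g' g s.toNNReal x) := by
  have h1 (r : ℝ) (c' : D') (c : D) :
      Continuous fun s : ℝ => l (kgg hk.cocycle.slices g' g r.toNNReal
        (assocSemigroup hk.cocycle.slices c' c (s - r).toNNReal x)) :=
    (continuous_functional (l ∘ₗ kgg hk.cocycle.slices g' g r.toNNReal)).comp
      ((hk.continuous_assocSemigroup c' c x).comp (by fun_prop))
  have hneg {s : ℝ} (hs : s ≤ 0) : s.toNNReal = 0 := Real.toNNReal_of_nonpos hs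
  refine continuous_iff_continuousAt.mpr fun r => continuousAt_iff_continuous_left'_right'.mpr
    ⟨?_, ?_⟩
  · rcases le_or_gt r 0 with hr | hr
    · refine (continuousWithinAt_const (b := l (kgg hk.cocycle.slices g' g 0 x))).congr
        (fun s (hs : s < r) => ?_) ?_
      · rw [hneg (hs.le.trans hr)]
      · rw [hneg hr]
    · obtain ⟨c', hc'⟩ := exists_const_left g' r
      obtain ⟨c, hc⟩ := exists_const_left g r
      obtain ⟨r₁, ⟨h2, h3⟩, h4, h5⟩ := ((hc'.and hc).and (Ioo_mem_nhdsLT hr)).exists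
      refine ((h1 r₁ c' c).continuousWithinAt.congr_of_eventuallyEq (s := Set.Iio r) ?_ ?_)
      · filter_upwards [Ioo_mem_nhdsLT h5] with s hs
        rw [hk.cocycle.kgg_add_of_const h4.le hs.1.le (fun y h6 h7 => h2 y h6 (h7.trans hs.2))
          (fun y h6 h7 => h3 y h6 (h7.trans hs.2))]
      · rw [hk.cocycle.kgg_add_of_const h4.le h5.le h2 h3]
  · rcases lt_or_ge r 0 with hr | hr
    · refine (continuousWithinAt_const (b := l (kgg hk.cocycle.slices g' g 0 x))).congr_of_eventuallyEq
        ?_ ?_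
      · filter_upwards [Ioo_mem_nhdsGT hr] with s hs
        rw [hneg hs.2.le]
      · rw [hneg hr.le]
    · refine ((h1 r (valS g' r) (valS g r)).continuousWithinAt.congr_of_eventuallyEq
        (s := Set.Ioi r) ?_ ?_)
      · filter_upwards [self_mem_nhdsWithin, eventually_const_right (g := g') r,
          eventually_const_right (g := g) r] with s (hs : r < s) h3 h4
        rw [hk.cocycle.kgg_add_of_const hr hs.le h3 h4]
      · rw [sub_self, Real.toNNReal_zero, hk.cocycle.assocSemigroup_zero, LinearMap.id_apply]

variable [CompleteSpace k]

theorem IsHolderCocycle.rightRegular_column_piecewiseConst (hk : IsHolderCocycle kk D')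
    (hD' : Dense (D' : Set k)) {y : ℝ → V} (hy : PiecewiseConst y) (e : Exps D) (a : h) :
    RightRegular fun s : ℝ => column (kk s.toNNReal (y s)) e a := by
  let b := Module.finBasis ℂ V
  have h1 (s : ℝ) : column (kk s.toNNReal (y s)) e a =
      ∑ j, b.coord j (y s) • column (kk s.toNNReal (b j)) e a := by
    conv_lhs => rw [← b.sum_repr (y s)]
    exact column_sum _ _ _ _
  simp only [h1]
  exact RightRegular.sum fun j _ => (hy.comp (b.coord j)).rightRegular.clm₂
    (ContinuousLinearMap.lsmul ℂ ℂ) (hk.rightRegular_column hD' (b j) e a)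

/-- The map `φ` generates the semigroups associated with the cocycle. -/
def IsSemigroupGenerator (hs : SlicesInto kk D')
    (φ : V →ₗ[ℂ] V ⊗[ℂ] OpDagger (hatSub D) (hatSub D')) : Prop :=
  ∀ (c' : D') (c : D) (x : V),
    Tendsto (fun t : ℝ => (t : ℂ)⁻¹ • (assocSemigroup hs c' c t.toNNReal x - x))
      (𝓝[>] 0) (𝓝 (component φ (hat (c' : k)) (hatS c) x))

/-- The fundamental theorem of calculus in its right-derivative form, since the derivative jumps
with `g'` and `g`. Multiplying by `⟪ε(g'), ε(g)⟫` undoes the normalisation of `k^{g',g}`, giving the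
matrix elements of `k`. -/
theorem IsHolderCocycle.integral_eq (hk : IsHolderCocycle kk D') (hD' : Dense (D' : Set k))
    {φ : V →ₗ[ℂ] V ⊗[ℂ] OpDagger (hatSub D) (hatSub D')}
    (hφ : IsSemigroupGenerator hk.cocycle.slices φ) (t : ℝ≥0) (x : V) (a' : h') (g' : Step D')
    (a : h) (g : Step D) :
    ⟪tmulH a' (ev (g' : ℝ → k)), column (kk t x) (evE g) a⟫_ℂ -
        ⟪a', (x : h →L[ℂ] h') a⟫_ℂ * ⟪ev (g' : ℝ → k), ev (g : ℝ → k)⟫_ℂ =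
      ∫ s in (0 : ℝ)..t, ⟪tmulH a' (ev (g' : ℝ → k)), column (kk s.toNNReal
        (component φ (hat ((g' : ℝ → k) s)) (hatS (valS g s)) x)) (evE g) a⟫_ℂ := by
  have hl (s : ℝ≥0) (y : V) := hk.cocycle.matrixFunctional_kgg s y a' g' a g
  have h1 := intervalIntegral.integral_eq_sub_of_hasDeriv_right (a := 0) (b := (t : ℝ))
    (hk.continuous_kgg g' g x
      (matrixFunctional ⟪ev (g' : ℝ → k), ev (g : ℝ → k)⟫_ℂ a' a)).continuousOn
    (fun r hr => hk.hasDerivWithinAt_kgg (g' := g') (g := g)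
      (by simpa [t.coe_nonneg] using hr.1.le) (hφ (valS g' r) (valS g r) x) _)
  simp only [hl, Real.toNNReal_coe, Real.toNNReal_zero] at h1
  rw [← hl 0 x, hk.cocycle.zero, LinearMap.id_apply] at h1
  refine Eq.trans ?_ (h1 ?_).symm
  · rw [mul_comm]
    rfl
  · have h2 : PiecewiseConst fun r => component φ (hat (valS g' r : k)) (hatS (valS g r)) x :=
      ((piecewiseConst_valS g').prodMk (piecewiseConst_valS g)).comp
        fun p : D' × D => component φ (hat (p.1 : k)) (hatS p.2) x
    exact ((hk.rightRegular_column_piecewiseConst hD' h2 (evE g) a).clm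
      (innerSL ℂ (tmulH a' (ev (g' : ℝ → k))))).intervalIntegrable 0 t

end IntegralEquation

section Hat

variable {k : Type u} [NormedAddCommGroup k]

theorem norm_hat_le (c : k) : ‖hat c‖ ≤ 1 + ‖c‖ := by
  refine (sq_le_sq₀ (norm_nonneg _) (by positivity)).mp ?_
  rw [WithLp.prod_norm_sq_eq_of_L2]
  change ‖(1 : ℂ)‖ ^ 2 + ‖c‖ ^ 2 ≤ _
  rw [norm_one]
  nlinarith [norm_nonneg c]

theorem continuous_hat : Continuous (hat : k → KHat k) :=
  (WithLp.prod_continuous_toLp 2 ℂ k).comp (by fun_prop)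

end Hat

/-! ### Extension of the test functions from `D'`-valued to all step functions -/

section Divergence

variable {h' : Type w} [NormedAddCommGroup h'] [InnerProductSpace ℂ h']
variable {k : Type u} [NormedAddCommGroup k] [InnerProductSpace ℂ k] {D' : Submodule ℂ k}

/-- For right-regular integrands, a divergence can be identified on a dense set of test
functions. -/
theorem isDivergence_of_dense (hD' : Dense (D' : Set k))
    {z : ℝ → HTensor (HTensor h' (KHat k)) (NoiseFock k)} (hz : RightRegular z) {t : ℝ≥0}
    {y : HTensor h' (NoiseFock k)}
    (hy : ∀ (a' : h'), ∀ g' ∈ Step D', ⟪tmulH a' (ev g'), y⟫_ℂ =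
      ∫ s in (0 : ℝ)..t, ⟪tmulH (tmulH a' (hat (g' s))) (ev g'), z s⟫_ℂ) :
    IsDivergence z t y := by
  intro a' g' hg'
  obtain ⟨G, hG, hG1, ⟨C, hC⟩, hG2⟩ := exists_step_approx hD' hg'
  have hev := tendsto_ev hG2
  obtain ⟨C₁, hC₁⟩ := hev.norm.bddAbove_range
  obtain ⟨C₂, hC₂⟩ := hz.exists_bound 0 t
  have hC0 : 0 ≤ C := (norm_nonneg _).trans (hC 0 0)
  have h1 : Tendsto (fun n => ⟪tmulH a' (ev (G n)), y⟫_ℂ) atTop (𝓝 ⟪tmulH a' (ev g'), y⟫_ℂ) :=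
    (((tmulL h' _ a').continuous.tendsto _).comp hev).inner tendsto_const_nhds
  refine tendsto_nhds_unique h1 ?_
  simp only [fun n => hy a' (G n) (hG n)]
  have hmeas (n : ℕ) : RightRegular fun s : ℝ =>
      tmulH (tmulH a' (hat (G n s))) (ev (G n)) := by
    have h2 := ((Step.piecewiseConst (hG n)).comp hat).rightRegular
    exact h2.clm (ket (ev (G n)) ∘L tmulL h' _ a')
  -- The constant majorant combines `‖ĉ‖ ≤ 1 + ‖c‖` for the uniformly bounded values, a bound `C₁`
  -- for the convergent exponential vectors, and the bound `C₂` for `z` on `[0,t]`.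
  refine intervalIntegral.tendsto_integral_filter_of_dominated_convergence
    (fun _ => ‖a'‖ * (1 + C) * C₁ * C₂) (.of_forall fun n => ?_) (.of_forall fun n => ?_)
    intervalIntegrable_const (.of_forall fun s _ => ?_)
  · exact ((hmeas n).stronglyMeasurable.inner hz.stronglyMeasurable).aestronglyMeasurable
  · refine .of_forall fun s hs => (norm_inner_le_norm _ _).trans ?_
    rw [Set.uIoc_of_le t.coe_nonneg] at hs
    rw [norm_tmulH, norm_tmulH]
    have h3 : ‖ev (G n)‖ ≤ C₁ := hC₁ ⟨n, rfl⟩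
    have h4 := hC₂ s ⟨hs.1.le, hs.2⟩
    have h5 : ‖hat (G n s)‖ ≤ 1 + C := (norm_hat_le _).trans (by gcongr; exact hC n s)
    have h6 : 0 ≤ C₁ := (norm_nonneg _).trans h3
    gcongr
  · have h2 : Tendsto (fun n => tmulH a' (hat (G n s))) atTop (𝓝 (tmulH a' (hat (g' s)))) :=
      ((tmulL h' _ a').continuous.tendsto _).comp ((continuous_hat.tendsto _).comp (hG1 s))
    exact ((continuous_tmulH.tendsto (tmulH a' (hat (g' s)), ev g')).comp
      (h2.prodMk_nhds hev)).inner tendsto_const_nhds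

end Divergence

/-! ### Strong solutions and uniqueness of weak solutions -/

section Gronwall

/-- The coefficients are only right-continuous, so `δ` is differentiated from the right and
Gronwall's inequality is used in its right-derivative form, with initial value `0`. -/
theorem eq_zero_of_integral_eq {ι : Type*} [Fintype ι] {δ : ℝ → ι → ℂ} (hδ : Continuous δ)
    {M : ι → ι → ℝ → ℂ} (hM : ∀ i j, RightRegular (M i j))
    (hint : ∀ t, 0 ≤ t → ∀ i, δ t i = ∫ s in (0 : ℝ)..t, ∑ j, M i j s * δ s j) {t : ℝ}
    (ht : 0 ≤ t) : δ t = 0 := by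
  have hδi (j : ι) : Continuous fun s => δ s j := (continuous_apply j).comp hδ
  have hreg (i : ι) : RightRegular fun s => ∑ j, M i j s * δ s j :=
    RightRegular.sum fun j _ => (hM i j).clm₂ (ContinuousLinearMap.mul ℂ ℂ) (hδi j).rightRegular
  have hderiv (r : ℝ) (hr : 0 ≤ r) :
      HasDerivWithinAt δ (fun i => ∑ j, M i j r * δ r j) (Set.Ici r) r := by
    refine hasDerivWithinAt_pi.mpr fun i => ?_
    have h1 := intervalIntegral.integral_hasDerivWithinAt_right ((hreg i).intervalIntegrable 0 r)
      (s := Set.Ici r) (t := Set.Ioi r)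
      (hreg i).stronglyMeasurable.stronglyMeasurableAtFilter
      (((hreg i).right r).mono Set.Ioi_subset_Ici_self)
    exact h1.congr (fun s (hs : r ≤ s) => hint s (hr.trans hs) i) (hint r hr i)
  have hbd (i j : ι) := (hM i j).exists_bound 0 t
  choose C hC using hbd
  have hC0 (i j : ι) : 0 ≤ C i j := (norm_nonneg _).trans (hC i j 0 ⟨le_rfl, ht⟩)
  have h0 : ‖δ 0‖ ≤ 0 := by
    have : δ 0 = 0 := funext fun i => by rw [hint 0 le_rfl i, intervalIntegral.integral_same]; rfl
    rw [this, norm_zero]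
  have h1 := norm_le_gronwallBound_of_norm_deriv_right_le (K := ∑ i, ∑ j, C i j) (ε := 0)
    (b := t) hδ.continuousOn (fun r hr => hderiv r hr.1) h0 (fun r hr => by
      rw [add_zero]
      refine (pi_norm_le_iff_of_nonneg (mul_nonneg
        (Finset.sum_nonneg fun i _ => Finset.sum_nonneg fun j _ => hC0 i j)
          (norm_nonneg _))).mpr fun i => ?_
      calc ‖∑ j, M i j r * δ r j‖ ≤ ∑ j, C i j * ‖δ r‖ := by
            refine (norm_sum_le _ _).trans (Finset.sum_le_sum fun j _ => ?_)
            rw [norm_mul]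
            exact mul_le_mul (hC i j r ⟨hr.1, hr.2.le⟩) (norm_le_pi_norm _ _) (norm_nonneg _)
              (hC0 i j)
        _ = (∑ j, C i j) * ‖δ r‖ := (Finset.sum_mul _ _ _).symm
        _ ≤ _ := by
            refine mul_le_mul_of_nonneg_right ?_ (norm_nonneg _)
            exact Finset.single_le_sum (f := fun i => ∑ j, C i j)
              (fun i _ => Finset.sum_nonneg fun j _ => hC0 i j) (Finset.mem_univ i))
    t ⟨ht, le_rfl⟩
  rw [gronwallBound_ε0_δ0] at h1
  exact norm_le_zero_iff.mp h1

end Gronwall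

section Columns

variable {k : Type u} [NormedAddCommGroup k] [InnerProductSpace ℂ k] [CompleteSpace k]
variable {h : Type v} [NormedAddCommGroup h] [InnerProductSpace ℂ h]
variable {h' : Type w} [NormedAddCommGroup h'] [InnerProductSpace ℂ h'] {D D' : Submodule ℂ k}

theorem eq_of_column_eq {A B : Op (expDomain (⊤ : Submodule ℂ h) D) (HTensor h' (NoiseFock k))}
    (hD' : Dense (D' : Set k)) (hAB : ∀ (a' : h') (g' : Step D') (a : h) (g : Step D),
      ⟪tmulH a' (ev (g' : ℝ → k)), column A (evE g) a⟫_ℂ =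
        ⟪tmulH a' (ev (g' : ℝ → k)), column B (evE g) a⟫_ℂ) : A = B := by
  have h1 (a : h) (g : Step D) : column A (evE g) a = column B (evE g) a := by
    refine eq_of_inner_tmulH_exps hD' fun a' e' => ?_
    induction e' using exps_induction with
    | hev g' => exact hAB a' g' a g
    | h0 => simp only [Submodule.coe_zero, tmulH_zero_right, inner_zero_left]
    | hadd e₁ e₂ h1 h2 => simp only [Submodule.coe_add, tmulH_add_right, inner_add_left, h1, h2]
    | hsmul c e h1 => simp only [Submodule.coe_smul, tmulH_smul_right, inner_smul_left, h1]
  have h2 (a : h) (e : Exps D) : column A e a = column B e a := by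
    induction e using exps_induction with
    | hev g => exact h1 a g
    | h0 =>
      have h3 (A : Op (expDomain (⊤ : Submodule ℂ h) D) (HTensor h' (NoiseFock k))) :
          column A 0 a = 0 := by simpa using column_smul_right A 0 0 a
      rw [h3, h3]
    | hadd e₁ e₂ h1 h2 => rw [column_add_right, column_add_right, h1, h2]
    | hsmul c e h1 => rw [column_smul_right, column_smul_right, h1]
  refine LinearMap.ext fun ξ => algTensor_induction (p := fun ξ => A ξ = B ξ)
    (fun a e => h2 a e) ?_ (fun x y hx hy => ?_) (fun c x hx => ?_) ξ
  · exact (map_zero A).trans (map_zero B).symm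
  · exact (map_add A x y).trans ((congrArg₂ _ hx hy).trans (map_add B x y).symm)
  · exact (map_smul A c x).trans ((congrArg _ hx).trans (map_smul B c x).symm)

end Columns

section Solutions

variable {k : Type u} [NormedAddCommGroup k] [InnerProductSpace ℂ k] [CompleteSpace k]
variable {h : Type v} [NormedAddCommGroup h] [InnerProductSpace ℂ h]
variable {h' : Type w} [NormedAddCommGroup h'] [InnerProductSpace ℂ h'] [CompleteSpace h']
variable {V : Submodule ℂ (h →L[ℂ] h')} [FiniteDimensional ℂ V] {D D' : Submodule ℂ k}
variable {kk : OpFamily V D}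

/-- The weak integral equation already identifies the divergence against `D'`-valued test functions;
right-regularity of the integrand, including the jumps of `g`, extends this to all test functions.
-/
theorem IsHolderCocycle.isStrongSolution (hk : IsHolderCocycle kk D') (hD' : Dense (D' : Set k))
    {ι : Type*} [Fintype ι] {b : ι → V} {T : ι → V →ₗ[ℂ] OpDagger (hatSub D) (hatSub D')}
    (hφ : IsSemigroupGenerator hk.cocycle.slices (sumTensor b T)) :
    IsStrongSolution (sumTensor b T) kk := by
  refine ⟨hk.cocycle.isProcess, integrand kk b T, hk.isQSIntegrable_integrand hD',
    fun t x ζ' ζ a e a' f => inner_integrand_domVec3 t x a ζ e a' ζ' f, fun t x a g => ?_⟩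
  refine isDivergence_of_dense hD'
    (hk.rightRegular_integrand hD' x a (evE g) ((piecewiseConst_valS g).comp hatS))
    fun a' g' hg' => ?_
  rw [inner_sub_right, inner_tmulH]
  refine (hk.integral_eq hD' hφ t x a' ⟨g', hg'⟩ a g).trans ?_
  refine intervalIntegral.integral_congr fun s _ => ?_
  exact (inner_integrand_domVec3 _ _ _ _ _ _ _ _).symm

/-- With the test vectors fixed, expanding `φ^{ĝ'(s)}_{ĝ(s)}(b_i)` in the basis turns the weak
equation into a closed finite linear system with piecewise constant coefficients. -/
theorem IsHolderCocycle.eq_of_isWeakSolution (hk : IsHolderCocycle kk D')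
    (hD' : Dense (D' : Set k)) {φ : V →ₗ[ℂ] V ⊗[ℂ] OpDagger (hatSub D) (hatSub D')}
    (hφ : IsSemigroupGenerator hk.cocycle.slices φ) {kk' : OpFamily V D}
    (hk' : IsWeakSolution φ kk') : kk' = kk := by
  let b := Module.finBasis ℂ V
  refine funext fun t => b.ext fun i => eq_of_column_eq hD' fun a' g' a g => ?_
  let ξ' : HTensor h' (NoiseFock k) := tmulH a' (ev (g' : ℝ → k))
  let δ : ℝ → Fin (Module.finrank ℂ V) → ℂ := fun s i =>
    ⟪ξ', column (kk' s.toNNReal (b i)) (evE g) a⟫_ℂ - ⟪ξ', column (kk s.toNNReal (b i)) (evE g) a⟫_ℂ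
  have hcont' (x : V) : Continuous fun s : ℝ => ⟪ξ', column (kk' s.toNNReal x) (evE g) a⟫_ℂ :=
    (hk'.continuous x (domVec ⟨a', trivial⟩ (evE g')) (domVec ⟨a, trivial⟩ (evE g))).comp
      continuous_real_toNNReal
  have hcont (x : V) : Continuous fun s : ℝ => ⟪ξ', column (kk s.toNNReal x) (evE g) a⟫_ℂ := by
    have h1 := hk.continuous_kgg g' g x
      (matrixFunctional ⟪ev (g' : ℝ → k), ev (g : ℝ → k)⟫_ℂ a' a)
    simpa only [hk.cocycle.matrixFunctional_kgg] using h1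
  let y (i : Fin (Module.finrank ℂ V)) (s : ℝ) : V :=
    component φ (hat ((g' : ℝ → k) s)) (hatS (valS g s)) (b i)
  have hy (i : Fin (Module.finrank ℂ V)) : PiecewiseConst (y i) :=
    ((piecewiseConst_valS g').prodMk (piecewiseConst_valS g)).comp
      fun p : D' × D => component φ (hat (p.1 : k)) (hatS p.2) (b i)
  have hsum {kk : OpFamily V D} (s : ℝ) (z : V) : ⟪ξ', column (kk s.toNNReal z) (evE g) a⟫_ℂ =
      ∑ j, b.coord j z * ⟪ξ', column (kk s.toNNReal (b j)) (evE g) a⟫_ℂ := by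
    conv_lhs => rw [← b.sum_repr z, column_sum, inner_sum]
    exact Finset.sum_congr rfl fun j _ => inner_smul_right _ _ _
  have hreg {kk : OpFamily V D}
      (hcont : ∀ x, Continuous fun s : ℝ => ⟪ξ', column (kk s.toNNReal x) (evE g) a⟫_ℂ)
      (i : Fin (Module.finrank ℂ V)) :
      RightRegular fun s => ⟪ξ', column (kk s.toNNReal (y i s)) (evE g) a⟫_ℂ := by
    simp only [hsum _ (y i _)]
    exact RightRegular.sum fun j _ => ((hy i).comp (b.coord j)).rightRegular.clm₂
      (ContinuousLinearMap.mul ℂ ℂ) (hcont (b j)).rightRegular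
  have h1 := eq_zero_of_integral_eq (δ := δ) (M := fun i j s => b.coord j (y i s))
    (continuous_pi fun i => (hcont' (b i)).sub (hcont (b i)))
    (fun i j => ((hy i).comp (b.coord j)).rightRegular) (fun s hs i => ?_) t.coe_nonneg
  · have h2 := congrFun h1 i
    simp only [δ, Real.toNNReal_coe] at h2
    exact sub_eq_zero.mp h2
  · have h2 := hk'.integral_eq s.toNNReal (b i) a' g' a g
    have h3 := hk.integral_eq hD' hφ s.toNNReal (b i) a' g' a g
    rw [Real.coe_toNNReal s hs] at h2 h3
    -- The initial terms `⟪a', b_i a⟫ ⟪ε(g'), ε(g)⟫` are common to both solutions and cancel.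
    have h4 : δ s i = (∫ r in (0 : ℝ)..s, ⟪ξ', column (kk' r.toNNReal (y i r)) (evE g) a⟫_ℂ) -
        ∫ r in (0 : ℝ)..s, ⟪ξ', column (kk r.toNNReal (y i r)) (evE g) a⟫_ℂ := by
      refine Eq.trans ?_ (congrArg₂ (· - ·) h2 h3)
      exact (sub_sub_sub_cancel_right _ _ _).symm
    rw [h4, ← intervalIntegral.integral_sub ((hreg hcont' i).intervalIntegrable 0 s)
      ((hreg hcont i).intervalIntegrable 0 s)]
    refine intervalIntegral.integral_congr fun r _ => ?_
    simp only [δ, mul_sub, Finset.sum_sub_distrib]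
    rw [← hsum, ← hsum]

end Solutions

end

end QS

theorem mainTheorem3
    {k h h' : Type*}
    [NormedAddCommGroup k] [InnerProductSpace ℂ k] [CompleteSpace k]
    [NormedAddCommGroup h] [InnerProductSpace ℂ h] [CompleteSpace h]
    [NormedAddCommGroup h'] [InnerProductSpace ℂ h'] [CompleteSpace h']
    (D D' : Submodule ℂ k) (hD : Dense (D : Set k)) (hD' : Dense (D' : Set k))
    (V : Submodule ℂ (h →L[ℂ] h')) [FiniteDimensional ℂ V]
    (kk : QS.OpFamily V D) (hkk : QS.IsHolderCocycle kk D') :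
    ∃ φ : V →ₗ[ℂ] V ⊗[ℂ] QS.OpDagger (QS.hatSub D) (QS.hatSub D'),
      QS.IsGeneratedBy φ kk := by
  obtain ⟨T, hT⟩ := hkk.exists_generator hD hD' (Module.finBasis ℂ V)
  obtain ⟨m, hm⟩ := hkk.exists_coefficient hD' (Module.finBasis ℂ V)
  exact ⟨QS.sumTensor (Module.finBasis ℂ V) T, hm.slicesInto_top hD', hkk.isStrongSolution hD' hT,
    fun _ hkk' => hkk.eq_of_isWeakSolution hD' hT hkk'⟩
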